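/- Let $\varphi$ be a smooth real function on $[-1,1]$, put $\lambda(t)=e^{-i\varphi(t)}$, $\bar\lambda(t)=e^{i\varphi(t)}$, and write $\dot f$ for the derivative of $f\in C^\infty([-1,1])$. **The algebra.** Let $\mathcal S^4_\lambda$ be the unital complex algebra generated by the smooth functions $f(t)$, $f\in C^\infty([-1,1])$ (a central subalgebra), and by $x^1=a$, $x^2=a^*$, $x^3=b$, $x^4=b^*$, with the relations $x^ix^j=A_{ij}\,x^jx^i$ and $aa^*+bb^*+t^2=1$, where $$A=\begin{pmatrix}1&1&\lambda&\bar\lambda\\1&1&\bar\lambda&\lambda\\ \bar\lambda&\lambda&1&1\\ \lambda&\bar\lambda&1&1\end{pmatrix}.$$ **The differential algebra.** Let $B_{ij}=A_{ij}^{-1}\dot A_{ij}$. Let $\Omega_u(\mathcal S^4_\lambda)$ be the universal differential algebra of $\mathcal S^4_\lambda$, and $\mathcal J^1\subset\Omega^1_u(\mathcal S^4_\lambda)$ the sub-bimodule generated by the relations $$d(f(t))=\dot f(t)\,dt,\qquad y\,dt=dt\,y\ \ (y\in\mathcal S^4_\lambda),\qquad t\,dx^i=dx^i\,t,$$ $$x^i\,dx^j=A_{ij}\,dx^j\,x^i+\tfrac12B_{ij}\,dt\,x^ix^j,\qquad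 a\,da^*+a^*\,da+b\,db^*+b^*\,db+2t\,dt=0 .$$ Let $\Omega(\mathcal S^4_\lambda)=\bigoplus_n\Omega^n(\mathcal S^4_\lambda)$ be the quotient of $\Omega_u(\mathcal S^4_\lambda)$ by the two-sided ideal generated by $\mathcal J^1+d\mathcal J^1$, with the induced differential $d$, and let $$\omega=\tfrac14\bigl(t\,da\,da^*\,db\,db^*-2\,a\,dt\,da^*\,db\,db^*+2\,dt\,da\,da^*\,db\,b^*\bigr)\in\Omega^4(\mathcal S^4_\lambda).$$ **Statement.** There is exactly one linear functional $\int:\Omega^4(\mathcal S^4_\lambda)\to\mathbb C$ such that $\int x\,\omega=\int_{S^4}\eta(x)$ for all $x\in\mathcal S^4_\lambda$; that is, for all $f\in C^\infty([-1,1])$ and all integers $i,j,k,l\ge0$, $$\int f(t)\,a^i(a^*)^jb^k(b^*)^l\,\omega=\int_{S^4}f(t)\,a^i\,\bar a^{\,j}\,b^k\,\bar b^{\,l},$$ where on the right $S^4=\{(a,b,t)\in\mathbb C^2\times\mathbb R:|a|^2+|b|^2+t^2=1\}$ carries its surface measure (of total mass $\tfrac83\pi^2$). This functional is a closed graded trace: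 $\int d\rho=0$ for every $\rho\in\Omega^3(\mathcal S^4_\lambda)$, and $\int\rho\sigma=(-1)^{pq}\int\sigma\rho$ for all $\rho\in\Omega^p(\mathcal S^4_\lambda)$, $\sigma\in\Omega^q(\mathcal S^4_\lambda)$ with $p+q=4$. The $5$-linear functional $$\psi(a_0,a_1,a_2,a_3,a_4)=\int a_0\,da_1\,da_2\,da_3\,da_4$$ is a cyclic $4$-cocycle on $\mathcal S^4_\lambda$: for all elements of $\mathcal S^4_\lambda$, $\psi(a_1,a_2,a_3,a_4,a_0)=\psi(a_0,a_1,a_2,a_3,a_4)$ and $$\sum_{i=0}^{4}(-1)^i\psi(a_0,\dots,a_ia_{i+1},\dots,a_5)-\psi(a_5a_0,a_1,a_2,a_3,a_4)=0 .$$ -/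

import Mathlib

open scoped ContDiff ComplexConjugate

noncomputable section

/-! ## Differential algebras over a complex algebra -/

section DifferentialAlgebra

variable (A : Type) [Ring A] [Algebra ℂ A]

/-- The relations of the universal differential algebra of `A` between the symbols `a`
(`Sum.inl a`) and `da` (`Sum.inr a`): the symbols `a` multiply as in `A`, and `d` is a
linear derivation. -/
inductive UnivRel : FreeAlgebra ℂ (A ⊕ A) → FreeAlgebra ℂ (A ⊕ A) → Prop
  | add (x y : A) : UnivRel (FreeAlgebra.ι ℂ (Sum.inl (x + y)))
      (FreeAlgebra.ι ℂ (Sum.inl x) + FreeAlgebra.ι ℂ (Sum.inl y))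
  | mul (x y : A) : UnivRel (FreeAlgebra.ι ℂ (Sum.inl (x * y)))
      (FreeAlgebra.ι ℂ (Sum.inl x) * FreeAlgebra.ι ℂ (Sum.inl y))
  | scalar (c : ℂ) : UnivRel (FreeAlgebra.ι ℂ (Sum.inl (algebraMap ℂ A c)))
      (algebraMap ℂ (FreeAlgebra ℂ (A ⊕ A)) c)
  | d_add (x y : A) : UnivRel (FreeAlgebra.ι ℂ (Sum.inr (x + y)))
      (FreeAlgebra.ι ℂ (Sum.inr x) + FreeAlgebra.ι ℂ (Sum.inr y))
  | d_smul (c : ℂ) (x : A) : UnivRel (FreeAlgebra.ι ℂ (Sum.inr (c • x)))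
      (c • FreeAlgebra.ι ℂ (Sum.inr x))
  | d_mul (x y : A) : UnivRel (FreeAlgebra.ι ℂ (Sum.inr (x * y)))
      (FreeAlgebra.ι ℂ (Sum.inl x) * FreeAlgebra.ι ℂ (Sum.inr y) +
        FreeAlgebra.ι ℂ (Sum.inr x) * FreeAlgebra.ι ℂ (Sum.inl y))

/-- The universal differential algebra `Ω_u(A)`. -/
def UnivForms : Type := RingQuot (UnivRel A)

instance : Ring (UnivForms A) := inferInstanceAs (Ring (RingQuot (UnivRel A)))

instance : Algebra ℂ (UnivForms A) := inferInstanceAs (Algebra ℂ (RingQuot (UnivRel A)))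

namespace UnivForms

/-- The projection of the free algebra on the symbols `a` and `da`. -/
def mk : FreeAlgebra ℂ (A ⊕ A) →ₐ[ℂ] UnivForms A := RingQuot.mkAlgHom ℂ (UnivRel A)

theorem mk_surjective : Function.Surjective (mk A) := RingQuot.mkAlgHom_surjective ℂ (UnivRel A)

variable {A}

theorem mk_rel {u v : FreeAlgebra ℂ (A ⊕ A)} (h : UnivRel A u v) : mk A u = mk A v :=
  RingQuot.mkAlgHom_rel ℂ h

/-- The homomorphism induced by one that respects the relations. -/
def lift {B : Type} [Ring B] [Algebra ℂ B] (f : FreeAlgebra ℂ (A ⊕ A) →ₐ[ℂ] B)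
    (hf : ∀ ⦃u v⦄, UnivRel A u v → f u = f v) : UnivForms A →ₐ[ℂ] B :=
  RingQuot.liftAlgHom ℂ ⟨f, hf⟩

theorem lift_mk {B : Type} [Ring B] [Algebra ℂ B] (f : FreeAlgebra ℂ (A ⊕ A) →ₐ[ℂ] B)
    (hf : ∀ ⦃u v⦄, UnivRel A u v → f u = f v) (u : FreeAlgebra ℂ (A ⊕ A)) :
    lift f hf (mk A u) = f u :=
  RingQuot.liftAlgHom_mkAlgHom_apply ℂ f hf u

/-- The symbol `a`. -/
def sym (x : A) : UnivForms A :=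
  mk A (FreeAlgebra.ι ℂ (Sum.inl x))

/-- The symbol `da`. -/
def dsym (x : A) : UnivForms A :=
  mk A (FreeAlgebra.ι ℂ (Sum.inr x))

theorem sym_mul (x y : A) : sym (x * y) = sym x * sym y := by
  simpa [sym] using mk_rel (UnivRel.mul x y)

theorem sym_add (x y : A) : sym (x + y) = sym x + sym y := by
  simpa [sym] using mk_rel (UnivRel.add x y)

theorem sym_algebraMap (c : ℂ) :
    sym (algebraMap ℂ A c) = algebraMap ℂ (UnivForms A) c := by
  simpa [sym] using mk_rel (UnivRel.scalar (A := A) c)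

theorem dsym_add (x y : A) : dsym (x + y) = dsym x + dsym y := by
  simpa [dsym] using mk_rel (UnivRel.d_add x y)

theorem dsym_smul (c : ℂ) (x : A) : dsym (c • x) = c • dsym x := by
  simpa [dsym] using mk_rel (UnivRel.d_smul c x)

theorem dsym_mul (x y : A) : dsym (x * y) = sym x * dsym y + dsym x * sym y := by
  simpa [sym, dsym] using mk_rel (UnivRel.d_mul x y)

/-- The inclusion of `A` as the forms of degree zero. -/
def incl : A →ₐ[ℂ] UnivForms A :=
  AlgHom.mk' (R := ℂ)
    { toFun := sym
      map_one' := by simpa using sym_algebraMap (A := A) 1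
      map_mul' := sym_mul
      map_zero' := by simpa using sym_algebraMap (A := A) 0
      map_add' := sym_add }
    (fun c x => by
      change sym (c • x) = c • sym x
      rw [Algebra.smul_def, sym_mul, sym_algebraMap, Algebra.smul_def])

/-- The differential `A → Ω_u¹(A)`. -/
def dincl : A →ₗ[ℂ] UnivForms A where
  toFun := dsym
  map_add' := dsym_add
  map_smul' := dsym_smul

theorem dincl_mul (x y : A) :
    dincl (x * y) = incl x * dincl y + dincl x * incl y := dsym_mul x y

theorem induction {P : UnivForms A → Prop}
    (scalar : ∀ c : ℂ, P (algebraMap ℂ _ c)) (h0 : ∀ x : A, P (incl x))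
    (h1 : ∀ x : A, P (dincl x)) (hadd : ∀ x y, P x → P y → P (x + y))
    (hmul : ∀ x y, P x → P y → P (x * y)) (x : UnivForms A) : P x := by
  obtain ⟨y, rfl⟩ := mk_surjective A x
  induction y using FreeAlgebra.induction with
  | grade0 c => simpa using scalar c
  | grade1 s =>
    cases s with
    | inl s => exact h0 s
    | inr s => exact h1 s
  | mul a b ha hb => rw [map_mul]; exact hmul _ _ ha hb
  | add a b ha hb => rw [map_add]; exact hadd _ _ ha hb

/-- The algebra homomorphism `x ↦ (ε(x), dx; 0, x)`, where `ε` is the grading involution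
(`(-1)^n` on `n`-forms); that it is multiplicative is the graded Leibniz rule. -/
def triang : UnivForms A →ₐ[ℂ] Matrix (Fin 2) (Fin 2) (UnivForms A) :=
  lift (FreeAlgebra.lift ℂ (Sum.elim
      (fun x => !![incl x, dincl x; 0, incl x])
      (fun x => !![-dincl x, 0; 0, dincl x]))) <| by
    intro u v h
    cases h with
    | add x y => ext i j; fin_cases i <;> fin_cases j <;> simp
    | mul x y =>
      ext i j; fin_cases i <;> fin_cases j <;> simp [Matrix.mul_apply, dincl_mul]
    | scalar c =>
      have h : dincl (algebraMap ℂ A c) = 0 := by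
        have h1 : dincl (1 : A) = 0 := by
          have := dincl_mul (1 : A) 1
          simpa using this
        rw [Algebra.algebraMap_eq_smul_one, map_smul, h1, smul_zero]
      ext i j; fin_cases i <;> fin_cases j <;>
        simp [h, Matrix.algebraMap_matrix_apply]
    | d_add x y =>
      ext i j; fin_cases i <;> fin_cases j <;> simp [add_comm]
    | d_smul c x => ext i j; fin_cases i <;> fin_cases j <;> simp
    | d_mul x y =>
      ext i j; fin_cases i <;> fin_cases j <;>
        simp [Matrix.mul_apply, dincl_mul, add_comm]

/-- The differential of `Ω_u(A)`. -/
def d : UnivForms A →ₗ[ℂ] UnivForms A where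
  toFun x := triang x 0 1
  map_add' x y := by simp
  map_smul' c x := by simp

/-- The grading involution of `Ω_u(A)`. -/
def parity (x : UnivForms A) : UnivForms A := triang x 0 0

theorem triang_incl (x : A) : triang (incl x) = !![incl x, dincl x; 0, incl x] := by
  change triang (mk A _) = _
  rw [triang, lift_mk, FreeAlgebra.lift_ι_apply, Sum.elim_inl]

theorem triang_dincl (x : A) : triang (dincl x) = !![-dincl x, 0; 0, dincl x] := by
  change triang (mk A _) = _
  rw [triang, lift_mk, FreeAlgebra.lift_ι_apply, Sum.elim_inr]

theorem triang_snd (x : UnivForms A) : triang x 1 0 = 0 ∧ triang x 1 1 = x := by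
  induction x using induction with
  | scalar c => simp [Matrix.algebraMap_matrix_apply]
  | h0 x => simp [triang_incl]
  | h1 x => simp [triang_dincl]
  | hadd x y hx hy => simp [hx, hy]
  | hmul x y hx hy => simp [Matrix.mul_apply, hx, hy]

theorem d_incl (x : A) : d (incl x) = dincl x := by simp [d, triang_incl]
theorem d_dincl (x : A) : d (dincl x) = 0 := by simp [d, triang_dincl]
theorem parity_incl (x : A) : parity (incl x) = incl x := by simp [parity, triang_incl]
theorem parity_dincl (x : A) : parity (dincl x) = -dincl x := by
  simp [parity, triang_dincl]

theorem parity_mul (x y : UnivForms A) : parity (x * y) = parity x * parity y := by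
  simp [parity, Matrix.mul_apply, (triang_snd y).1]

theorem parity_add (x y : UnivForms A) : parity (x + y) = parity x + parity y := by
  simp [parity]

theorem parity_sub (x y : UnivForms A) : parity (x - y) = parity x - parity y := by
  simp [parity]

theorem d_mul (x y : UnivForms A) : d (x * y) = parity x * d y + d x * y := by
  simp [d, parity, Matrix.mul_apply, (triang_snd y).2]

theorem parity_algebraMap (c : ℂ) :
    parity (algebraMap ℂ (UnivForms A) c) = algebraMap ℂ (UnivForms A) c := by
  simp [parity, Matrix.algebraMap_matrix_apply]

theorem d_algebraMap (c : ℂ) : d (algebraMap ℂ (UnivForms A) c) = 0 := by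
  simp [d, Matrix.algebraMap_matrix_apply]

theorem d_d_aux (x : UnivForms A) : d (d x) = 0 ∧ d (parity x) = -parity (d x) := by
  have hz : parity (0 : UnivForms A) = 0 := by simp [parity]
  have hn : ∀ z : UnivForms A, parity (-z) = -parity z := fun z => by simp [parity]
  induction x using induction with
  | scalar c => simp [parity_algebraMap, d_algebraMap, hz]
  | h0 x => simp [d_incl, d_dincl, parity_incl, parity_dincl]
  | h1 x => simp [d_dincl, parity_dincl, hz]
  | hadd x y hx hy =>
    simp only [map_add, parity_add, hx, hy, add_zero, true_and]; abel
  | hmul x y hx hy =>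
    simp only [d_mul, map_add, parity_add, parity_mul, hx, hy]
    constructor <;> simp [add_comm]

theorem d_d (x : UnivForms A) : d (d x) = 0 := (d_d_aux x).1

end UnivForms

open UnivForms

variable {A}

/-- The sub-bimodule of `Ω_u¹(A)` generated by a set of relations. -/
def relBimodule (S : Set (UnivForms A)) : Submodule ℂ (UnivForms A) :=
  Submodule.span ℂ {w | ∃ x y : A, ∃ s ∈ S, w = incl x * s * incl y}

/-- The quotient of `Ω_u(A)` by the two-sided ideal generated by `J + dJ`, where `J` is the
sub-bimodule generated by `S`. -/
abbrev FormsMod (S : Set (UnivForms A)) : Type :=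
  RingQuot (fun x y : UnivForms A =>
    (x ∈ relBimodule S ∨ ∃ j ∈ relBimodule S, x = UnivForms.d j) ∧ y = 0)

namespace FormsMod

variable (S : Set (UnivForms A))

/-- The projection `Ω_u(A) → Ω(A)`. -/
def proj : UnivForms A →ₐ[ℂ] FormsMod S := RingQuot.mkAlgHom ℂ _

variable {S}

theorem proj_eq_zero {x : UnivForms A} (hx : x ∈ relBimodule S) : proj S x = 0 := by
  have := RingQuot.mkAlgHom_rel ℂ (s := fun x y : UnivForms A =>
    (x ∈ relBimodule S ∨ ∃ j ∈ relBimodule S, x = UnivForms.d j) ∧ y = 0)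
    (x := x) (y := 0) ⟨Or.inl hx, rfl⟩
  simpa [proj] using this

theorem proj_d_eq_zero {x : UnivForms A} (hx : x ∈ relBimodule S) :
    proj S (UnivForms.d x) = 0 := by
  have := RingQuot.mkAlgHom_rel ℂ (s := fun x y : UnivForms A =>
    (x ∈ relBimodule S ∨ ∃ j ∈ relBimodule S, x = UnivForms.d j) ∧ y = 0)
    (x := UnivForms.d x) (y := 0) ⟨Or.inr ⟨x, hx, rfl⟩, rfl⟩
  simpa [proj] using this

theorem parity_of_mem (hS : ∀ s ∈ S, parity s = -s) {x : UnivForms A}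
    (hx : x ∈ relBimodule S) : parity x = -x := by
  induction hx using Submodule.span_induction with
  | mem x h =>
    obtain ⟨a, b, s, hs, rfl⟩ := h
    simp [parity_mul, parity_incl, hS s hs]
  | zero => simp [parity]
  | add x y _ _ hx hy => rw [parity_add, hx, hy]; abel
  | smul c x _ hx =>
    have : parity (c • x) = c • parity x := by simp [parity]
    rw [this, hx, smul_neg]

/-- The homomorphism `x ↦ (ε(x), dx; 0, x)` on the quotient. -/
def triang (hS : ∀ s ∈ S, parity s = -s) :
    FormsMod S →ₐ[ℂ] Matrix (Fin 2) (Fin 2) (FormsMod S) :=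
  RingQuot.liftAlgHom ℂ ⟨((proj S).mapMatrix).comp UnivForms.triang, by
    rintro u v ⟨h, rfl⟩
    rw [map_zero]
    have key : ∀ x : UnivForms A, proj S (parity x) = 0 → proj S (UnivForms.d x) = 0 →
        proj S x = 0 → ((proj S).mapMatrix.comp UnivForms.triang) x = 0 := by
      intro x h1 h2 h3
      ext i j
      fin_cases i <;> fin_cases j
      · exact h1
      · exact h2
      · simp [(triang_snd x).1]
      · simp [(triang_snd x).2, h3]
    rcases h with h | ⟨j, hj, rfl⟩
    · refine key u ?_ (proj_d_eq_zero h) (proj_eq_zero h)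
      rw [parity_of_mem hS h, map_neg, proj_eq_zero h, neg_zero]
    · refine key _ ?_ ?_ (proj_d_eq_zero hj)
      · have h2 := (d_d_aux j).2
        rw [parity_of_mem hS hj, map_neg, neg_inj] at h2
        rw [← h2, proj_d_eq_zero hj]
      · rw [d_d, map_zero]⟩

theorem triang_proj (hS : ∀ s ∈ S, parity s = -s) (x : UnivForms A) :
    triang hS (proj S x) = (proj S).mapMatrix (UnivForms.triang x) :=
  RingQuot.liftAlgHom_mkAlgHom_apply ℂ _ _ x

/-- The differential of the quotient, induced by the one of `Ω_u(A)`. -/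
def d (hS : ∀ s ∈ S, parity s = -s) : FormsMod S →ₗ[ℂ] FormsMod S where
  toFun x := triang hS x 0 1
  map_add' x y := by simp
  map_smul' c x := by simp

theorem d_proj (hS : ∀ s ∈ S, parity s = -s) (x : UnivForms A) :
    d hS (proj S x) = proj S (UnivForms.d x) := by
  change triang hS (proj S x) 0 1 = _
  rw [triang_proj]
  rfl

variable (S)

/-- The algebra `A` mapped to the forms of degree zero. -/
def incl : A →ₐ[ℂ] FormsMod S := (proj S).comp UnivForms.incl

/-- The differential `a ↦ da` on elements of `A`. -/
def dincl : A →ₗ[ℂ] FormsMod S := (proj S).toLinearMap ∘ₗ UnivForms.dincl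

variable {S} in
theorem dincl_mul (x y : A) :
    dincl S (x * y) = incl S x * dincl S y + dincl S x * incl S y := by
  simp [dincl, incl, UnivForms.dincl_mul]

/-- The multilinear map `(a₀, …, aₙ) ↦ a₀ da₁ ⋯ daₙ`. -/
def monomial (n : ℕ) : MultilinearMap ℂ (fun _ : Fin (n + 1) => A) (FormsMod S) :=
  (MultilinearMap.mkPiAlgebraFin ℂ (n + 1) (FormsMod S)).compLinearMap
    (fun i => if i = 0 then (incl S).toLinearMap else dincl S)

/-- The `n`-forms: the linear combinations of the `a₀ da₁ ⋯ daₙ`. -/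
def deg (n : ℕ) : Submodule ℂ (FormsMod S) :=
  Submodule.span ℂ (Set.range (monomial S n))

variable {S}

theorem monomial_apply (n : ℕ) (v : Fin (n + 1) → A) :
    monomial S n v =
      incl S (v 0) * (List.ofFn fun i : Fin n => dincl S (v i.succ)).prod := by
  simp [monomial, List.ofFn_succ]

theorem incl_mem (x : A) : incl S x ∈ deg S 0 :=
  Submodule.subset_span ⟨fun _ => x, by simp [monomial_apply]⟩

theorem dincl_mem (x : A) : dincl S x ∈ deg S 1 :=
  Submodule.subset_span ⟨![1, x], by simp [monomial_apply]⟩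

theorem incl_mul_mem (x : A) {n : ℕ} {w : FormsMod S} (hw : w ∈ deg S n) :
    incl S x * w ∈ deg S n := by
  induction hw using Submodule.span_induction with
  | mem w h =>
    obtain ⟨v, rfl⟩ := h
    refine Submodule.subset_span ⟨Fin.cons (x * v 0) (fun i => v i.succ), ?_⟩
    simp [monomial_apply, mul_assoc]
  | zero => simp
  | add a b _ _ ha hb => rw [mul_add]; exact add_mem ha hb
  | smul c a _ ha => rw [mul_smul_comm]; exact Submodule.smul_mem _ _ ha

theorem mul_dincl_mem (x : A) {n : ℕ} {w : FormsMod S} (hw : w ∈ deg S n) :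
    w * dincl S x ∈ deg S (n + 1) := by
  induction hw using Submodule.span_induction with
  | mem w h =>
    obtain ⟨v, rfl⟩ := h
    refine Submodule.subset_span ⟨Fin.snoc v x, ?_⟩
    rw [monomial_apply, monomial_apply, List.ofFn_succ']
    have h0 : (Fin.snoc v x : Fin (n + 2) → A) 0 = v 0 := by
      rw [← Fin.castSucc_zero, Fin.snoc_castSucc]
    have h1 : ∀ i : Fin n, (Fin.snoc v x : Fin (n + 2) → A) i.castSucc.succ = v i.succ := by
      intro i
      rw [Fin.succ_castSucc, Fin.snoc_castSucc]
    have h2 : (Fin.snoc v x : Fin (n + 2) → A) (Fin.last n).succ = x := by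
      rw [Fin.succ_last, Fin.snoc_last]
    simp only [h0, h1, h2, List.concat_eq_append, List.prod_append, List.prod_singleton,
      mul_assoc]
  | zero => simp
  | add a b _ _ ha hb => rw [add_mul]; exact add_mem ha hb
  | smul c a _ ha => rw [smul_mul_assoc]; exact Submodule.smul_mem _ _ ha

theorem deg_succ (n : ℕ) {P : FormsMod S → Prop} (h0 : P 0)
    (hadd : ∀ a b, P a → P b → P (a + b)) (hsmul : ∀ (c : ℂ) a, P a → P (c • a))
    (hm : ∀ w ∈ deg S n, ∀ x, P (w * dincl S x)) {w : FormsMod S}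
    (hw : w ∈ deg S (n + 1)) : P w := by
  induction hw using Submodule.span_induction with
  | mem w h =>
    obtain ⟨v, rfl⟩ := h
    have : monomial S (n + 1) v =
        monomial S n (fun i => v i.castSucc) * dincl S (v (Fin.last (n + 1))) := by
      rw [monomial_apply, monomial_apply, List.ofFn_succ']
      simp [mul_assoc]
    rw [this]
    exact hm _ (Submodule.subset_span ⟨_, rfl⟩) _
  | zero => exact h0
  | add a b _ _ ha hb => exact hadd _ _ ha hb
  | smul c a _ ha => exact hsmul _ _ ha

theorem mul_incl_mem (x : A) {n : ℕ} {w : FormsMod S} (hw : w ∈ deg S n) :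
    w * incl S x ∈ deg S n := by
  induction n generalizing x w with
  | zero =>
    induction hw using Submodule.span_induction with
    | mem w h =>
      obtain ⟨v, rfl⟩ := h
      have : monomial S 0 v * incl S x = incl S (v 0 * x) := by simp [monomial_apply]
      rw [this]
      exact incl_mem _
    | zero => simp
    | add a b _ _ ha hb => rw [add_mul]; exact add_mem ha hb
    | smul c a _ ha => rw [smul_mul_assoc]; exact Submodule.smul_mem _ _ ha
  | succ n ih =>
    refine deg_succ n (P := fun w => w * incl S x ∈ deg S (n + 1)) ?_ ?_ ?_ ?_ hw
    · simp
    · intro a b ha hb; rw [add_mul]; exact add_mem ha hb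
    · intro c a ha; rw [smul_mul_assoc]; exact Submodule.smul_mem _ _ ha
    · intro w hw y
      have : w * dincl S y * incl S x =
          w * dincl S (y * x) - w * incl S y * dincl S x := by
        rw [dincl_mul]; noncomm_ring
      rw [this]
      exact sub_mem (mul_dincl_mem _ hw) (mul_dincl_mem _ (ih _ hw))

theorem mul_mem {m n : ℕ} {w z : FormsMod S} (hw : w ∈ deg S m) (hz : z ∈ deg S n) :
    w * z ∈ deg S (m + n) := by
  induction n generalizing z with
  | zero =>
    induction hz using Submodule.span_induction with
    | mem z h =>
      obtain ⟨v, rfl⟩ := h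
      have : monomial S 0 v = incl S (v 0) := by simp [monomial_apply]
      rw [this]
      exact mul_incl_mem _ hw
    | zero => simp
    | add a b _ _ ha hb => rw [mul_add]; exact add_mem ha hb
    | smul c a _ ha => rw [mul_smul_comm]; exact Submodule.smul_mem _ _ ha
  | succ n ih =>
    refine deg_succ n (P := fun z => w * z ∈ deg S (m + (n + 1))) ?_ ?_ ?_ ?_ hz
    · simp
    · intro a b ha hb; rw [mul_add]; exact add_mem ha hb
    · intro c a ha; rw [mul_smul_comm]; exact Submodule.smul_mem _ _ ha
    · intro z hz y
      rw [← mul_assoc]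
      exact mul_dincl_mem _ (ih hz)

theorem d_mul_dincl (hS : ∀ s ∈ S, parity s = -s) (w : FormsMod S) (x : A) :
    d hS (w * dincl S x) = d hS w * dincl S x := by
  obtain ⟨u, rfl⟩ : ∃ u, proj S u = w := RingQuot.mkAlgHom_surjective ℂ _ w
  have : proj S u * dincl S x = proj S (u * UnivForms.dincl x) := by simp [dincl]
  rw [this, d_proj, d_proj, UnivForms.d_mul, d_dincl]
  simp [dincl]

theorem d_mem (hS : ∀ s ∈ S, parity s = -s) {n : ℕ} {w : FormsMod S} (hw : w ∈ deg S n) :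
    d hS w ∈ deg S (n + 1) := by
  induction n generalizing w with
  | zero =>
    induction hw using Submodule.span_induction with
    | mem w h =>
      obtain ⟨v, rfl⟩ := h
      have : monomial S 0 v = proj S (UnivForms.incl (v 0)) := by
        simp [monomial_apply, incl]
      rw [this, d_proj, d_incl]
      exact dincl_mem _
    | zero => simp
    | add a b _ _ ha hb => rw [map_add]; exact add_mem ha hb
    | smul c a _ ha => rw [map_smul]; exact Submodule.smul_mem _ _ ha
  | succ n ih =>
    refine deg_succ n (P := fun w => d hS w ∈ deg S (n + 1 + 1)) ?_ ?_ ?_ ?_ hw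
    · simp
    · intro a b ha hb; rw [map_add]; exact add_mem ha hb
    · intro c a ha; rw [map_smul]; exact Submodule.smul_mem _ _ ha
    · intro w hw y
      rw [d_mul_dincl]
      exact mul_dincl_mem _ (ih hw)

end FormsMod

/-- An `(n+1)`-linear functional `ψ` on `A` is a cyclic `n`-cocycle:
`ψ(a₁, …, aₙ, a₀) = (-1)ⁿ ψ(a₀, …, aₙ)`, and its Hochschild coboundary vanishes, that is
`∑_{i=0}^{n} (-1)^i ψ(a₀, …, a_i a_{i+1}, …, a_{n+1}) + (-1)^{n+1} ψ(a_{n+1} a₀, a₁, …, aₙ) = 0`. -/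
def IsCyclicCocycle {n : ℕ} (ψ : MultilinearMap ℂ (fun _ : Fin (n + 1) => A) ℂ) : Prop :=
  (∀ a : Fin (n + 1) → A, ψ (fun i => a (i + 1)) = (-1) ^ n * ψ a) ∧
  (∀ a : Fin (n + 2) → A,
    ∑ i : Fin (n + 1), (-1) ^ (i : ℕ) * ψ (Fin.contractNth i.castSucc (· * ·) a) +
      (-1) ^ (n + 1) *
        ψ (Fin.cons (a (Fin.last (n + 1)) * a 0) (fun i : Fin n => a i.castSucc.succ)) = 0)

end DifferentialAlgebra

/-! ## The deformed four-sphere -/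

/-- A function on `[-1, 1]`, extended to the line by constants. -/
def extendI (f : Set.Icc (-1 : ℝ) 1 → ℂ) : ℝ → ℂ := Set.IccExtend (by norm_num) f

theorem extendI_apply (f : Set.Icc (-1 : ℝ) 1 → ℂ) {t : ℝ} (ht : t ∈ Set.Icc (-1 : ℝ) 1) :
    extendI f t = f ⟨t, ht⟩ := Set.IccExtend_of_mem _ _ ht

/-- The algebra `C^∞([-1, 1])` of smooth complex functions on `[-1, 1]`. -/
def SmoothI : Subalgebra ℂ (Set.Icc (-1 : ℝ) 1 → ℂ) where
  carrier := {f | ContDiffOn ℝ ∞ (extendI f) (Set.Icc (-1) 1)}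
  mul_mem' hf hg := ContDiffOn.mul hf hg
  add_mem' hf hg := ContDiffOn.add hf hg
  algebraMap_mem' _ := contDiffOn_const

namespace SmoothI

theorem ofReal_mem {g : ℝ → ℂ} (hg : ContDiffOn ℝ ∞ g (Set.Icc (-1) 1)) :
    (fun t : Set.Icc (-1 : ℝ) 1 => g t) ∈ SmoothI :=
  ContDiffOn.congr hg (fun _ ht => extendI_apply _ ht)

/-- The restriction to `[-1, 1]` of a function that is smooth there. -/
def ofReal (g : ℝ → ℂ) (hg : ContDiffOn ℝ ∞ g (Set.Icc (-1) 1)) : SmoothI :=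
  ⟨fun t => g t, ofReal_mem hg⟩

/-- The derivative (one-sided at the end points) of a smooth function on `[-1, 1]`. -/
def deriv (f : SmoothI) : SmoothI :=
  ofReal (derivWithin (extendI f.1) (Set.Icc (-1) 1))
    ((contDiffOn_infty_iff_derivWithin (uniqueDiffOn_Icc (by norm_num))).1 f.2).2

/-- The coordinate function `t`. -/
def coord : SmoothI := ofReal (fun t => (t : ℂ)) Complex.ofRealCLM.contDiff.contDiffOn

end SmoothI

section Sphere

variable (φ : ℝ → ℝ) (hφ : ContDiffOn ℝ ∞ φ (Set.Icc (-1) 1))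

/-- `λ(t) = e^{-iφ(t)}`. -/
def lam : SmoothI :=
  SmoothI.ofReal (fun t => Complex.exp (-(Complex.I * φ t)))
    ((contDiffOn_const.mul (Complex.ofRealCLM.contDiff.comp_contDiffOn hφ)).neg.cexp)

/-- `λ̄(t) = e^{iφ(t)}`. -/
def lamBar : SmoothI :=
  SmoothI.ofReal (fun t => Complex.exp (Complex.I * φ t))
    ((contDiffOn_const.mul (Complex.ofRealCLM.contDiff.comp_contDiffOn hφ)).cexp)

/-- The matrix `A` of the commutation relations of `x⁰ = a`, `x¹ = a*`, `x² = b`, `x³ = b*`. -/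
def matA : Matrix (Fin 4) (Fin 4) SmoothI :=
  !![1, 1, lam φ hφ, lamBar φ hφ;
     1, 1, lamBar φ hφ, lam φ hφ;
     lamBar φ hφ, lam φ hφ, 1, 1;
     lam φ hφ, lamBar φ hφ, 1, 1]

/-- The antisymmetric matrix `B_{ij} = A_{ij}⁻¹ Ȧ_{ij}`; note `A_{ij}⁻¹ = A_{ji}`. -/
def matB : Matrix (Fin 4) (Fin 4) SmoothI :=
  fun i j => matA φ hφ j i * SmoothI.deriv (matA φ hφ i j)

/-- The relations `x^i x^j = A_{ij} x^j x^i` and `a a* + b b* + t² = 1`. -/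
inductive SphereRel : FreeAlgebra SmoothI (Fin 4) → FreeAlgebra SmoothI (Fin 4) → Prop
  | comm (i j : Fin 4) : SphereRel
      (FreeAlgebra.ι SmoothI i * FreeAlgebra.ι SmoothI j)
      (matA φ hφ i j • (FreeAlgebra.ι SmoothI j * FreeAlgebra.ι SmoothI i))
  | sphere : SphereRel
      (FreeAlgebra.ι SmoothI 0 * FreeAlgebra.ι SmoothI 1 +
        FreeAlgebra.ι SmoothI 2 * FreeAlgebra.ι SmoothI 3 +
        algebraMap SmoothI (FreeAlgebra SmoothI (Fin 4)) (SmoothI.coord ^ 2)) 1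

/-- The algebra `S⁴_λ`, generated by `a, a*, b, b*` and the smooth functions of the central
element `t`. -/
def S4 : Type := RingQuot (SphereRel φ hφ)

instance : Ring (S4 φ hφ) := RingQuot.instRing (SphereRel φ hφ)

instance : Algebra SmoothI (S4 φ hφ) :=
  inferInstanceAs (Algebra SmoothI (RingQuot (SphereRel φ hφ)))

instance : Algebra ℂ (S4 φ hφ) := inferInstanceAs (Algebra ℂ (RingQuot (SphereRel φ hφ)))

namespace S4

/-- The generators `x⁰ = a`, `x¹ = a*`, `x² = b`, `x³ = b*`. -/
def x (i : Fin 4) : S4 φ hφ := RingQuot.mkRingHom _ (FreeAlgebra.ι SmoothI i)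

/-- The smooth function `f(t)` of the generator `t`. -/
def fn (f : SmoothI) : S4 φ hφ := algebraMap SmoothI (S4 φ hφ) f

/-- The generator `t`. -/
def t : S4 φ hφ := fn φ hφ SmoothI.coord

open UnivForms in
/-- The relations of the bimodule of one-forms. -/
inductive CalcRel : Set (UnivForms (S4 φ hφ))
  /- the chain rule for functions of `t` -/
  | chain (f : SmoothI) : CalcRel
      (dincl (fn φ hφ f) - incl (fn φ hφ (SmoothI.deriv f)) * dincl (t φ hφ))
  /- the form `dt` is central -/
  | dt_central (y : S4 φ hφ) : CalcRel
      (incl y * dincl (t φ hφ) - dincl (t φ hφ) * incl y)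
  /- `t dx^i = dx^i t` -/
  | t_comm (i : Fin 4) : CalcRel
      (incl (t φ hφ) * dincl (x φ hφ i) - dincl (x φ hφ i) * incl (t φ hφ))
  /- `x^i dx^j = A_{ij} dx^j x^i + ½ B_{ij} dt x^i x^j` -/
  | comm (i j : Fin 4) : CalcRel
      (incl (x φ hφ i) * dincl (x φ hφ j) -
        (incl (fn φ hφ (matA φ hφ i j)) * dincl (x φ hφ j) * incl (x φ hφ i) +
          (1 / 2 : ℂ) • (incl (fn φ hφ (matB φ hφ i j)) * dincl (t φ hφ) *
            incl (x φ hφ i * x φ hφ j))))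
  /- `a da* + a* da + b db* + b* db + 2 t dt = 0` -/
  | sphere : CalcRel
      (incl (x φ hφ 0) * dincl (x φ hφ 1) + incl (x φ hφ 1) * dincl (x φ hφ 0) +
        incl (x φ hφ 2) * dincl (x φ hφ 3) + incl (x φ hφ 3) * dincl (x φ hφ 2) +
        2 * incl (t φ hφ) * dincl (t φ hφ))

open UnivForms in
theorem parity_calcRel : ∀ s ∈ CalcRel φ hφ, parity s = -s := by
  have hsmul : ∀ (c : ℂ) (w : UnivForms (S4 φ hφ)), parity (c • w) = c • parity w :=
    fun c w => by simp [parity]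
  have htwo : parity (2 : UnivForms (S4 φ hφ)) = 2 := by
    have h := parity_algebraMap (A := S4 φ hφ) 2
    rwa [map_ofNat] at h
  intro s hs
  cases hs <;>
    simp only [parity_sub, parity_add, parity_mul, parity_incl, parity_dincl, hsmul, htwo,
      mul_neg, neg_mul, smul_neg] <;> abel

/-- The differential algebra `Ω(S⁴_λ)`. -/
abbrev Forms : Type := FormsMod (CalcRel φ hφ)

/-- The space `Ωⁿ(S⁴_λ)` of `n`-forms. -/
abbrev nForms (n : ℕ) : Submodule ℂ (Forms φ hφ) := FormsMod.deg (CalcRel φ hφ) n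

/-- The inclusion `S⁴_λ = Ω⁰ → Ω`. -/
abbrev inc : S4 φ hφ →ₐ[ℂ] Forms φ hφ := FormsMod.incl (CalcRel φ hφ)

/-- The differential `d : Ω(S⁴_λ) → Ω(S⁴_λ)`. -/
abbrev d : Forms φ hφ →ₗ[ℂ] Forms φ hφ := FormsMod.d (parity_calcRel φ hφ)

/-- The differential of an element of the algebra. -/
abbrev dOf : S4 φ hφ →ₗ[ℂ] Forms φ hφ := FormsMod.dincl (CalcRel φ hφ)

theorem d_inc (y : S4 φ hφ) : d φ hφ (inc φ hφ y) = dOf φ hφ y := by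
  simp only [FormsMod.incl, FormsMod.dincl, AlgHom.comp_apply, FormsMod.d_proj,
    UnivForms.d_incl]
  rfl

/-- The four-form
`ω = ¼ (t da da* db db* - 2 a dt da* db db* + 2 dt da da* db b*)`. -/
def omega : Forms φ hφ :=
  let da := dOf φ hφ (x φ hφ 0)
  let da' := dOf φ hφ (x φ hφ 1)
  let db := dOf φ hφ (x φ hφ 2)
  let db' := dOf φ hφ (x φ hφ 3)
  let dt := dOf φ hφ (t φ hφ)
  (1 / 4 : ℂ) • (inc φ hφ (t φ hφ) * da * da' * db * db'
    - (2 : ℂ) • (inc φ hφ (x φ hφ 0) * dt * da' * db * db')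
    + (2 : ℂ) • (dt * da * da' * db * inc φ hφ (x φ hφ 3)))

theorem omega_mem : omega φ hφ ∈ nForms φ hφ 4 := by
  refine Submodule.smul_mem _ _ (add_mem (sub_mem ?_ (Submodule.smul_mem _ _ ?_))
    (Submodule.smul_mem _ _ ?_))
  · exact FormsMod.mul_dincl_mem _ (FormsMod.mul_dincl_mem _ (FormsMod.mul_dincl_mem _
      (FormsMod.mul_dincl_mem _ (FormsMod.incl_mem _))))
  · exact FormsMod.mul_dincl_mem _ (FormsMod.mul_dincl_mem _ (FormsMod.mul_dincl_mem _
      (FormsMod.mul_dincl_mem _ (FormsMod.incl_mem _))))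
  · exact FormsMod.mul_incl_mem _ (FormsMod.mul_dincl_mem _ (FormsMod.mul_dincl_mem _
      (FormsMod.mul_dincl_mem _ (FormsMod.dincl_mem _))))

/-- The integral of `f(t) a^i ā^j b^k b̄^l` over the unit sphere `S⁴ ⊂ ℂ² × ℝ = ℝ⁵`, with the
coordinates `a = p₀ + i p₁`, `b = p₂ + i p₃`, `t = p₄` and the surface measure. -/
def classicalIntegral (f : SmoothI) (i j k l : ℕ) : ℂ :=
  ∫ p : Metric.sphere (0 : EuclideanSpace ℝ (Fin 5)) 1,
    extendI f.1 (p.1 4) * (p.1 0 + p.1 1 * Complex.I : ℂ) ^ i *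
      conj (p.1 0 + p.1 1 * Complex.I : ℂ) ^ j * (p.1 2 + p.1 3 * Complex.I : ℂ) ^ k *
      conj (p.1 2 + p.1 3 * Complex.I : ℂ) ^ l
    ∂(MeasureTheory.volume.toSphere)

/-- `I` is the integral on four-forms, `∫ x ω = ∫_{S⁴} η(x)`, where the linear map `η`
identifies an element of `S⁴_λ`, written with `a, a*` to the left of `b, b*`, with the
corresponding function on `S⁴`. -/
def IsIntegral (I : nForms φ hφ 4 →ₗ[ℂ] ℂ) : Prop :=
  ∀ (f : SmoothI) (i j k l : ℕ),
    I ⟨inc φ hφ (fn φ hφ f * x φ hφ 0 ^ i * x φ hφ 1 ^ j * x φ hφ 2 ^ k * x φ hφ 3 ^ l) *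
        omega φ hφ, FormsMod.incl_mul_mem _ (omega_mem φ hφ)⟩ =
      classicalIntegral f i j k l

variable {φ hφ}

/-- `I` is closed: `∫ dρ = 0` for every three-form `ρ`. -/
def IsClosedFunctional (I : nForms φ hφ 4 →ₗ[ℂ] ℂ) : Prop :=
  ∀ (ρ : Forms φ hφ) (hρ : ρ ∈ nForms φ hφ 3),
    I ⟨d φ hφ ρ, FormsMod.d_mem _ hρ⟩ = 0

/-- `I` is a graded trace: `∫ ρ σ = (-1)^{pq} ∫ σ ρ` for all `ρ ∈ Ω^p`, `σ ∈ Ω^q`, `p + q = 4`. -/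
def IsGradedTrace (I : nForms φ hφ 4 →ₗ[ℂ] ℂ) : Prop :=
  ∀ (p q : ℕ) (h : p + q = 4) (ρ σ : Forms φ hφ) (hρ : ρ ∈ nForms φ hφ p)
    (hσ : σ ∈ nForms φ hφ q),
    I ⟨ρ * σ, h ▸ FormsMod.mul_mem hρ hσ⟩ =
      (-1) ^ (p * q) * I ⟨σ * ρ, (add_comm q p).trans h ▸ FormsMod.mul_mem hσ hρ⟩

/-- The functional `ψ(a₀, …, a₄) = ∫ a₀ da₁ da₂ da₃ da₄`. -/
def psi (I : nForms φ hφ 4 →ₗ[ℂ] ℂ) :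
    MultilinearMap ℂ (fun _ : Fin 5 => S4 φ hφ) ℂ :=
  I.compMultilinearMap ((FormsMod.monomial (CalcRel φ hφ) 4).codRestrict (nForms φ hφ 4)
    (fun v => Submodule.subset_span ⟨v, rfl⟩))

theorem psi_apply (I : nForms φ hφ 4 →ₗ[ℂ] ℂ) (a : Fin 5 → S4 φ hφ)
    (h : inc φ hφ (a 0) * dOf φ hφ (a 1) * dOf φ hφ (a 2) * dOf φ hφ (a 3) * dOf φ hφ (a 4) ∈
      nForms φ hφ 4) :
    psi I a = I ⟨inc φ hφ (a 0) * dOf φ hφ (a 1) * dOf φ hφ (a 2) * dOf φ hφ (a 3) *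
      dOf φ hφ (a 4), h⟩ := by
  change I ⟨FormsMod.monomial (CalcRel φ hφ) 4 a, _⟩ = _
  congr 2
  rw [FormsMod.monomial_apply]
  simp [List.ofFn_succ, mul_assoc]

end S4

end Sphere

end

/-! `Ω` is given by generators and relations. A functional on four-forms is therefore built by
letting `Ω` act on a concrete space, and its uniqueness requires that the relations reduce all
four-forms to multiples of `ω`.

Existence. `S⁴_λ` deforms the functions on `S⁴` along the two-torus that rotates `a` and `b`. A
current is a functional on functions with values in the exterior algebra of `ℂ⁵`, killed by the
equation of the sphere and by its differential. On families of currents indexed by `ℤ²`, the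
generator `x^i` acts by the classical coordinate, a shift by its torus degree and a half-integral
power of `λ`. The exterior derivative `D` of currents satisfies `D² = 0`, so `y ↦ [D, y]` represents
the universal calculus. The relations of `Ω` hold (`commutatorRep_calcRel`), the term `½ B_ij dt`
being the derivative of the half power of `λ`. The integral of `ρ` is minus the mass, in degree zero
of `ℤ²`, of `ρ` applied to the fundamental current of the sphere. It is closed (`integral_d`), since
`D` kills the fundamental current by rotation invariance and exact currents have mass zero. On `f
a^i (a*)^j b^k (b*)^l ω` all phases cancel if `i = j` and `k = l`, and `ω` acts as the classical
volume form. For other exponents both sides vanish (`integral_normalMonomial`).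

Uniqueness. The differential of the sphere relation, multiplied by three-forms, together with the
sphere relation itself, shows that every product of four differentials is a left multiple of `W =
4ω` (`exists_eq_mul_W`). Every element of `S⁴_λ` is a sum of normal monomials, whose values are
prescribed.

Trace and cocycle. Multiplying a normal monomial by a generator on the left or on the right gives
the same monomial up to powers of `λ`, which cancel whenever the integral is not zero. As `ω`
commutes with `S⁴_λ`, elements of degree zero can be cycled under the integral. Closedness extends
this to differentials (`integral_dOf_mul_comm`), and moving one differential at a time gives the
graded trace. The cyclic cocycle identities follow from closedness, the trace property and the
Leibniz rule. -/

noncomputable section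

/-! ### Derivatives on the interval and half-integral powers of `λ` -/

namespace SmoothI

instance : CommRing SmoothI := inferInstance

instance : CommSemiring SmoothI := inferInstance

instance : Algebra ℂ SmoothI := inferInstance

theorem ext' {f g : SmoothI} (h : ∀ t, f.1 t = g.1 t) : f = g := Subtype.ext (funext h)

theorem hasDerivWithinAt (f : SmoothI) (t : Set.Icc (-1 : ℝ) 1) :
    HasDerivWithinAt (extendI f.1) ((deriv f).1 t) (Set.Icc (-1) 1) t := by
  have h : DifferentiableWithinAt ℝ (extendI f.1) (Set.Icc (-1) 1) t :=
    (f.2.differentiableOn (by simp)) _ t.2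
  exact h.hasDerivWithinAt

theorem deriv_eq_of_hasDerivWithinAt {f : SmoothI} {g : Set.Icc (-1 : ℝ) 1 → ℂ}
    (h : ∀ t : Set.Icc (-1 : ℝ) 1,
      HasDerivWithinAt (extendI f.1) (g t) (Set.Icc (-1) 1) t)
    (t : Set.Icc (-1 : ℝ) 1) : (deriv f).1 t = g t :=
  (h t).derivWithin ((uniqueDiffOn_Icc (by norm_num)) _ t.2)

theorem deriv_add (f g : SmoothI) : deriv (f + g) = deriv f + deriv g :=
  ext' fun t => deriv_eq_of_hasDerivWithinAt (f := f + g) (g := (deriv f + deriv g).1)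
    (fun t => (hasDerivWithinAt f t).add (hasDerivWithinAt g t)) t

theorem deriv_mul (f g : SmoothI) : deriv (f * g) = f * deriv g + g * deriv f :=
  ext' fun t => deriv_eq_of_hasDerivWithinAt (g := (f * deriv g + g * deriv f).1)
    (fun t => by
      have h := (hasDerivWithinAt f t).mul (hasDerivWithinAt g t)
      rw [extendI_apply _ t.2, extendI_apply _ t.2] at h
      refine h.congr_deriv ?_
      change _ = f.1 t * (deriv g).1 t + g.1 t * (deriv f).1 t
      simp only [Subtype.coe_eta]
      ring) t

theorem deriv_algebraMap (c : ℂ) : deriv (algebraMap ℂ SmoothI c) = 0 :=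
  ext' fun t => deriv_eq_of_hasDerivWithinAt (g := fun _ => 0)
    (fun _ => hasDerivWithinAt_const _ _ _) t

theorem deriv_coord : deriv coord = 1 :=
  ext' fun t => deriv_eq_of_hasDerivWithinAt (g := fun _ => 1)
    (fun t => by
      have h := (Complex.ofRealCLM.hasDerivAt (x := (t : ℝ))).hasDerivWithinAt
        (s := Set.Icc (-1) 1)
      exact (h.congr (fun s hs => extendI_apply _ hs) (extendI_apply _ t.2)).congr_deriv
        (by simp)) t

/-- The derivation `f ↦ ḟ` of `C^∞([-1, 1])`. -/
def derivation : Derivation ℂ SmoothI SmoothI where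
  toFun := deriv
  map_add' := deriv_add
  map_smul' c f := by
    rw [Algebra.smul_def, deriv_mul, deriv_algebraMap, mul_zero, add_zero,
      RingHom.id_apply, Algebra.smul_def]
  map_one_eq_zero' := by simpa using deriv_algebraMap 1
  leibniz' f g := deriv_mul f g

theorem derivation_apply (f : SmoothI) : derivation f = deriv f := rfl

section Phase

variable (φ : ℝ → ℝ) (hφ : ContDiffOn ℝ ∞ φ (Set.Icc (-1) 1))

/-- The function `e^{-ikφ/2}`, that is `λ^{k/2}`. -/
def phase (k : ℤ) : SmoothI :=
  ofReal (fun t => Complex.exp ((k : ℂ) * (-(Complex.I * φ t) / 2)))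
    ((contDiffOn_const.mul
      ((contDiffOn_const.mul (Complex.ofRealCLM.contDiff.comp_contDiffOn hφ)).neg.div_const
        2)).cexp)

/-- The function `φ` as an element of `C^∞([-1, 1])`. -/
def angle : SmoothI := ofReal (fun t => (φ t : ℂ)) (Complex.ofRealCLM.contDiff.comp_contDiffOn hφ)

/-- The logarithmic derivative `-iφ̇/2` of `λ^{1/2}`. -/
def phaseLogDeriv : SmoothI := (-Complex.I / 2) • deriv (angle φ hφ)

theorem phase_zero : phase φ hφ 0 = 1 := ext' fun t => by
  change Complex.exp (((0 : ℤ) : ℂ) * _) = 1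
  simp

theorem phase_add (k l : ℤ) : phase φ hφ (k + l) = phase φ hφ k * phase φ hφ l :=
  ext' fun t => by
    change Complex.exp (((k + l : ℤ) : ℂ) * _) = Complex.exp (k * _) * Complex.exp (l * _)
    rw [← Complex.exp_add]
    push_cast
    congr 1
    ring

theorem deriv_phase (k : ℤ) :
    deriv (phase φ hφ k) = (k : ℂ) • (phaseLogDeriv φ hφ * phase φ hφ k) :=
  ext' fun t => deriv_eq_of_hasDerivWithinAt
    (g := ((k : ℂ) • (phaseLogDeriv φ hφ * phase φ hφ k)).1)
    (fun t => by
      have h := ((((hasDerivWithinAt (angle φ hφ) t).const_mul Complex.I).neg.div_const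
        2).const_mul (k : ℂ)).cexp
      refine (h.congr (fun s hs => ?_) ?_).congr_deriv ?_
      · simp only [Pi.neg_apply, extendI_apply _ hs]
        rfl
      · simp only [Pi.neg_apply, extendI_apply _ t.2]
        rfl
      · simp only [Pi.neg_apply, extendI_apply _ t.2]
        change Complex.exp ((k : ℂ) * (-(Complex.I * φ t) / 2)) * _ =
          (k : ℂ) * ((-Complex.I / 2) * (deriv (angle φ hφ)).1 t *
            Complex.exp ((k : ℂ) * (-(Complex.I * φ t) / 2)))
        ring) t

/-- The degrees of `a, a*, b, b*` under the action of the two-torus. -/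
def torusDegree : Fin 4 → ℤ × ℤ := ![(1, 0), (-1, 0), (0, 1), (0, -1)]

/-- The determinant of two elements of `ℤ²`. -/
def det₂ (m n : ℤ × ℤ) : ℤ := m.1 * n.2 - m.2 * n.1

/-- The factor 2 appears because `phase` counts half powers of `λ`. Once the commutation factors
form a bicharacter of the torus degrees, identities between them become additive identities between
determinants. -/
theorem matA_eq (i j : Fin 4) :
    matA φ hφ i j = phase φ hφ (2 * det₂ (torusDegree i) (torusDegree j)) := by
  have h1 : lam φ hφ = phase φ hφ 2 := ext' fun t => by
    change Complex.exp _ = Complex.exp (((2 : ℤ) : ℂ) * _)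
    congr 1
    push_cast
    ring
  have h2 : lamBar φ hφ = phase φ hφ (-2) := ext' fun t => by
    change Complex.exp _ = Complex.exp (((-2 : ℤ) : ℂ) * _)
    congr 1
    push_cast
    ring
  fin_cases i <;> fin_cases j <;>
    simp [matA, torusDegree, det₂, h1, h2, phase_zero]

theorem matA_mul_matA (i j : Fin 4) : matA φ hφ i j * matA φ hφ j i = 1 := by
  rw [matA_eq, matA_eq, ← phase_add, ← phase_zero φ hφ]
  congr 1
  simp only [det₂]
  ring

/-- The logarithmic derivative of a power of `λ` is proportional to the exponent, so a single
function governs all entries. -/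
theorem matB_eq (i j : Fin 4) : matB φ hφ i j =
    ((2 * det₂ (torusDegree i) (torusDegree j) : ℤ) : ℂ) • phaseLogDeriv φ hφ := by
  have h : matA φ hφ j i * matA φ hφ i j = 1 := matA_mul_matA φ hφ j i
  rw [matB]
  nth_rewrite 2 [matA_eq]
  rw [deriv_phase, ← matA_eq, mul_smul_comm, mul_left_comm, h, mul_one]

theorem deriv_matA (i j : Fin 4) : deriv (matA φ hφ i j) = matA φ hφ i j * matB φ hφ i j := by
  rw [matB, ← mul_assoc, matA_mul_matA, one_mul]

theorem matB_swap (i j : Fin 4) : matB φ hφ j i = -matB φ hφ i j := by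
  rw [matB_eq, matB_eq, ← neg_smul]
  congr 1
  simp only [det₂]
  push_cast
  ring

end Phase

end SmoothI

/-! ## Polynomials over the smooth functions of `t`, as functions on `ℝ⁵` -/

/-- The derivation of a polynomial ring with prescribed values on the coefficients and on
the variables. -/
def MvPolynomial.extendDerivation {σ k A : Type*} [CommRing k] [CommRing A] [Algebra k A]
    (d : Derivation k A A) (v : σ → MvPolynomial σ A) :
    Derivation k (MvPolynomial σ A) (MvPolynomial σ A) :=
  -- A derivation `D` of a ring is the `ε`-part of a homomorphism `p ↦ p + ε D p` into the dual
  -- numbers, and such a homomorphism may be prescribed on coefficients and variables.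
  let g : A →+* DualNumber (MvPolynomial σ A) :=
    { toFun := fun f => TrivSqZeroExt.inl (C f) + TrivSqZeroExt.inr (C (d f))
      map_one' := by simp
      map_mul' := fun a b => by
        ext <;> simp [mul_comm]
      map_zero' := by simp
      map_add' := fun a b => by ext <;> simp }
  let h : MvPolynomial σ A →+* DualNumber (MvPolynomial σ A) :=
    eval₂Hom g (fun i => TrivSqZeroExt.inl (X i) + TrivSqZeroExt.inr (v i))
  have hfst : ∀ p, (h p).fst = p := fun p => by
    induction p using MvPolynomial.induction_on with
    | C a => simp [h, g]
    | add p q hp hq => simp [hp, hq]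
    | mul_X p i hp => rw [map_mul, TrivSqZeroExt.fst_mul, hp]; simp [h]
  have hmul : ∀ p q, (h (p * q)).snd = p * (h q).snd + q * (h p).snd := fun p q => by
    rw [map_mul, TrivSqZeroExt.snd_mul, hfst, hfst]
    simp [mul_comm]
  { toFun := fun p => (h p).snd
    map_add' := fun p q => by simp
    map_smul' := fun c p => by
      have h1 : (h (algebraMap k (MvPolynomial σ A) c)).snd = 0 := by
        rw [MvPolynomial.algebraMap_apply]
        simp [h, g]
      rw [Algebra.smul_def, hmul, h1, mul_zero, add_zero, RingHom.id_apply, Algebra.smul_def]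
    map_one_eq_zero' := by simp
    leibniz' := fun p q => by
      change (h (p * q)).snd = _
      rw [hmul]; rfl }

theorem MvPolynomial.extendDerivation_C {σ k A : Type*} [CommRing k] [CommRing A] [Algebra k A]
    (d : Derivation k A A) (v : σ → MvPolynomial σ A) (f : A) :
    extendDerivation d v (C f) = C (d f) := by
  change TrivSqZeroExt.snd (eval₂Hom _ _ (C f)) = _
  simp

theorem MvPolynomial.extendDerivation_X {σ k A : Type*} [CommRing k] [CommRing A] [Algebra k A]
    (d : Derivation k A A) (v : σ → MvPolynomial σ A) (i : σ) :
    extendDerivation d v (X i) = v i := by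
  change TrivSqZeroExt.snd (eval₂Hom _ _ (X i)) = _
  simp

/-- Polynomials in four real coordinates over the smooth functions of the fifth. -/
abbrev StripPoly : Type := MvPolynomial (Fin 4) SmoothI

namespace StripPoly

open MvPolynomial

instance : CommRing StripPoly := inferInstance

instance : CommSemiring StripPoly := inferInstance

instance : Algebra ℂ StripPoly := inferInstance

instance : Module ℂ StripPoly := inferInstance

/-- The five coordinate functions. -/
def coordinate (i : Fin 5) : StripPoly := Fin.lastCases (C SmoothI.coord) X i

/-- The partial derivative with respect to the `i`-th coordinate. -/
def partialDeriv (i : Fin 5) : Derivation ℂ StripPoly StripPoly :=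
  extendDerivation (if i = Fin.last 4 then SmoothI.derivation else 0)
    (fun j => if i = j.castSucc then 1 else 0)

theorem partialDeriv_C (i : Fin 5) (f : SmoothI) :
    partialDeriv i (C f) = if i = Fin.last 4 then C (SmoothI.deriv f) else 0 := by
  rw [partialDeriv, extendDerivation_C]
  split_ifs <;> simp [SmoothI.derivation_apply]

theorem partialDeriv_X (i : Fin 5) (j : Fin 4) :
    partialDeriv i (X j) = if i = j.castSucc then 1 else 0 := by
  rw [partialDeriv, extendDerivation_X]

theorem partialDeriv_coordinate (i j : Fin 5) :
    partialDeriv i (coordinate j) = if i = j then 1 else 0 := by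
  induction j using Fin.lastCases with
  | last =>
    rw [coordinate, Fin.lastCases_last, partialDeriv_C, SmoothI.deriv_coord, map_one]
  | cast j => simp [coordinate, partialDeriv_X]

theorem partialDeriv_comm (i j : Fin 5) (p : StripPoly) :
    partialDeriv i (partialDeriv j p) = partialDeriv j (partialDeriv i p) := by
  induction p using MvPolynomial.induction_on with
  | C f =>
    simp only [partialDeriv_C, apply_ite (partialDeriv i), apply_ite (partialDeriv j), map_zero]
    split_ifs <;> rfl
  | add p q hp hq => simp only [map_add, hp, hq]
  | mul_X p k hp =>
    have h : ∀ i j, partialDeriv i (partialDeriv j (X k)) = 0 := fun i j => by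
      rw [partialDeriv_X]; split_ifs <;> simp
    simp only [Derivation.leibniz, map_add, smul_eq_mul, hp, h, mul_zero, zero_add]
    ring

/-- Evaluation at a point. -/
def evalAt (x : EuclideanSpace ℝ (Fin 5)) : StripPoly →+* ℂ :=
  eval₂Hom
    ({ toFun := fun f => extendI f.1 (x 4)
       map_one' := rfl
       map_mul' := fun _ _ => rfl
       map_zero' := rfl
       map_add' := fun _ _ => rfl } : SmoothI →+* ℂ)
    (fun i => (x i.castSucc : ℂ))

theorem evalAt_C (x : EuclideanSpace ℝ (Fin 5)) (f : SmoothI) :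
    evalAt x (C f) = extendI f.1 (x 4) :=
  eval₂Hom_C _ _ _

theorem evalAt_X (x : EuclideanSpace ℝ (Fin 5)) (i : Fin 4) :
    evalAt x (X i) = x i.castSucc := by
  simp [evalAt]

theorem evalAt_smul (x : EuclideanSpace ℝ (Fin 5)) (c : ℂ) (p : StripPoly) :
    evalAt x (c • p) = c * evalAt x p := by
  rw [Algebra.smul_def, map_mul, MvPolynomial.algebraMap_apply, evalAt_C]
  rfl

theorem evalAt_coordinate {x : EuclideanSpace ℝ (Fin 5)} (hx : x 4 ∈ Set.Icc (-1 : ℝ) 1)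
    (i : Fin 5) : evalAt x (coordinate i) = x i := by
  induction i using Fin.lastCases with
  | last =>
    simp only [coordinate, Fin.lastCases_last, evalAt_C]
    rw [extendI_apply _ hx]
    rfl
  | cast j => simp [coordinate, evalAt_X]

theorem continuous_evalAt (p : StripPoly) : Continuous (fun x => evalAt x p) := by
  induction p using MvPolynomial.induction_on with
  | C f =>
    simp only [evalAt_C]
    have h1 : Continuous f.1 := by
      have h := (f.2.continuousOn).domRestrict
      convert h using 1
      ext t
      exact (extendI_apply f.1 t.2).symm
    have h2 : Continuous (extendI f.1) := h1.Icc_extend'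
    exact h2.comp (by fun_prop)
  | add p q hp hq => simp only [map_add]; exact hp.add hq
  | mul_X p i hp =>
    simp only [map_mul, evalAt_X]
    exact hp.mul (by fun_prop)

/-- The coefficients are differentiable only within `[-1, 1]`. The chain rule still holds along
curves whose last coordinate stays there, as on the orbits of rotations of the sphere, poles
included. -/
theorem hasDerivAt_evalAt {γ : ℝ → EuclideanSpace ℝ (Fin 5)} {γ' : Fin 5 → ℝ} {s : ℝ}
    (hγ : ∀ k, HasDerivAt (fun u => γ u k) (γ' k) s) (h4 : ∀ u, γ u 4 ∈ Set.Icc (-1 : ℝ) 1)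
    (p : StripPoly) :
    HasDerivAt (fun u => evalAt (γ u) p) (∑ k, (γ' k : ℂ) * evalAt (γ s) (partialDeriv k p)) s := by
  induction p using MvPolynomial.induction_on with
  | C f =>
    have h := (SmoothI.hasDerivWithinAt f ⟨γ s 4, h4 s⟩).scomp_of_eq s
      (hγ 4).hasDerivWithinAt (s := Set.univ) (fun u _ => h4 u) rfl
    rw [hasDerivWithinAt_univ] at h
    simp only [evalAt_C]
    refine h.congr_deriv ?_
    rw [Fin.sum_univ_castSucc]
    have h0 : ∀ k : Fin 4, evalAt (γ s) (partialDeriv k.castSucc (C f)) = 0 := fun k => by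
      rw [partialDeriv_C, if_neg (Fin.castSucc_ne_last k), map_zero]
    simp only [h0, mul_zero, Finset.sum_const_zero, zero_add]
    rw [partialDeriv_C, if_pos rfl, evalAt_C, extendI_apply _ (h4 s)]
    simp
  | add p q hp hq =>
    simp only [map_add, mul_add, Finset.sum_add_distrib]
    exact hp.add hq
  | mul_X p i hp =>
    have hX : HasDerivAt (fun u => evalAt (γ u) (X i)) (γ' i.castSucc : ℂ) s := by
      simp only [evalAt_X]
      exact (hγ i.castSucc).ofReal_comp
    simp only [map_mul]
    refine (hp.mul hX).congr_deriv ?_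
    simp only [Derivation.leibniz, smul_eq_mul, map_add, map_mul, mul_add,
      Finset.sum_add_distrib, Finset.sum_mul, partialDeriv_X]
    have : ∀ k : Fin 5, (γ' k : ℂ) * (evalAt (γ s) p *
        evalAt (γ s) (if k = i.castSucc then 1 else 0)) =
        if k = i.castSucc then evalAt (γ s) p * γ' k else 0 := fun k => by
      split_ifs <;> simp [mul_comm]
    simp only [this, Finset.sum_ite_eq', Finset.mem_univ, if_true]
    rw [add_comm]
    congr 1
    refine Finset.sum_congr rfl fun k _ => ?_
    ring

end StripPoly

/-! ## Rotations of the sphere -/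

/-- The rotation by the angle `s` in the plane of the `i`-th and the `j`-th coordinate. -/
def planeRotation {n : ℕ} {i j : Fin n} (hij : i ≠ j) (s : ℝ) :
    EuclideanSpace ℝ (Fin n) →ₗᵢ[ℝ] EuclideanSpace ℝ (Fin n) where
  toFun x := WithLp.toLp 2 fun k =>
    if k = i then Real.cos s * x i - Real.sin s * x j
    else if k = j then Real.sin s * x i + Real.cos s * x j else x k
  map_add' x y := by
    ext k
    simp only [PiLp.add_apply]
    split_ifs <;> ring
  map_smul' c x := by
    ext k
    simp only [PiLp.smul_apply, smul_eq_mul, RingHom.id_apply]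
    split_ifs <;> ring
  norm_map' x := by
    rw [← sq_eq_sq₀ (norm_nonneg _) (norm_nonneg _), EuclideanSpace.real_norm_sq_eq,
      EuclideanSpace.real_norm_sq_eq, ← sub_eq_zero, ← Finset.sum_sub_distrib]
    -- The squares of the two rotated coordinates change by opposite amounts, by `sin² + cos² = 1`.
    have h : ∀ k, (if k = i then Real.cos s * x i - Real.sin s * x j
        else if k = j then Real.sin s * x i + Real.cos s * x j else x k) ^ 2 - x k ^ 2 =
        (if k = i then (Real.cos s * x i - Real.sin s * x j) ^ 2 - x i ^ 2 else 0) +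
        (if k = j then -((Real.cos s * x i - Real.sin s * x j) ^ 2 - x i ^ 2) else 0) := by
      intro k
      by_cases hi : k = i
      · subst hi; simp [hij]
      · by_cases hj : k = j
        · subst hj
          simp only [hi, if_true, if_false]
          linear_combination (x i ^ 2 + x k ^ 2) * Real.sin_sq_add_cos_sq s
        · simp [hi, hj]
    simp only [LinearMap.coe_mk, AddHom.coe_mk]
    simp only [h, Finset.sum_add_distrib, Finset.sum_ite_eq', Finset.mem_univ, if_true]
    ring

theorem planeRotation_apply {n : ℕ} {i j : Fin n} (hij : i ≠ j) (s : ℝ)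
    (x : EuclideanSpace ℝ (Fin n)) (k : Fin n) :
    planeRotation hij s x k = if k = i then Real.cos s * x i - Real.sin s * x j
      else if k = j then Real.sin s * x i + Real.cos s * x j else x k := rfl

-- The surface measure of a set is a constant times the volume of the cone over it. A linear
-- isometry commutes with forming cones and preserves volume.
open MeasureTheory Metric Pointwise in
theorem MeasureTheory.Measure.integral_toSphere_comp_linearIsometryEquiv {E : Type*}
    [NormedAddCommGroup E] [InnerProductSpace ℝ E] [FiniteDimensional ℝ E] [MeasurableSpace E]
    [BorelSpace E] (R : E ≃ₗᵢ[ℝ] E) (G : E → ℂ) :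
    ∫ p : sphere (0 : E) 1, G (R p) ∂(volume : Measure E).toSphere =
      ∫ p : sphere (0 : E) 1, G p ∂(volume : Measure E).toSphere := by
  have hR : ∀ p : sphere (0 : E) 1, R p ∈ sphere (0 : E) 1 := fun p => by simp
  let T : sphere (0 : E) 1 ≃ₜ sphere (0 : E) 1 :=
    { toFun := fun p => ⟨R p, hR p⟩
      invFun := fun p => ⟨R.symm p, by simp⟩
      left_inv := fun p => by simp
      right_inv := fun p => by simp
      continuous_toFun := by fun_prop
      continuous_invFun := by fun_prop }
  have hT : MeasurePreserving T (volume : Measure E).toSphere (volume : Measure E).toSphere := by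
    refine ⟨T.continuous.measurable, ?_⟩
    ext S hS
    rw [Measure.map_apply T.continuous.measurable hS, Measure.toSphere_apply' _ hS,
      Measure.toSphere_apply' _ (T.continuous.measurable hS)]
    congr 1
    have : Set.Ioo (0 : ℝ) 1 • ((↑) '' (T ⁻¹' S) : Set E) =
        R ⁻¹' (Set.Ioo (0 : ℝ) 1 • ((↑) '' S : Set E)) := by
      ext x
      simp only [Set.mem_smul, Set.mem_image, Set.mem_preimage]
      constructor
      · rintro ⟨r, hr, _, ⟨p, hp, rfl⟩, rfl⟩
        exact ⟨r, hr, _, ⟨T p, hp, rfl⟩, by simp [T]⟩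
      · rintro ⟨r, hr, _, ⟨p, hp, rfl⟩, h⟩
        refine ⟨r, hr, _, ⟨T.symm p, by simpa using hp, rfl⟩, ?_⟩
        apply R.injective
        rw [← h]
        simp [T]
    rw [this]
    exact R.measurePreserving.measure_preimage_equiv (f := R.toMeasurableEquiv) _
  exact hT.integral_comp T.measurableEmbedding (fun p => G p)

namespace StripPoly

open MeasureTheory Metric

theorem last_mem_Icc {x : EuclideanSpace ℝ (Fin 5)} (hx : ‖x‖ = 1) (i : Fin 5) :
    x i ∈ Set.Icc (-1 : ℝ) 1 := by
  have h := PiLp.norm_apply_le x i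
  rw [hx, Real.norm_eq_abs] at h
  exact abs_le.1 h

theorem integrable_evalAt (p : StripPoly) :
    Integrable (fun x : sphere (0 : EuclideanSpace ℝ (Fin 5)) 1 => evalAt x p)
      (volume.toSphere) :=
  ((continuous_evalAt p).comp continuous_subtype_val).integrable_of_hasCompactSupport
    (HasCompactSupport.of_compactSpace _)

/-- The integral over the unit sphere. -/
def sphereIntegral : StripPoly →ₗ[ℂ] ℂ where
  toFun p := ∫ x : sphere (0 : EuclideanSpace ℝ (Fin 5)) 1, evalAt x p ∂(volume.toSphere)
  map_add' p q := by
    simp only [map_add]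
    exact integral_add (integrable_evalAt p) (integrable_evalAt q)
  map_smul' c p := by
    simp only [evalAt_smul]
    exact integral_const_mul _ _

theorem sphereIntegral_apply (p : StripPoly) : sphereIntegral p =
    ∫ x : sphere (0 : EuclideanSpace ℝ (Fin 5)) 1, evalAt x p ∂(volume.toSphere) := rfl

theorem sphereIntegral_congr {p q : StripPoly}
    (h : ∀ x : EuclideanSpace ℝ (Fin 5), ‖x‖ = 1 → evalAt x p = evalAt x q) :
    sphereIntegral p = sphereIntegral q := by
  simp only [sphereIntegral_apply]
  exact integral_congr_ae (Filter.Eventually.of_forall fun x => h x (by simp))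

/-- The polynomial `∑ xᵢ² - 1`. -/
def sphereEq : StripPoly := ∑ i, coordinate i ^ 2 - 1

theorem sphereIntegral_sphereEq_mul (p : StripPoly) : sphereIntegral (sphereEq * p) = 0 := by
  rw [← map_zero sphereIntegral]
  refine sphereIntegral_congr fun x hx => ?_
  have h : ∑ i, x i ^ 2 = 1 := by
    rw [← EuclideanSpace.real_norm_sq_eq, hx, one_pow]
  have h2 : evalAt x sphereEq = 0 := by
    simp only [sphereEq, map_sub, map_sum, map_pow, map_one,
      evalAt_coordinate (last_mem_Icc hx 4)]
    rw [sub_eq_zero]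
    exact_mod_cast h
  rw [map_mul, h2, zero_mul, map_zero]

/-- The integral over the sphere is invariant under infinitesimal rotations. -/
theorem sphereIntegral_coordinate_mul_partialDeriv (i j : Fin 5) (p : StripPoly) :
    sphereIntegral (coordinate i * partialDeriv j p) =
      sphereIntegral (coordinate j * partialDeriv i p) := by
  by_cases hij : i = j
  · rw [hij]
  rw [← sub_eq_zero, ← map_sub]
  set q := coordinate i * partialDeriv j p - coordinate j * partialDeriv i p with hq
  -- The integral of `p` over rotated points does not depend on the angle `s`. Its derivative at `s
  -- = 0` is the integral of `q`, the infinitesimal rotation applied to `p`.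
  let γ : EuclideanSpace ℝ (Fin 5) → ℝ → EuclideanSpace ℝ (Fin 5) :=
    fun x s => planeRotation hij s x
  have hnorm : ∀ x s, ‖x‖ = 1 → ‖γ x s‖ = 1 := fun x s hx => by
    rw [← hx]; exact (planeRotation hij s).norm_map x
  have hder : ∀ x, ‖x‖ = 1 → ∀ s,
      HasDerivAt (fun u => evalAt (γ x u) p) (evalAt (γ x s) q) s := by
    intro x hx s
    have h1 : ∀ k, HasDerivAt (fun u => γ x u k)
        (if k = i then -(γ x s j) else if k = j then γ x s i else 0) s := by
      intro k
      simp only [γ, planeRotation_apply, if_true, if_neg (Ne.symm hij)]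
      split_ifs
      · refine (((Real.hasDerivAt_cos s).mul_const (x i)).sub
          ((Real.hasDerivAt_sin s).mul_const (x j))).congr_deriv ?_
        ring
      · refine (((Real.hasDerivAt_sin s).mul_const (x i)).add
          ((Real.hasDerivAt_cos s).mul_const (x j))).congr_deriv ?_
        ring
      · exact hasDerivAt_const _ _
    refine (hasDerivAt_evalAt h1 (fun u => last_mem_Icc (hnorm x u hx) 4) p).congr_deriv ?_
    have h2 : ∀ k : Fin 5, (((if k = i then -(γ x s j) else if k = j then γ x s i else 0 : ℝ)) : ℂ)
        * evalAt (γ x s) (partialDeriv k p) =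
        (if k = i then -(γ x s j : ℂ) * evalAt (γ x s) (partialDeriv i p) else 0) +
        (if k = j then (γ x s i : ℂ) * evalAt (γ x s) (partialDeriv j p) else 0) := by
      intro k
      by_cases hi : k = i
      · subst hi; simp [hij]
      · by_cases hj : k = j
        · subst hj; simp [hi]
        · simp [hi, hj]
    simp only [h2, Finset.sum_add_distrib, Finset.sum_ite_eq', Finset.mem_univ, if_true]
    rw [hq, map_sub, map_mul, map_mul, evalAt_coordinate (last_mem_Icc (hnorm x s hx) 4),
      evalAt_coordinate (last_mem_Icc (hnorm x s hx) 4)]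
    ring
  -- Rotated points stay on the sphere, so one constant dominates the derivatives for all angles.
  obtain ⟨M, hM⟩ := (isCompact_sphere (0 : EuclideanSpace ℝ (Fin 5)) 1).exists_bound_of_continuousOn
    (continuous_evalAt q).continuousOn
  have hcont : ∀ s, Continuous (fun x : sphere (0 : EuclideanSpace ℝ (Fin 5)) 1 => γ x s) :=
    fun s => (planeRotation hij s).continuous.comp continuous_subtype_val
  have hint : ∀ s (r : StripPoly), Integrable
      (fun x : sphere (0 : EuclideanSpace ℝ (Fin 5)) 1 => evalAt (γ x s) r) (volume.toSphere) :=
    fun s r => ((continuous_evalAt r).comp (hcont s)).integrable_of_hasCompactSupport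
      (HasCompactSupport.of_compactSpace _)
  have hmain := (hasDerivAt_integral_of_dominated_loc_of_deriv_le
    (μ := (volume : Measure (EuclideanSpace ℝ (Fin 5))).toSphere)
    (F := fun s (x : sphere (0 : EuclideanSpace ℝ (Fin 5)) 1) => evalAt (γ x s) p)
    (F' := fun s x => evalAt (γ x s) q) (x₀ := (0 : ℝ)) (bound := fun _ => M)
    (s := Set.univ) Filter.univ_mem
    (Filter.Eventually.of_forall fun s => (hint s p).aestronglyMeasurable) (hint 0 p)
    (hint 0 q).aestronglyMeasurable
    (Filter.Eventually.of_forall fun x s _ => hM _ (by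
      simpa using hnorm x s (by simp)))
    (integrable_const _)
    (Filter.Eventually.of_forall fun x s _ => hder x (by simp) s)).2
  have hconst : (fun s => ∫ x : sphere (0 : EuclideanSpace ℝ (Fin 5)) 1, evalAt (γ x s) p
      ∂(volume.toSphere)) = fun _ => sphereIntegral p := by
    funext s
    exact Measure.integral_toSphere_comp_linearIsometryEquiv
      ((planeRotation hij s).toLinearIsometryEquiv rfl) (fun y => evalAt y p)
  rw [hconst] at hmain
  have h0 := hmain.unique (hasDerivAt_const _ _)
  have hγ0 : ∀ x, γ x 0 = x := fun x => by
    ext k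
    simp only [γ, planeRotation_apply, Real.cos_zero, Real.sin_zero]
    split_ifs with h1 h2
    · subst h1; ring
    · subst h2; ring
    · rfl
  simp only [hγ0] at h0
  exact h0

end StripPoly

/-! ## Representations of differential algebras by commutators -/

section CommutatorRep

open UnivForms

variable {A : Type} [Ring A] [Algebra ℂ A] {R : Type} [Ring R] [Algebra ℂ R]

/-- The representation of `Ω_u(A)` in which `da` acts as the commutator with `D`. -/
def UnivForms.commutatorRep (π : A →ₐ[ℂ] R) (D : R) : UnivForms A →ₐ[ℂ] R :=
  lift (FreeAlgebra.lift ℂ (Sum.elim π (fun a => D * π a - π a * D))) <| by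
    intro u v h
    cases h with
    | add x y => simp
    | mul x y => simp
    | scalar c => simp
    | d_add x y => simp [mul_add, add_mul]; abel
    | d_smul c x => simp [smul_sub]
    | d_mul x y => simp; noncomm_ring

variable (π : A →ₐ[ℂ] R) (D : R)

theorem UnivForms.commutatorRep_incl (a : A) : commutatorRep π D (incl a) = π a := by
  change lift _ _ (mk A _) = _
  rw [lift_mk, FreeAlgebra.lift_ι_apply, Sum.elim_inl]

theorem UnivForms.commutatorRep_dincl (a : A) :
    commutatorRep π D (dincl a) = D * π a - π a * D := by
  change lift _ _ (mk A _) = _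
  rw [lift_mk, FreeAlgebra.lift_ι_apply, Sum.elim_inr]

/-- The differential becomes the graded commutator with `D`, with `parity` carrying the sign. For a
symbol `da` this requires `D [D, a] + [D, a] D = 0`, which is where `D² = 0` enters. -/
theorem UnivForms.commutatorRep_d (hD : D * D = 0) (u : UnivForms A) :
    commutatorRep π D (d u) = D * commutatorRep π D u - commutatorRep π D (parity u) * D := by
  induction u using UnivForms.induction with
  | scalar c => simp [d_algebraMap, parity_algebraMap, Algebra.commutes]
  | h0 a => rw [d_incl, parity_incl, commutatorRep_incl, commutatorRep_dincl]
  | h1 a =>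
    rw [d_dincl, parity_dincl, map_zero, map_neg, commutatorRep_dincl]
    have h1 : D * (D * π a) = 0 := by rw [← mul_assoc, hD, zero_mul]
    simp [mul_sub, sub_mul, mul_assoc, hD, h1]
  | hadd x y hx hy => rw [map_add, map_add, hx, hy, parity_add, map_add, map_add]; noncomm_ring
  | hmul x y hx hy =>
    rw [UnivForms.d_mul, map_add, map_mul, map_mul, hx, hy, parity_mul, map_mul, map_mul]
    noncomm_ring

variable {S : Set (UnivForms A)}

/-- The representation of `Ω(A)` in which `da` acts as the commutator with `D`. -/
def FormsMod.commutatorRep (hD : D * D = 0) (hS : ∀ s ∈ S, parity s = -s)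
    (hπ : ∀ s ∈ S, UnivForms.commutatorRep π D s = 0) : FormsMod S →ₐ[ℂ] R :=
  RingQuot.liftAlgHom ℂ ⟨UnivForms.commutatorRep π D, by
    have h0 : ∀ u ∈ relBimodule S, UnivForms.commutatorRep π D u = 0 := by
      intro u hu
      induction hu using Submodule.span_induction with
      | mem x h =>
        obtain ⟨a, b, s, hs, rfl⟩ := h
        rw [map_mul, map_mul, hπ s hs, mul_zero, zero_mul]
      | zero => rw [map_zero]
      | add x y _ _ hx hy => rw [map_add, hx, hy, add_zero]
      | smul c x _ hx => rw [map_smul, hx, smul_zero]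
    -- If `j` acts as zero then so does `dj`, being a graded commutator of `D` with `j`. Thus only
    -- the relations of degree one have to be verified.
    rintro u v ⟨h | ⟨j, hj, rfl⟩, rfl⟩
    · rw [map_zero, h0 u h]
    · rw [map_zero, UnivForms.commutatorRep_d π D hD, parity_of_mem hS hj, map_neg, h0 j hj]
      simp⟩

variable (hD : D * D = 0) (hS : ∀ s ∈ S, parity s = -s)
    (hπ : ∀ s ∈ S, UnivForms.commutatorRep π D s = 0)

theorem FormsMod.commutatorRep_proj (u : UnivForms A) :
    commutatorRep π D hD hS hπ (proj S u) = UnivForms.commutatorRep π D u :=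
  RingQuot.liftAlgHom_mkAlgHom_apply ℂ _ _ u

theorem FormsMod.commutatorRep_incl (a : A) :
    commutatorRep π D hD hS hπ (FormsMod.incl S a) = π a := by
  rw [FormsMod.incl, AlgHom.comp_apply, commutatorRep_proj, UnivForms.commutatorRep_incl]

theorem FormsMod.commutatorRep_dincl (a : A) :
    commutatorRep π D hD hS hπ (FormsMod.dincl S a) = D * π a - π a * D := by
  rw [FormsMod.dincl, LinearMap.comp_apply, AlgHom.toLinearMap_apply, commutatorRep_proj,
    UnivForms.commutatorRep_dincl]

/-- The operator `z` is left unspecified because `z * D` disappears on vectors killed by `D`. -/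
theorem FormsMod.exists_commutatorRep_d (w : FormsMod S) :
    ∃ z, commutatorRep π D hD hS hπ (FormsMod.d hS w) =
      D * commutatorRep π D hD hS hπ w - z * D := by
  obtain ⟨u, rfl⟩ : ∃ u, proj S u = w := RingQuot.mkAlgHom_surjective ℂ _ w
  refine ⟨UnivForms.commutatorRep π D (parity u), ?_⟩
  rw [FormsMod.d_proj, commutatorRep_proj, commutatorRep_proj,
    UnivForms.commutatorRep_d π D hD]

end CommutatorRep

/-! ## Currents on the sphere -/

/-- The exterior algebra of `ℂ⁵`. -/
abbrev Ext5 : Type := ExteriorAlgebra ℂ (Fin 5 → ℂ)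

/-- The generators of the exterior algebra. -/
def ext5 (i : Fin 5) : Ext5 := ExteriorAlgebra.ι ℂ (Pi.single i 1)

theorem ext5_mul_swap (i j : Fin 5) : ext5 i * ext5 j = -(ext5 j * ext5 i) :=
  eq_neg_of_add_eq_zero_left (ExteriorAlgebra.ι_add_mul_swap _ _)

/-- Exchanging the summation indices pairs an antisymmetric product with a symmetric coefficient, so
the sum equals its negative. -/
theorem sum_ext5_mul_ext5_mul {w : Fin 5 → Fin 5 → Ext5} (hw : ∀ i j, w i j = w j i) :
    ∑ i, ∑ j, ext5 i * (ext5 j * w i j) = 0 := by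
  have h : ∑ i, ∑ j, ext5 i * (ext5 j * w i j) = -∑ i, ∑ j, ext5 i * (ext5 j * w i j) := by
    conv_lhs => rw [Finset.sum_comm]
    simp only [← Finset.sum_neg_distrib]
    refine Finset.sum_congr rfl fun i _ => Finset.sum_congr rfl fun j _ => ?_
    rw [← mul_assoc, ← mul_assoc, ext5_mul_swap j i, hw j i, neg_mul]
  have h2 : (2 : ℂ) • ∑ i, ∑ j, ext5 i * (ext5 j * w i j) = 0 := by
    rw [two_smul]
    nth_rewrite 1 [h]
    exact neg_add_cancel _
  simpa using h2

open StripPoly MvPolynomial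

/-- The currents with values in the exterior algebra that are supported on the sphere and
annihilated by the differential of its equation. -/
def currentSubmodule : Submodule ℂ (StripPoly →ₗ[ℂ] Ext5) where
  -- These conditions are dual to dividing forms by `∑ xᵢ² - 1` and by its differential. They make
  -- the sphere relation and its derivative hold as operators on currents.
  carrier := {w | ∀ g, w (sphereEq * g) = 0 ∧ ∑ i, ext5 i * w (coordinate i * g) = 0}
  add_mem' hv hw g := by
    simp only [LinearMap.add_apply, mul_add, Finset.sum_add_distrib]
    simp [(hv g).1, (hw g).1, (hv g).2, (hw g).2]
  zero_mem' g := by simp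
  smul_mem' c w hw g := by
    simp only [LinearMap.smul_apply, mul_smul_comm, ← Finset.smul_sum]
    rw [(hw g).1, (hw g).2]
    simp

/-- The type of currents. -/
def Current : Type := currentSubmodule

namespace Current

instance : AddCommGroup Current := inferInstanceAs (AddCommGroup currentSubmodule)

instance : Module ℂ Current := inferInstanceAs (Module ℂ currentSubmodule)

/-- The functional underlying a current. -/
def toLinearMap : Current →ₗ[ℂ] StripPoly →ₗ[ℂ] Ext5 := currentSubmodule.subtype

theorem ext' {v w : Current} (h : ∀ g, v.1 g = w.1 g) : v = w :=
  Subtype.ext (LinearMap.ext h)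

theorem sum_apply {ι : Type*} (s : Finset ι) (w : ι → Current) (g : StripPoly) :
    (∑ i ∈ s, w i).1 g = ∑ i ∈ s, (w i).1 g := by
  change toLinearMap (∑ i ∈ s, w i) g = ∑ i ∈ s, toLinearMap (w i) g
  rw [map_sum, LinearMap.sum_apply]

instance : SMul StripPoly Current where
  smul p w := ⟨w.1 ∘ₗ LinearMap.mulLeft ℂ p, fun g => by
    simp only [LinearMap.comp_apply, LinearMap.mulLeft_apply, mul_left_comm p]
    exact w.2 (p * g)⟩

theorem smul_apply (p : StripPoly) (w : Current) (g : StripPoly) : (p • w).1 g = w.1 (p * g) :=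
  rfl

instance : Module StripPoly Current where
  one_smul w := ext' fun g => by rw [smul_apply, one_mul]
  mul_smul p q w := ext' fun g => by
    rw [smul_apply, smul_apply, smul_apply, mul_left_comm, mul_assoc]
  smul_zero p := rfl
  smul_add p v w := rfl
  add_smul p q w := ext' fun g => by
    change w.1 ((p + q) * g) = w.1 (p * g) + w.1 (q * g)
    rw [add_mul, map_add]
  zero_smul w := ext' fun g => by
    rw [smul_apply, zero_mul, map_zero]; rfl

instance : Module SmoothI Current := Module.compHom Current (C : SmoothI →+* StripPoly)

theorem C_smul (f : SmoothI) (w : Current) : (C f : StripPoly) • w = f • w := rfl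

instance : IsScalarTower ℂ StripPoly Current where
  smul_assoc c p w := ext' fun g => by
    change w.1 ((c • p) * g) = c • w.1 (p * g)
    rw [smul_mul_assoc, map_smul]

instance : IsScalarTower ℂ SmoothI Current where
  smul_assoc c f w := by
    rw [← C_smul, ← C_smul, ← smul_assoc]
    congr 1
    rw [Algebra.smul_def, Algebra.smul_def, map_mul]
    rfl

theorem sphereEq_smul (w : Current) : sphereEq • w = 0 :=
  ext' fun g => (w.2 g).1

/-- Left multiplication by a generator of the exterior algebra. -/
def extMul (i : Fin 5) : Current →ₗ[StripPoly] Current where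
  toFun w := ⟨LinearMap.mulLeft ℂ (ext5 i) ∘ₗ w.1, fun g => by
    simp only [LinearMap.comp_apply, LinearMap.mulLeft_apply]
    constructor
    · rw [(w.2 g).1, mul_zero]
    · have h : ∀ j, ext5 j * (ext5 i * w.1 (coordinate j * g)) =
          -(ext5 i * (ext5 j * w.1 (coordinate j * g))) := fun j => by
        rw [← mul_assoc, ext5_mul_swap, neg_mul, mul_assoc]
      simp only [h, Finset.sum_neg_distrib]
      rw [← Finset.mul_sum, (w.2 g).2, mul_zero, neg_zero]⟩
  map_add' v w := ext' fun g => mul_add (ext5 i) (v.1 g) (w.1 g)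
  map_smul' p w := rfl

theorem extMul_apply (i : Fin 5) (w : Current) (g : StripPoly) :
    (extMul i w).1 g = ext5 i * w.1 g := rfl

theorem extMul_extMul (i j : Fin 5) (w : Current) :
    extMul i (extMul j w) = -extMul j (extMul i w) := ext' fun g => by
  change ext5 i * (ext5 j * w.1 g) = -(ext5 j * (ext5 i * w.1 g))
  rw [← mul_assoc, ext5_mul_swap, neg_mul, mul_assoc]

theorem sum_coordinate_smul_extMul (w : Current) : ∑ i, coordinate i • extMul i w = 0 :=
  ext' fun g => by
    rw [sum_apply]
    exact (w.2 g).2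

/-- The exterior derivative of an arbitrary functional. -/
def diffAux (w : StripPoly →ₗ[ℂ] Ext5) : StripPoly →ₗ[ℂ] Ext5 where
  -- The sign is that of integration by parts. It gives the Leibniz rule `diff_smul` its usual form.
  toFun g := -∑ i, ext5 i * w (partialDeriv i g)
  map_add' p q := by
    simp only [map_add, mul_add, Finset.sum_add_distrib, neg_add]
  map_smul' c p := by
    simp only [Derivation.map_smul, map_smul, mul_smul_comm, ← Finset.smul_sum, smul_neg,
      RingHom.id_apply]

theorem diffAux_apply (w : StripPoly →ₗ[ℂ] Ext5) (g : StripPoly) :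
    diffAux w g = -∑ i, ext5 i * w (partialDeriv i g) := rfl

theorem partialDeriv_sphereEq (i : Fin 5) :
    partialDeriv i sphereEq = (2 : ℂ) • coordinate i := by
  simp only [sphereEq, map_sub, map_sum, Derivation.leibniz_pow, partialDeriv_coordinate,
    Derivation.map_one_eq_zero]
  simp [two_smul, ← two_mul]

/-- Differentiating the equation of the sphere yields `2 xᵢ`, so the first condition on the
derivative is the second condition on `w`. The second condition persists because the one-form `∑ xᵢ
dxᵢ` is closed and anticommutes with the generators. -/
theorem diffAux_mem (w : Current) : diffAux w.1 ∈ currentSubmodule := fun g => by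
  simp only [diffAux_apply]
  constructor
  · have h : ∀ i, partialDeriv i (sphereEq * g) =
        sphereEq * partialDeriv i g + (2 : ℂ) • (coordinate i * g) := by
      intro i
      rw [Derivation.leibniz, smul_eq_mul, smul_eq_mul, partialDeriv_sphereEq, mul_smul_comm,
        mul_comm g]
    simp only [h, map_add, (w.2 _).1, zero_add, map_smul, mul_smul_comm]
    rw [← Finset.smul_sum, (w.2 g).2, smul_zero, neg_zero]
  · simp only [mul_neg, Finset.sum_neg_distrib, neg_eq_zero, Finset.mul_sum,
      Derivation.leibniz, smul_eq_mul, map_add, mul_add, Finset.sum_add_distrib]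
    have h1 : ∑ j, ∑ i, ext5 j * (ext5 i * w.1 (coordinate j * partialDeriv i g)) = 0 := by
      rw [Finset.sum_comm]
      refine Finset.sum_eq_zero fun i _ => ?_
      have h : ∀ j, ext5 j * (ext5 i * w.1 (coordinate j * partialDeriv i g)) =
          -(ext5 i * (ext5 j * w.1 (coordinate j * partialDeriv i g))) := fun j => by
        rw [← mul_assoc, ext5_mul_swap, neg_mul, mul_assoc]
      simp only [h, Finset.sum_neg_distrib]
      rw [← Finset.mul_sum, (w.2 _).2, mul_zero, neg_zero]
    rw [h1, zero_add]
    refine sum_ext5_mul_ext5_mul fun i j => ?_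
    simp only [partialDeriv_coordinate, eq_comm]

/-- The exterior derivative. -/
def diff : Current →ₗ[ℂ] Current where
  toFun w := ⟨diffAux w.1, diffAux_mem w⟩
  map_add' v w := ext' fun g => by
    change diffAux (v.1 + w.1) g = diffAux v.1 g + diffAux w.1 g
    simp only [LinearMap.add_apply, diffAux_apply, mul_add, Finset.sum_add_distrib, neg_add]
  map_smul' c w := ext' fun g => by
    change diffAux (c • w.1) g = c • diffAux w.1 g
    simp only [LinearMap.smul_apply, diffAux_apply, mul_smul_comm, ← Finset.smul_sum, smul_neg]

theorem diff_apply (w : Current) (g : StripPoly) :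
    (diff w).1 g = -∑ i, ext5 i * w.1 (partialDeriv i g) := rfl

theorem diff_diff (w : Current) : diff (diff w) = 0 := ext' fun g => by
  simp only [diff_apply, mul_neg, Finset.sum_neg_distrib, neg_neg, Finset.mul_sum]
  exact sum_ext5_mul_ext5_mul fun i j => by rw [partialDeriv_comm]

/-- Multiplication by the one-form `dp`. -/
def dMul : Derivation ℂ StripPoly (Current →ₗ[StripPoly] Current) where
  toFun p := ∑ i, partialDeriv i p • extMul i
  map_add' p q := by simp [add_smul, Finset.sum_add_distrib]
  map_smul' c p := by simp [Finset.smul_sum]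
  map_one_eq_zero' := by simp
  leibniz' p q := by
    simp [add_smul, Finset.sum_add_distrib, Finset.smul_sum, mul_smul]

theorem dMul_apply (p : StripPoly) (w : Current) :
    dMul p w = ∑ i, partialDeriv i p • extMul i w := by
  change (∑ i, partialDeriv i p • extMul i) w = _
  simp [LinearMap.sum_apply]

theorem dMul_coordinate (i : Fin 5) (w : Current) : dMul (coordinate i) w = extMul i w := by
  simp [dMul_apply, partialDeriv_coordinate]

theorem dMul_dMul (p q : StripPoly) (w : Current) : dMul p (dMul q w) = -dMul q (dMul p w) := by
  simp only [dMul_apply p, dMul_apply q, map_sum, map_smul, Finset.smul_sum]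
  rw [Finset.sum_comm]
  rw [← Finset.sum_neg_distrib]
  refine Finset.sum_congr rfl fun i _ => ?_
  rw [← Finset.sum_neg_distrib]
  refine Finset.sum_congr rfl fun j _ => ?_
  rw [extMul_extMul, smul_neg, smul_neg, smul_comm]

theorem dMul_dMul_self (p : StripPoly) (w : Current) : dMul p (dMul p w) = 0 := by
  have h := dMul_dMul p p w
  have h2 : (2 : ℂ) • dMul p (dMul p w) = 0 := by
    rw [two_smul]
    nth_rewrite 1 [h]
    exact neg_add_cancel (dMul p (dMul p w))
  simpa using h2

theorem dMul_C (f : SmoothI) :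
    dMul (C f) = (C (SmoothI.deriv f) : StripPoly) • dMul (C SmoothI.coord) := by
  ext1 w
  rw [LinearMap.smul_apply, dMul_apply, dMul_apply]
  simp only [partialDeriv_C, SmoothI.deriv_coord, map_one, ite_smul, one_smul, zero_smul,
    Finset.sum_ite_eq', Finset.mem_univ, if_true]

theorem dMul_sphereEq : dMul sphereEq = 0 := by
  ext1 w
  simp only [dMul_apply, partialDeriv_sphereEq, smul_assoc]
  rw [← Finset.smul_sum, sum_coordinate_smul_extMul, smul_zero, LinearMap.zero_apply]

/-- Equivalently, the commutator of the exterior derivative with a function is multiplication by the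
differential of that function. This is what makes the commutator representation geometric. -/
theorem diff_smul (p : StripPoly) (w : Current) : diff (p • w) = p • diff w + dMul p w :=
  ext' fun g => by
    change (diff (p • w)).1 g = (diff w).1 (p * g) + (dMul p w).1 g
    rw [diff_apply, diff_apply, dMul_apply]
    simp only [sum_apply, smul_apply, extMul_apply,
      Derivation.leibniz, smul_eq_mul, map_add, mul_add, Finset.sum_add_distrib]
    have : ∀ i, partialDeriv i p * g = g * partialDeriv i p := fun i => mul_comm _ _
    simp only [this]
    abel

/-- The current of integration over the sphere, times the differential of half its equation. -/
def fundamental : Current :=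
  -- The conormal factor `∑ xᵢ eᵢ` makes the current annihilated by the differential of the
  -- equation. It also supplies the fifth generator, so that four differentials reach the top degree
  -- of the exterior algebra.
  ⟨∑ i, (LinearMap.toSpanSingleton ℂ Ext5 (ext5 i)) ∘ₗ sphereIntegral ∘ₗ
      LinearMap.mulLeft ℂ (coordinate i), fun g => by
    simp only [LinearMap.sum_apply, LinearMap.comp_apply, LinearMap.mulLeft_apply,
      LinearMap.toSpanSingleton_apply]
    constructor
    · simp [mul_left_comm _ sphereEq, sphereIntegral_sphereEq_mul]
    · have h : ∀ i j, ext5 i * (sphereIntegral (coordinate j * (coordinate i * g)) • ext5 j) =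
          ext5 i * (ext5 j * algebraMap ℂ Ext5
            (sphereIntegral (coordinate j * (coordinate i * g)))) := fun i j => by
        rw [Algebra.smul_def, Algebra.commutes]
      simp only [Finset.mul_sum, h]
      exact sum_ext5_mul_ext5_mul fun i j => by rw [mul_left_comm]⟩

theorem fundamental_apply (g : StripPoly) :
    fundamental.1 g = ∑ i, sphereIntegral (coordinate i * g) • ext5 i := by
  simp [fundamental, LinearMap.sum_apply]

/-- Rotation invariance makes `∫ x_j ∂_i g` symmetric in `i` and `j`, while the product of
generators is antisymmetric. -/
theorem diff_fundamental : diff fundamental = 0 := ext' fun g => by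
  have h : ∀ i j, ext5 i * (sphereIntegral (coordinate j * partialDeriv i g) • ext5 j) =
      ext5 i * (ext5 j * algebraMap ℂ Ext5
        (sphereIntegral (coordinate j * partialDeriv i g))) := fun i j => by
    rw [Algebra.smul_def, Algebra.commutes]
  simp only [diff_apply, fundamental_apply, Finset.mul_sum, h]
  rw [sum_ext5_mul_ext5_mul, neg_zero]
  · rfl
  · intro i j
    rw [sphereIntegral_coordinate_mul_partialDeriv]

/-- The coefficient of the product of all generators. -/
def topCoeff : Ext5 →ₗ[ℂ] ℂ :=
  ExteriorAlgebra.liftAlternating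
    -- The family of alternating maps is zero in every degree except five, where it is the
    -- determinant.
    (Function.update 0 5 ((Pi.basisFun ℂ (Fin 5)).det))

/-- The total mass of a current of top degree. -/
def mass : Current →ₗ[ℂ] ℂ := topCoeff ∘ₗ LinearMap.applyₗ 1 ∘ₗ toLinearMap

theorem mass_apply (w : Current) : mass w = topCoeff (w.1 1) := rfl

/-- Stokes' theorem: the mass is a pairing with the constant function `1`, whose partial derivatives
vanish. -/
theorem mass_diff (w : Current) : mass (diff w) = 0 := by
  rw [mass_apply, diff_apply]
  simp

end Current

/-! ### Complex coordinates, torus weights and the classical volume form -/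

section

open StripPoly MvPolynomial SmoothI

/-- The derivation `p E - q D`. -/
def Derivation.smulSub {k A : Type*} [CommRing k] [CommRing A] [Algebra k A] (p q : A)
    (D E : Derivation k A A) : Derivation k A A := p • E - q • D

namespace StripPoly

/-- The coordinate functions `a, ā, b, b̄`. -/
def complexCoord : Fin 4 → StripPoly :=
  ![X 0 + Complex.I • X 1, X 0 - Complex.I • X 1, X 2 + Complex.I • X 3, X 2 - Complex.I • X 3]

theorem coordinate_four : coordinate 4 = C SmoothI.coord := rfl

theorem complexCoord_eq : complexCoord = ![coordinate 0 + Complex.I • coordinate 1,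
    coordinate 0 - Complex.I • coordinate 1, coordinate 2 + Complex.I • coordinate 3,
    coordinate 2 - Complex.I • coordinate 3] := rfl

theorem add_smul_I_mul_sub_smul_I (p q : StripPoly) :
    (p + Complex.I • q) * (p - Complex.I • q) = p ^ 2 + q ^ 2 := by
  have h : (Complex.I • q) * (Complex.I • q) = -(q ^ 2) := by
    rw [smul_mul_smul_comm, Complex.I_mul_I, neg_smul, one_smul, sq]
  linear_combination -h

theorem sum_complexCoord : complexCoord 0 * complexCoord 1 + complexCoord 2 * complexCoord 3 +
    C SmoothI.coord ^ 2 = 1 + sphereEq := by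
  have h1 : complexCoord 0 * complexCoord 1 = coordinate 0 ^ 2 + coordinate 1 ^ 2 :=
    add_smul_I_mul_sub_smul_I _ _
  have h2 : complexCoord 2 * complexCoord 3 = coordinate 2 ^ 2 + coordinate 3 ^ 2 :=
    add_smul_I_mul_sub_smul_I _ _
  rw [h1, h2, sphereEq, Fin.sum_univ_five, coordinate_four]
  ring

/-- The infinitesimal rotation in the plane of two coordinates. -/
def rotation (i j : Fin 5) : Derivation ℂ StripPoly StripPoly :=
  Derivation.smulSub (coordinate i) (coordinate j) (partialDeriv i) (partialDeriv j)

theorem rotation_apply (i j : Fin 5) (p : StripPoly) : rotation i j p =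
    coordinate i * partialDeriv j p - coordinate j * partialDeriv i p := rfl

theorem rotation_coordinate (i j k : Fin 5) : rotation i j (coordinate k) =
    coordinate i * (if j = k then 1 else 0) - coordinate j * (if i = k then 1 else 0) := by
  rw [rotation_apply, partialDeriv_coordinate, partialDeriv_coordinate]

theorem sphereIntegral_rotation (i j : Fin 5) (p : StripPoly) :
    sphereIntegral (rotation i j p) = 0 := by
  rw [rotation_apply, map_sub, sphereIntegral_coordinate_mul_partialDeriv, sub_self]

theorem rotation_C {i j : Fin 5} (hi : i ≠ Fin.last 4) (hj : j ≠ Fin.last 4) (f : SmoothI) :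
    rotation i j (C f) = 0 := by
  rw [rotation_apply, partialDeriv_C, partialDeriv_C, if_neg hi, if_neg hj]
  simp

/-- The monomial `f(t) a^i ā^j b^k b̄^l`. -/
def complexMonomial (f : SmoothI) (i j k l : ℕ) : StripPoly :=
  C f * complexCoord 0 ^ i * complexCoord 1 ^ j * complexCoord 2 ^ k * complexCoord 3 ^ l

theorem _root_.Derivation.leibniz_pow_of_eq_smul {k A : Type*} [CommRing k] [CommRing A]
    [Algebra k A] (D : Derivation k A A) {c : k} {p : A} (h : D p = c • p) (n : ℕ) :
    D (p ^ n) = ((n : k) * c) • p ^ n := by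
  induction n with
  | zero => simp
  | succ n ih =>
    rw [pow_succ, D.leibniz, ih, h, smul_eq_mul, smul_eq_mul, mul_smul_comm, mul_smul_comm,
      mul_comm p, ← add_smul]
    congr 1
    push_cast
    ring

theorem _root_.Derivation.leibniz_mul_of_eq_smul {k A : Type*} [CommRing k] [CommRing A]
    [Algebra k A] (D : Derivation k A A) {c d : k} {p q : A} (h : D p = c • p) (h' : D q = d • q) :
    D (p * q) = (c + d) • (p * q) := by
  rw [D.leibniz, h, h', smul_eq_mul, smul_eq_mul, mul_smul_comm, mul_smul_comm, mul_comm q,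
    ← add_smul, add_comm]

theorem rotation_complexMonomial {r s : Fin 5} (hr : r ≠ Fin.last 4) (hs : s ≠ Fin.last 4)
    {c : Fin 4 → ℂ} (hc : ∀ i, rotation r s (complexCoord i) = c i • complexCoord i)
    (f : SmoothI) (i j k l : ℕ) : rotation r s (complexMonomial f i j k l) =
      (i * c 0 + j * c 1 + k * c 2 + l * c 3) • complexMonomial f i j k l := by
  have h0 : rotation r s (C f) = (0 : ℂ) • C f := by rw [rotation_C hr hs, zero_smul]
  have h := Derivation.leibniz_mul_of_eq_smul (rotation r s) (Derivation.leibniz_mul_of_eq_smul _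
    (Derivation.leibniz_mul_of_eq_smul (rotation r s) (Derivation.leibniz_mul_of_eq_smul (rotation r s) h0
      (Derivation.leibniz_pow_of_eq_smul (rotation r s) (hc 0) i))
      (Derivation.leibniz_pow_of_eq_smul (rotation r s) (hc 1) j))
      (Derivation.leibniz_pow_of_eq_smul (rotation r s) (hc 2) k))
      (Derivation.leibniz_pow_of_eq_smul (rotation r s) (hc 3) l)
  rw [complexMonomial, h, zero_add]

theorem I_smul_I_smul (p : StripPoly) : Complex.I • Complex.I • p = -p := by
  rw [smul_smul, Complex.I_mul_I, neg_smul, one_smul]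

theorem rotation_zero_one_complexCoord (i : Fin 4) : rotation 0 1 (complexCoord i) =
    (![Complex.I, -Complex.I, 0, 0] : Fin 4 → ℂ) i • complexCoord i := by
  rw [complexCoord_eq]
  fin_cases i <;>
    simp [rotation_coordinate, I_smul_I_smul, sub_eq_add_neg, add_comm]

theorem rotation_two_three_complexCoord (i : Fin 4) : rotation 2 3 (complexCoord i) =
    (![0, 0, Complex.I, -Complex.I] : Fin 4 → ℂ) i • complexCoord i := by
  rw [complexCoord_eq]
  fin_cases i <;>
    simp [rotation_coordinate, I_smul_I_smul, sub_eq_add_neg, add_comm]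

/-- The monomial is an eigenvector of the infinitesimal rotations of the planes of `a` and of `b`,
with eigenvalues `I(i - j)` and `I(k - l)`. An infinitesimal rotation has integral zero, so a
nonzero eigenvalue forces the integral of the monomial to vanish. -/
theorem sphereIntegral_complexMonomial_eq_zero (f : SmoothI) {i j k l : ℕ}
    (h : ¬(i = j ∧ k = l)) : sphereIntegral (complexMonomial f i j k l) = 0 := by
  have key : ∀ m n : ℕ, (m * Complex.I + n * -Complex.I) •
      sphereIntegral (complexMonomial f i j k l) = 0 → m ≠ n →
      sphereIntegral (complexMonomial f i j k l) = 0 := by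
    intro m n h hmn
    refine (smul_eq_zero.1 h).resolve_left fun h0 => hmn ?_
    have h1 : ((m : ℂ) - n) * Complex.I = 0 := by linear_combination h0
    have h2 := (mul_eq_zero.1 h1).resolve_right Complex.I_ne_zero
    exact_mod_cast sub_eq_zero.1 h2
  have h1 := sphereIntegral_rotation 0 1 (complexMonomial f i j k l)
  have h2 := sphereIntegral_rotation 2 3 (complexMonomial f i j k l)
  rw [rotation_complexMonomial (by decide) (by decide) rotation_zero_one_complexCoord,
    map_smul] at h1
  rw [rotation_complexMonomial (by decide) (by decide) rotation_two_three_complexCoord,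
    map_smul] at h2
  by_cases hij : i = j
  · refine key k l ?_ fun hkl => h ⟨hij, hkl⟩
    simpa using h2
  · refine key i j ?_ hij
    simpa using h1

theorem sphereIntegral_complexMonomial (f : SmoothI) (i j k l : ℕ) :
    sphereIntegral (complexMonomial f i j k l) = S4.classicalIntegral f i j k l := by
  rw [sphereIntegral_apply, S4.classicalIntegral]
  congr 1
  funext x
  simp only [complexMonomial, complexCoord, map_mul, map_pow, evalAt_C]
  simp [evalAt_X, evalAt_smul, mul_comm Complex.I, sub_eq_add_neg]

end StripPoly

theorem S4.classicalIntegral_eq_zero (f : SmoothI) {i j k l : ℕ} (h : ¬(i = j ∧ k = l)) :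
    S4.classicalIntegral f i j k l = 0 := by
  rw [← sphereIntegral_complexMonomial, sphereIntegral_complexMonomial_eq_zero f h]

namespace Current

theorem topCoeff_mul (a b c d : Fin 5) (v : Fin 5 → ℂ) :
    topCoeff (ext5 a * (ext5 b * (ext5 c * (ext5 d * ExteriorAlgebra.ι ℂ v)))) =
      Matrix.det (Matrix.of ![Pi.single a 1, Pi.single b 1, Pi.single c 1, Pi.single d 1, v]) := by
  have h : ext5 a * (ext5 b * (ext5 c * (ext5 d * ExteriorAlgebra.ι ℂ v))) =
      ExteriorAlgebra.ιMulti ℂ 5 ![Pi.single a 1, Pi.single b 1, Pi.single c 1, Pi.single d 1, v]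
      := by
    rw [ExteriorAlgebra.ιMulti_apply]
    simp [List.ofFn_succ, ext5]
  rw [h, topCoeff, ExteriorAlgebra.liftAlternating_apply_ιMulti]
  rw [Function.update_self, Pi.basisFun_det_apply]

theorem fundamental_apply' (g : StripPoly) : fundamental.1 g =
    ExteriorAlgebra.ι ℂ (fun i => sphereIntegral (coordinate i * g)) := by
  rw [fundamental_apply, LinearMap.pi_apply_eq_sum_univ (ExteriorAlgebra.ι ℂ)]
  refine Finset.sum_congr rfl fun i _ => ?_
  congr 2
  rw [ext5]
  congr 1
  funext j
  simp [Pi.single_apply, eq_comm]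

theorem mass_complex_smul (c : ℂ) (w : Current) : mass (c • w) = c * mass w :=
  mass.map_smul c w

theorem mass_smul_extMul (a b c d : Fin 5) (p : StripPoly) :
    mass (p • extMul a (extMul b (extMul c (extMul d fundamental)))) =
      Matrix.det (Matrix.of ![Pi.single a 1, Pi.single b 1, Pi.single c 1, Pi.single d 1,
        fun i => sphereIntegral (coordinate i * p)]) := by
  rw [mass_apply, smul_apply, extMul_apply, extMul_apply, extMul_apply, extMul_apply,
    fundamental_apply', topCoeff_mul, mul_one]

theorem dMul_add_smul_I (i j : Fin 5) (w : Current) :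
    dMul (coordinate i + Complex.I • coordinate j) w = extMul i w + Complex.I • extMul j w := by
  rw [map_add, Derivation.map_smul, LinearMap.add_apply, LinearMap.smul_apply, dMul_coordinate,
    dMul_coordinate]

theorem dMul_sub_smul_I (i j : Fin 5) (w : Current) :
    dMul (coordinate i - Complex.I • coordinate j) w = extMul i w - Complex.I • extMul j w := by
  rw [map_sub, Derivation.map_smul, LinearMap.sub_apply, LinearMap.smul_apply, dMul_coordinate,
    dMul_coordinate]

theorem extMul_complex_smul (i : Fin 5) (c : ℂ) (w : Current) :
    extMul i (c • w) = c • extMul i w :=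
  (extMul i).map_smul_of_tower c w

theorem dMul_complex_smul (p : StripPoly) (c : ℂ) (w : Current) :
    dMul p (c • w) = c • dMul p w :=
  (dMul p).map_smul_of_tower c w

theorem extMul_extMul_self (i : Fin 5) (w : Current) : extMul i (extMul i w) = 0 := by
  rw [← dMul_coordinate, ← dMul_coordinate, dMul_dMul_self]

/-- The identity `dz ∧ dz̄ = -2i dx ∧ dy`. -/
theorem dMul_add_smul_I_dMul_sub_smul_I (i j : Fin 5) (w : Current) :
    dMul (coordinate i + Complex.I • coordinate j)
      (dMul (coordinate i - Complex.I • coordinate j) w) =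
    (-2 * Complex.I) • extMul i (extMul j w) := by
  rw [dMul_sub_smul_I, dMul_add_smul_I, map_sub, map_sub, extMul_complex_smul,
    extMul_complex_smul, extMul_extMul_self, extMul_extMul_self, extMul_extMul j i]
  module

/-- The classical volume form, as an operator on currents. -/
def volumeMul (w : Current) : Current :=
  (1 / 4 : ℂ) • ((C SmoothI.coord : StripPoly) • dMul (complexCoord 0) (dMul (complexCoord 1)
      (dMul (complexCoord 2) (dMul (complexCoord 3) w)))
    - (2 : ℂ) • (complexCoord 0 • dMul (C SmoothI.coord) (dMul (complexCoord 1)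
      (dMul (complexCoord 2) (dMul (complexCoord 3) w))))
    + (2 : ℂ) • dMul (C SmoothI.coord) (dMul (complexCoord 0) (dMul (complexCoord 1)
      (dMul (complexCoord 2) (complexCoord 3 • w)))))

theorem mass_smul_volumeMul_aux₁ (p : StripPoly) :
    mass (p • dMul (complexCoord 0) (dMul (complexCoord 1)
      (dMul (complexCoord 2) (dMul (complexCoord 3) fundamental)))) =
    -4 * sphereIntegral (coordinate 4 * p) := by
  have h : dMul (complexCoord 0) (dMul (complexCoord 1)
      (dMul (complexCoord 2) (dMul (complexCoord 3) fundamental))) =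
      (-4 : ℂ) • extMul 0 (extMul 1 (extMul 2 (extMul 3 fundamental))) := by
    refine (dMul_add_smul_I_dMul_sub_smul_I 0 1 _).trans ?_
    rw [show dMul (complexCoord 2) (dMul (complexCoord 3) fundamental) = _ from
      dMul_add_smul_I_dMul_sub_smul_I 2 3 _, extMul_complex_smul, extMul_complex_smul, smul_smul]
    congr 1
    linear_combination 4 * Complex.I_mul_I
  rw [h, smul_comm, mass_complex_smul, mass_smul_extMul]
  congr 1
  simp [Matrix.det_succ_row_zero, Fin.sum_univ_succ, Fin.succAbove, Pi.single_apply]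

theorem mass_smul_volumeMul_aux₂ (p : StripPoly) :
    mass (p • dMul (C SmoothI.coord) (dMul (complexCoord 1)
      (dMul (complexCoord 2) (dMul (complexCoord 3) fundamental)))) =
    2 * sphereIntegral (complexCoord 1 * p) := by
  have h : dMul (C SmoothI.coord) (dMul (complexCoord 1)
      (dMul (complexCoord 2) (dMul (complexCoord 3) fundamental))) =
      (-2 * Complex.I) • extMul 4 (extMul 0 (extMul 2 (extMul 3 fundamental))) +
      (-2 : ℂ) • extMul 4 (extMul 1 (extMul 2 (extMul 3 fundamental))) := by
    rw [show dMul (complexCoord 2) (dMul (complexCoord 3) fundamental) = _ from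
      dMul_add_smul_I_dMul_sub_smul_I 2 3 _, dMul_complex_smul, dMul_complex_smul,
      ← coordinate_four, dMul_coordinate, show complexCoord 1 = _ from rfl]
    change (-2 * Complex.I) • extMul 4 (dMul (coordinate 0 - Complex.I • coordinate 1) _) = _
    rw [dMul_sub_smul_I, map_sub, extMul_complex_smul, smul_sub, smul_smul,
      show -2 * Complex.I * Complex.I = 2 by linear_combination (-2) * Complex.I_mul_I]
    module
  have h2 : sphereIntegral (complexCoord 1 * p) =
      sphereIntegral (coordinate 0 * p) - Complex.I * sphereIntegral (coordinate 1 * p) := by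
    change sphereIntegral ((coordinate 0 - Complex.I • coordinate 1) * p) = _
    rw [sub_mul, map_sub, smul_mul_assoc, map_smul, smul_eq_mul]
  rw [h, h2, smul_add, smul_comm, smul_comm p, map_add, mass_complex_smul, mass_complex_smul,
    mass_smul_extMul, mass_smul_extMul]
  simp [Matrix.det_succ_row_zero, Fin.sum_univ_succ, Fin.succAbove, Pi.single_apply]
  ring

theorem mass_smul_volumeMul_aux₃ (p : StripPoly) :
    mass (p • dMul (C SmoothI.coord) (dMul (complexCoord 0)
      (dMul (complexCoord 1) (dMul (complexCoord 2) fundamental)))) =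
    -2 * sphereIntegral (complexCoord 2 * p) := by
  have h : dMul (C SmoothI.coord) (dMul (complexCoord 0)
      (dMul (complexCoord 1) (dMul (complexCoord 2) fundamental))) =
      (-2 * Complex.I) • extMul 4 (extMul 0 (extMul 1 (extMul 2 fundamental))) +
      (2 : ℂ) • extMul 4 (extMul 0 (extMul 1 (extMul 3 fundamental))) := by
    rw [show dMul (complexCoord 0) (dMul (complexCoord 1) _) = _ from
      dMul_add_smul_I_dMul_sub_smul_I 0 1 _, dMul_complex_smul,
      ← coordinate_four, dMul_coordinate]
    change (-2 * Complex.I) • extMul 4 (extMul 0 (extMul 1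
      (dMul (coordinate 2 + Complex.I • coordinate 3) _))) = _
    rw [dMul_add_smul_I, map_add, map_add, map_add, extMul_complex_smul, extMul_complex_smul,
      extMul_complex_smul, smul_add, smul_smul,
      show -2 * Complex.I * Complex.I = 2 by linear_combination (-2) * Complex.I_mul_I]
  have h2 : sphereIntegral (complexCoord 2 * p) =
      sphereIntegral (coordinate 2 * p) + Complex.I * sphereIntegral (coordinate 3 * p) := by
    change sphereIntegral ((coordinate 2 + Complex.I • coordinate 3) * p) = _
    rw [add_mul, map_add, smul_mul_assoc, map_smul, smul_eq_mul]
  rw [h, h2, smul_add, smul_comm, smul_comm p, map_add, mass_complex_smul, mass_complex_smul,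
    mass_smul_extMul, mass_smul_extMul]
  simp [Matrix.det_succ_row_zero, Fin.sum_univ_succ, Fin.succAbove, Pi.single_apply]
  ring

/-- The three summands of the volume form contribute the densities `t²`, `a ā` and `b b̄`, all with
sign `-1`, and their sum is `1` on the sphere. -/
theorem mass_smul_volumeMul (p : StripPoly) :
    mass (p • volumeMul fundamental) = -sphereIntegral p := by
  have h : sphereIntegral ((complexCoord 0 * complexCoord 1 + complexCoord 2 * complexCoord 3 +
      C SmoothI.coord ^ 2) * p) = sphereIntegral p := by
    rw [sum_complexCoord, add_mul, one_mul, map_add, sphereIntegral_sphereEq_mul, add_zero]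
  rw [add_mul, add_mul, map_add, map_add] at h
  rw [volumeMul, smul_comm, smul_add, smul_sub, smul_comm p (2 : ℂ), smul_comm p (2 : ℂ),
    ← mul_smul, ← mul_smul]
  simp only [LinearMap.map_smul (dMul _) (complexCoord 3)]
  rw [← mul_smul, mass_complex_smul, map_add, map_sub, mass_complex_smul, mass_complex_smul,
    mass_smul_volumeMul_aux₁,
    mass_smul_volumeMul_aux₂, mass_smul_volumeMul_aux₃, ← h, coordinate_four]
  have e1 : (C SmoothI.coord : StripPoly) * (p * C SmoothI.coord) = C SmoothI.coord ^ 2 * p := by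
    ring
  have e2 : complexCoord 1 * (p * complexCoord 0) = complexCoord 0 * complexCoord 1 * p := by
    ring
  have e3 : complexCoord 2 * (p * complexCoord 3) = complexCoord 2 * complexCoord 3 * p := by
    ring
  rw [e1, e2, e3]
  ring

end Current

/-! ### The representation on twisted currents -/

open Current (dMul C_smul diff_smul dMul_C sphereEq_smul dMul_complex_smul)

section TwistedRep

variable (φ : ℝ → ℝ) (hφ : ContDiffOn ℝ ∞ φ (Set.Icc (-1) 1))

namespace S4

theorem fn_mul (f g : SmoothI) : fn φ hφ (f * g) = fn φ hφ f * fn φ hφ g :=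
  map_mul (algebraMap SmoothI (S4 φ hφ)) f g

set_option synthInstance.maxHeartbeats 100000 in
theorem induction {P : S4 φ hφ → Prop} (hf : ∀ f, P (fn φ hφ f)) (hx : ∀ i, P (x φ hφ i))
    (hadd : ∀ y z, P y → P z → P (y + z)) (hmul : ∀ y z, P y → P z → P (y * z))
    (y : S4 φ hφ) : P y := by
  obtain ⟨u, rfl⟩ := RingQuot.mkAlgHom_surjective SmoothI (SphereRel φ hφ) y
  induction u using FreeAlgebra.induction with
  | grade0 f =>
    rw [AlgHom.commutes]
    exact hf f
  | grade1 i =>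
    have h : RingQuot.mkAlgHom SmoothI (SphereRel φ hφ) (FreeAlgebra.ι SmoothI i) = x φ hφ i := by
      rw [x, ← RingQuot.mkAlgHom_coe SmoothI]; rfl
    rw [h]
    exact hx i
  | mul a b ha hb => rw [map_mul]; exact hmul _ _ ha hb
  | add a b ha hb => rw [map_add]; exact hadd _ _ ha hb

end S4

/-- The currents on the sphere with values in the functions on `ℤ²`. -/
abbrev TwistedCurrent : Type := ℤ × ℤ → Current

namespace TwistedCurrent

instance : AddCommGroup TwistedCurrent := inferInstanceAs (AddCommGroup (ℤ × ℤ → Current))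

instance : Module ℂ TwistedCurrent := inferInstanceAs (Module ℂ (ℤ × ℤ → Current))

instance : Module SmoothI TwistedCurrent := inferInstanceAs (Module SmoothI (ℤ × ℤ → Current))

instance : IsScalarTower ℂ SmoothI TwistedCurrent :=
  inferInstanceAs (IsScalarTower ℂ SmoothI (ℤ × ℤ → Current))

instance : Algebra SmoothI (Module.End SmoothI TwistedCurrent) := Module.End.instAlgebra _ _ _

/-- The coordinate function `xⁱ` times the phase by which it is twisted in degree `n`. -/
def twist (i : Fin 4) (n : ℤ × ℤ) : StripPoly :=
  C (phase φ hφ (det₂ (torusDegree i) n)) * complexCoord i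

theorem twist_sub (i : Fin 4) (m n : ℤ × ℤ) :
    twist φ hφ i (n - m) = C (phase φ hφ (-det₂ (torusDegree i) m)) * twist φ hφ i n := by
  rw [twist, twist, ← mul_assoc, ← map_mul, ← phase_add]
  congr 3
  simp only [det₂, Prod.fst_sub, Prod.snd_sub]
  ring

/-- The two orders shift the exponents of the half powers of `λ` by opposite determinants, so their
quotient is the full power `A_ij`. -/
theorem twist_mul_twist_swap (i j : Fin 4) (n : ℤ × ℤ) :
    twist φ hφ i n * twist φ hφ j (n - torusDegree i) =
      C (matA φ hφ i j) * (twist φ hφ j n * twist φ hφ i (n - torusDegree j)) := by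
  have h : phase φ hφ (-det₂ (torusDegree j) (torusDegree i)) =
      matA φ hφ i j * phase φ hφ (-det₂ (torusDegree i) (torusDegree j)) := by
    rw [matA_eq, ← phase_add]
    congr 1
    simp only [det₂]
    ring
  rw [twist_sub, twist_sub, h, map_mul]
  ring

/-- The action of the generator `xⁱ`. -/
def genAction (i : Fin 4) : Module.End SmoothI TwistedCurrent where
  toFun w n := twist φ hφ i n • w (n - torusDegree i)
  map_add' v w := funext fun n => smul_add _ _ _
  map_smul' f w := funext fun n => by
    change twist φ hφ i n • f • w (n - torusDegree i) = f • twist φ hφ i n • w (n - torusDegree i)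
    rw [← C_smul, ← C_smul, smul_comm]

theorem genAction_apply (i : Fin 4) (w : TwistedCurrent) (n : ℤ × ℤ) :
    genAction φ hφ i w n = twist φ hφ i n • w (n - torusDegree i) := rfl

/-- Conjugate generators carry inverse phases, so that `a a*` and `b b*` act untwisted. -/
theorem twist_mul_twist {i j : Fin 4} (hij : torusDegree i + torusDegree j = 0) (n : ℤ × ℤ) :
    twist φ hφ i n * twist φ hφ j n = complexCoord i * complexCoord j := by
  have h : phase φ hφ (det₂ (torusDegree i) n) * phase φ hφ (det₂ (torusDegree j) n) = 1 := by
    rw [← phase_add, ← phase_zero φ hφ]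
    congr 1
    rw [eq_neg_of_add_eq_zero_left hij]
    simp only [det₂, Prod.fst_neg, Prod.snd_neg]
    ring
  calc _ = C (phase φ hφ (det₂ (torusDegree i) n) * phase φ hφ (det₂ (torusDegree j) n)) *
        (complexCoord i * complexCoord j) := by rw [map_mul, twist, twist]; ring
    _ = _ := by rw [h, map_one, one_mul]

theorem twist_sub_opposite {i j : Fin 4} (hij : torusDegree i + torusDegree j = 0) (n : ℤ × ℤ) :
    twist φ hφ i (n - torusDegree j) = twist φ hφ i n := by
  have h : -det₂ (torusDegree i) (torusDegree j) = 0 := by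
    rw [eq_neg_of_add_eq_zero_left hij]
    simp only [det₂, Prod.fst_neg, Prod.snd_neg]
    ring
  rw [twist_sub, h, phase_zero, map_one, one_mul]

theorem genAction_mul_opposite {i j : Fin 4} (hij : torusDegree i + torusDegree j = 0)
    (w : TwistedCurrent) (n : ℤ × ℤ) :
    genAction φ hφ i (genAction φ hφ j w) n = (complexCoord i * complexCoord j) • w n := by
  rw [genAction_apply, genAction_apply, twist_sub_opposite φ hφ (by rwa [add_comm]), ← mul_smul,
    twist_mul_twist φ hφ hij, sub_sub, hij, sub_zero]

/-- The representation of `S⁴_λ` on the twisted currents. -/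
def rep : S4 φ hφ →ₐ[SmoothI] Module.End SmoothI TwistedCurrent :=
  RingQuot.liftAlgHom SmoothI ⟨FreeAlgebra.lift SmoothI (genAction φ hφ), by
    intro u v h
    cases h with
    | comm i j =>
      simp only [map_mul, map_smul, FreeAlgebra.lift_ι_apply]
      ext1 w
      funext n
      change genAction φ hφ i (genAction φ hφ j w) n =
        matA φ hφ i j • genAction φ hφ j (genAction φ hφ i w) n
      rw [genAction_apply, genAction_apply, genAction_apply, genAction_apply, ← C_smul,
        ← mul_smul, ← mul_smul, ← mul_smul, twist_mul_twist_swap, sub_sub, sub_sub,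
        add_comm (torusDegree j), mul_assoc]
    | sphere =>
      simp only [map_mul, map_add, map_one, FreeAlgebra.lift_ι_apply, AlgHom.commutes]
      ext1 w
      funext n
      change genAction φ hφ 0 (genAction φ hφ 1 w) n + genAction φ hφ 2 (genAction φ hφ 3 w) n +
        (SmoothI.coord ^ 2) • w n = w n
      rw [genAction_mul_opposite φ hφ (by rfl), genAction_mul_opposite φ hφ (by rfl), ← C_smul,
        ← add_smul, ← add_smul, map_pow, sum_complexCoord, add_smul, sphereEq_smul, one_smul,
        add_zero]⟩

theorem rep_fn (f : SmoothI) (w : TwistedCurrent) : rep φ hφ (S4.fn φ hφ f) w = f • w := by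
  rw [S4.fn, AlgHom.commutes]
  rfl

theorem rep_x (i : Fin 4) : rep φ hφ (S4.x φ hφ i) = genAction φ hφ i := by
  have h : S4.x φ hφ i = RingQuot.mkAlgHom SmoothI (SphereRel φ hφ) (FreeAlgebra.ι SmoothI i) := by
    rw [S4.x, ← RingQuot.mkAlgHom_coe SmoothI]; rfl
  rw [h]
  exact (RingQuot.liftAlgHom_mkAlgHom_apply SmoothI _ _ _).trans (FreeAlgebra.lift_ι_apply _ _)

/-- The representation of `S⁴_λ` as a complex algebra. -/
def repComplex : S4 φ hφ →ₐ[ℂ] Module.End ℂ TwistedCurrent where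
  toFun y := (rep φ hφ y).restrictScalars ℂ
  map_one' := by rw [map_one]; rfl
  map_mul' y z := by rw [map_mul]; rfl
  map_zero' := by rw [map_zero]; rfl
  map_add' y z := by rw [map_add]; rfl
  commutes' c := by
    have h : algebraMap ℂ (S4 φ hφ) c = S4.fn φ hφ (algebraMap ℂ SmoothI c) := rfl
    rw [h]
    ext1 w
    change rep φ hφ _ w = c • w
    rw [rep_fn, algebraMap_smul]

theorem repComplex_apply (y : S4 φ hφ) (w : TwistedCurrent) :
    repComplex φ hφ y w = rep φ hφ y w := rfl

/-- The exterior derivative of twisted currents. -/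
def twistedDiff : Module.End ℂ TwistedCurrent where
  toFun w n := Current.diff (w n)
  map_add' v w := funext fun n => Current.diff.map_add (v n) (w n)
  map_smul' c w := funext fun n => Current.diff.map_smul c (w n)

theorem twistedDiff_mul_self : twistedDiff * twistedDiff = 0 := by
  ext1 w
  funext n
  exact Current.diff_diff (w n)

theorem commutator_fn (f : SmoothI) (w : TwistedCurrent) (n : ℤ × ℤ) :
    (twistedDiff * repComplex φ hφ (S4.fn φ hφ f) - repComplex φ hφ (S4.fn φ hφ f) * twistedDiff) w n =
      dMul (C f) (w n) := by
  change Current.diff (rep φ hφ (S4.fn φ hφ f) w n) - rep φ hφ (S4.fn φ hφ f) (twistedDiff w) n = _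
  rw [rep_fn, rep_fn]
  change Current.diff (f • w n) - f • Current.diff (w n) = _
  rw [← C_smul, diff_smul, C_smul, add_sub_cancel_left]

theorem commutator_x (i : Fin 4) (w : TwistedCurrent) (n : ℤ × ℤ) :
    (twistedDiff * repComplex φ hφ (S4.x φ hφ i) - repComplex φ hφ (S4.x φ hφ i) * twistedDiff) w n =
      dMul (twist φ hφ i n) (w (n - torusDegree i)) := by
  change Current.diff (rep φ hφ (S4.x φ hφ i) w n) - rep φ hφ (S4.x φ hφ i) (twistedDiff w) n = _
  rw [rep_x, genAction_apply, genAction_apply, diff_smul]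
  exact add_sub_cancel_left _ _

/-- Shifting the degree multiplies the twist by a half power of `λ`, which depends on `t`. The last
term of the Leibniz rule contains its logarithmic derivative, which is exactly `½ B_ij`; hence the
shape of the relation for `x^i dx^j`. -/
theorem dMul_twist_sub (i j : Fin 4) (n : ℤ × ℤ) (w : Current) :
    dMul (twist φ hφ j (n - torusDegree i)) w =
      (C (phase φ hφ (det₂ (torusDegree i) (torusDegree j))) : StripPoly) •
        dMul (twist φ hφ j n) w +
      (1 / 2 : ℂ) • ((C (matB φ hφ i j) * twist φ hφ j (n - torusDegree i) : StripPoly) •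
        dMul (C SmoothI.coord) w) := by
  have h : -det₂ (torusDegree j) (torusDegree i) = det₂ (torusDegree i) (torusDegree j) := by
    simp only [det₂]
    ring
  have h2 : (1 / 2 : ℂ) • (C (matB φ hφ i j) : StripPoly) *
      C (phase φ hφ (det₂ (torusDegree i) (torusDegree j))) =
      C (SmoothI.deriv (phase φ hφ (det₂ (torusDegree i) (torusDegree j)))) := by
    rw [deriv_phase, matB_eq, smul_mul_assoc, ← map_mul, smul_mul_assoc]
    have hC : ∀ (c : ℂ) (f : SmoothI), (C (c • f) : StripPoly) = c • C f := fun c f => by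
      rw [Algebra.smul_def, map_mul, Algebra.smul_def]
      rfl
    rw [hC, hC, smul_smul]
    congr 1
    push_cast
    ring
  rw [twist_sub, h, Derivation.leibniz, LinearMap.add_apply, LinearMap.smul_apply,
    LinearMap.smul_apply, dMul_C, ← h2, LinearMap.smul_apply, ← mul_smul, ← smul_assoc]
  congr 2
  simp only [smul_mul_assoc, mul_smul_comm]
  congr 1
  ring

theorem diff_commutes_dt (y : S4 φ hφ) (w : TwistedCurrent) (n : ℤ × ℤ) :
    dMul (C SmoothI.coord) (rep φ hφ y w n) =
      rep φ hφ y (fun m => dMul (C SmoothI.coord) (w m)) n := by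
  induction y using S4.induction generalizing w n with
  | hf f =>
    rw [rep_fn, rep_fn]
    change dMul (C SmoothI.coord) (f • w n) = f • dMul (C SmoothI.coord) (w n)
    rw [← C_smul, ← C_smul, map_smul]
  | hx i => rw [rep_x, genAction_apply, genAction_apply, map_smul]
  | hadd y z hy hz =>
    rw [map_add]
    change dMul _ (rep φ hφ y w n + rep φ hφ z w n) = _ + _
    rw [map_add, hy, hz]
  | hmul y z hy hz =>
    rw [map_mul]
    change dMul _ (rep φ hφ y (rep φ hφ z w) n) = rep φ hφ y (rep φ hφ z _) n
    rw [hy]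
    exact congrArg (fun u => rep φ hφ y u n) (funext fun m => hz w m)

end TwistedCurrent

end TwistedRep

section TwistedRep

variable (φ : ℝ → ℝ) (hφ : ContDiffOn ℝ ∞ φ (Set.Icc (-1) 1))

namespace TwistedCurrent

/-- The commutator with the exterior derivative. -/
def commutator (y : S4 φ hφ) : Module.End ℂ TwistedCurrent :=
  twistedDiff * repComplex φ hφ y - repComplex φ hφ y * twistedDiff

theorem commutator_fn_apply (f : SmoothI) (w : TwistedCurrent) (n : ℤ × ℤ) :
    commutator φ hφ (S4.fn φ hφ f) w n = dMul (C f) (w n) := commutator_fn φ hφ f w n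

theorem commutator_t (w : TwistedCurrent) :
    commutator φ hφ (S4.t φ hφ) w = fun n => dMul (C SmoothI.coord) (w n) :=
  funext fun n => commutator_fn φ hφ SmoothI.coord w n

theorem commutator_t_apply (w : TwistedCurrent) (n : ℤ × ℤ) :
    commutator φ hφ (S4.t φ hφ) w n = dMul (C SmoothI.coord) (w n) :=
  commutator_fn φ hφ SmoothI.coord w n

theorem commutator_x_apply (i : Fin 4) (w : TwistedCurrent) (n : ℤ × ℤ) :
    commutator φ hφ (S4.x φ hφ i) w n = dMul (twist φ hφ i n) (w (n - torusDegree i)) :=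
  commutator_x φ hφ i w n

theorem repComplex_fn_apply (f : SmoothI) (w : TwistedCurrent) (n : ℤ × ℤ) :
    repComplex φ hφ (S4.fn φ hφ f) w n = (C f : StripPoly) • w n := by
  rw [repComplex_apply, rep_fn]
  rfl

theorem repComplex_x_apply (i : Fin 4) (w : TwistedCurrent) (n : ℤ × ℤ) :
    repComplex φ hφ (S4.x φ hφ i) w n = twist φ hφ i n • w (n - torusDegree i) := by
  rw [repComplex_apply, rep_x, genAction_apply]

/-- The phases of conjugate generators can be compared in one common degree, where they cancel. What
remains is the Leibniz rule for the classical product of coordinates. -/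
theorem repComplex_mul_commutator_x {i j : Fin 4} (hij : torusDegree i + torusDegree j = 0)
    (w : TwistedCurrent) (n : ℤ × ℤ) :
    repComplex φ hφ (S4.x φ hφ i) (commutator φ hφ (S4.x φ hφ j) w) n +
      repComplex φ hφ (S4.x φ hφ j) (commutator φ hφ (S4.x φ hφ i) w) n =
      dMul (complexCoord i * complexCoord j) (w n) := by
  have hji : torusDegree j + torusDegree i = 0 := by rwa [add_comm]
  rw [repComplex_x_apply, repComplex_x_apply, commutator_x_apply, commutator_x_apply,
    twist_sub_opposite φ hφ hij, twist_sub_opposite φ hφ hji, sub_sub, sub_sub, hij, hji,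
    sub_zero, ← twist_mul_twist φ hφ hij n, Derivation.leibniz, LinearMap.add_apply,
    LinearMap.smul_apply, LinearMap.smul_apply]

/-- The module arithmetic behind the relation for `x^i dx^j`; the hypothesis `h` holds the
comparison of phases. -/
theorem smul_smul_dMul_add {a a' b b' p q r t : StripPoly} (h : a * p = q * a') (u : Current) :
    a • (p • dMul b u + (1 / 2 : ℂ) • ((r * b') • dMul t u)) =
      q • dMul b (a' • u) + (1 / 2 : ℂ) • (r • dMul t (a • b' • u)) := by
  have e : a * (r * b') = r * (a * b') := mul_left_comm _ _ _
  rw [map_smul (dMul b), map_smul (dMul t), map_smul (dMul t), smul_add, ← mul_smul a p, h,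
    mul_smul, smul_comm a (1 / 2 : ℂ), ← mul_smul a, e, mul_smul r, mul_smul a]

theorem commutatorRep_calcRel : ∀ s ∈ S4.CalcRel φ hφ,
    UnivForms.commutatorRep (repComplex φ hφ) twistedDiff s = 0 := by
  intro s hs
  have hd : ∀ y, UnivForms.commutatorRep (repComplex φ hφ) twistedDiff (UnivForms.dincl y) =
      commutator φ hφ y := UnivForms.commutatorRep_dincl _ _
  have hi := UnivForms.commutatorRep_incl (repComplex φ hφ) twistedDiff
  cases hs with
  | chain f =>
    rw [map_sub, map_mul, hd, hd, hi]
    ext1 w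
    funext n
    change commutator φ hφ (S4.fn φ hφ f) w n - repComplex φ hφ (S4.fn φ hφ _)
      (commutator φ hφ (S4.t φ hφ) w) n = 0
    rw [commutator_fn_apply, repComplex_fn_apply, commutator_t_apply, dMul_C,
      LinearMap.smul_apply, sub_self]
  | dt_central y =>
    rw [map_sub, map_mul, map_mul, hd, hi]
    ext1 w
    funext n
    change repComplex φ hφ y (commutator φ hφ (S4.t φ hφ) w) n -
      commutator φ hφ (S4.t φ hφ) (repComplex φ hφ y w) n = 0
    rw [commutator_t, commutator_t, repComplex_apply, repComplex_apply]
    exact sub_eq_zero.2 (diff_commutes_dt φ hφ y w n).symm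
  | t_comm i =>
    rw [map_sub, map_mul, map_mul, hd, hi]
    ext1 w
    funext n
    change repComplex φ hφ (S4.fn φ hφ _) (commutator φ hφ (S4.x φ hφ i) w) n -
      commutator φ hφ (S4.x φ hφ i) (repComplex φ hφ (S4.fn φ hφ _) w) n = 0
    rw [repComplex_fn_apply, commutator_x_apply, commutator_x_apply, repComplex_fn_apply,
      map_smul, sub_self]
  | comm i j =>
    rw [map_sub, map_add, map_smul, map_mul, map_mul, map_mul, map_mul, map_mul, hd, hd, hi, hi,
      hi, hi]
    ext1 w
    funext n
    change repComplex φ hφ (S4.x φ hφ i) (commutator φ hφ (S4.x φ hφ j) w) n -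
      (repComplex φ hφ (S4.fn φ hφ _) (commutator φ hφ (S4.x φ hφ j)
        (repComplex φ hφ (S4.x φ hφ i) w)) n +
      (1 / 2 : ℂ) • repComplex φ hφ (S4.fn φ hφ _) (commutator φ hφ (S4.t φ hφ)
        (repComplex φ hφ (S4.x φ hφ i * S4.x φ hφ j) w)) n) = 0
    have hm : repComplex φ hφ (S4.x φ hφ i * S4.x φ hφ j) w =
        repComplex φ hφ (S4.x φ hφ i) (repComplex φ hφ (S4.x φ hφ j) w) := by
      rw [map_mul]; rfl
    rw [hm, repComplex_x_apply, commutator_x_apply, repComplex_fn_apply, commutator_x_apply,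
      repComplex_x_apply, repComplex_fn_apply, commutator_t_apply, repComplex_x_apply,
      repComplex_x_apply, sub_sub, sub_sub, add_comm (torusDegree j) (torusDegree i),
      dMul_twist_sub φ hφ i j, sub_eq_zero]
    refine smul_smul_dMul_add ?_ _
    rw [twist_sub, ← mul_assoc, ← map_mul, matA_eq, ← phase_add, mul_comm]
    congr 3
    ring
  | sphere =>
    have h2 : UnivForms.commutatorRep (repComplex φ hφ) twistedDiff 2 = 2 := map_ofNat _ 2
    simp only [map_add, map_mul, hd, hi, h2]
    ext1 w
    funext n
    change repComplex φ hφ (S4.x φ hφ 0) (commutator φ hφ (S4.x φ hφ 1) w) n +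
      repComplex φ hφ (S4.x φ hφ 1) (commutator φ hφ (S4.x φ hφ 0) w) n +
      repComplex φ hφ (S4.x φ hφ 2) (commutator φ hφ (S4.x φ hφ 3) w) n +
      repComplex φ hφ (S4.x φ hφ 3) (commutator φ hφ (S4.x φ hφ 2) w) n +
      ((2 : Module.End ℂ TwistedCurrent) (repComplex φ hφ (S4.fn φ hφ _)
        (commutator φ hφ (S4.t φ hφ) w))) n = 0
    have h3 : ∀ u : TwistedCurrent, (2 : Module.End ℂ TwistedCurrent) u n = u n + u n := by
      intro u
      rw [← one_add_one_eq_two]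
      rfl
    rw [h3, repComplex_mul_commutator_x φ hφ (by rfl), add_assoc (dMul _ _),
      repComplex_mul_commutator_x φ hφ (by rfl), repComplex_fn_apply, commutator_t_apply,
      ← LinearMap.add_apply, ← map_add]
    -- Since the differential of `sphereEq` acts as zero, `d(a ā + b b̄) = -2t dt`, which cancels
    -- the remaining term.
    have h4 : complexCoord 0 * complexCoord 1 + complexCoord 2 * complexCoord 3 =
        1 + sphereEq - C SmoothI.coord * C SmoothI.coord := by
      rw [← sum_complexCoord]; ring
    rw [h4, map_sub, map_add, Derivation.map_one_eq_zero, Current.dMul_sphereEq,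
      Derivation.leibniz]
    simp

/-- The representation of the differential algebra on the twisted currents. -/
def formRep : S4.Forms φ hφ →ₐ[ℂ] Module.End ℂ TwistedCurrent :=
  FormsMod.commutatorRep (repComplex φ hφ) twistedDiff twistedDiff_mul_self
    (S4.parity_calcRel φ hφ) (commutatorRep_calcRel φ hφ)

theorem formRep_inc (y : S4 φ hφ) : formRep φ hφ (S4.inc φ hφ y) = repComplex φ hφ y :=
  FormsMod.commutatorRep_incl _ _ _ _ _ y

theorem formRep_dOf (y : S4 φ hφ) : formRep φ hφ (S4.dOf φ hφ y) = commutator φ hφ y :=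
  FormsMod.commutatorRep_dincl _ _ _ _ _ y

/-- The current `w` in degree `n` of `ℤ²`. -/
def single (n : ℤ × ℤ) (w : Current) : TwistedCurrent := Pi.single (M := fun _ => Current) n w

theorem single_self (n : ℤ × ℤ) (w : Current) : single n w n = w :=
  Pi.single_eq_same (M := fun _ => Current) n w

theorem single_of_ne {m n : ℤ × ℤ} (h : m ≠ n) (w : Current) : single n w m = 0 :=
  Pi.single_eq_of_ne (M := fun _ => Current) h w

theorem single_add (n : ℤ × ℤ) (v w : Current) : single n (v + w) = single n v + single n w :=
  Pi.single_add (f := fun _ => Current) n v w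

theorem single_sub (n : ℤ × ℤ) (v w : Current) : single n (v - w) = single n v - single n w :=
  Pi.single_sub (f := fun _ => Current) n v w

theorem single_smul (n : ℤ × ℤ) (c : ℂ) (w : Current) : single n (c • w) = c • single n w :=
  Pi.single_smul (f := fun _ => Current) n c w

theorem apply_single_eq_single {T : Module.End ℂ TwistedCurrent} {U : ℤ × ℤ → Current → Current}
    (hU : ∀ n, U n 0 = 0) {k : ℤ × ℤ} (hT : ∀ w n, T w n = U n (w (n - k)))
    (m : ℤ × ℤ) (w : Current) : T (single m w) = single (m + k) (U (m + k) w) := by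
  funext n
  rw [hT]
  by_cases h : n = m + k
  · subst h
    rw [add_sub_cancel_right, single_self, single_self]
  · rw [single_of_ne h, single_of_ne, hU]
    rintro rfl
    exact h (sub_add_cancel n k).symm

theorem repComplex_x_single (i : Fin 4) (m : ℤ × ℤ) (w : Current) :
    repComplex φ hφ (S4.x φ hφ i) (single m w) =
      single (m + torusDegree i) (twist φ hφ i (m + torusDegree i) • w) :=
  apply_single_eq_single (U := fun n u => twist φ hφ i n • u) (fun _ => smul_zero _)
    (repComplex_x_apply φ hφ i) m w

theorem commutator_x_single (i : Fin 4) (m : ℤ × ℤ) (w : Current) :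
    commutator φ hφ (S4.x φ hφ i) (single m w) =
      single (m + torusDegree i) (dMul (twist φ hφ i (m + torusDegree i)) w) :=
  apply_single_eq_single (U := fun n u => dMul (twist φ hφ i n) u) (fun _ => map_zero _)
    (commutator_x_apply φ hφ i) m w

theorem commutator_t_single (m : ℤ × ℤ) (w : Current) :
    commutator φ hφ (S4.t φ hφ) (single m w) = single m (dMul (C SmoothI.coord) w) := by
  have h := apply_single_eq_single (T := commutator φ hφ (S4.t φ hφ)) (k := 0)
    (U := fun _ u => dMul (C SmoothI.coord) u) (fun _ => map_zero _)
    (fun w n => by rw [commutator_t_apply, sub_zero]) m w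
  rwa [add_zero] at h

theorem repComplex_fn_single (f : SmoothI) (m : ℤ × ℤ) (w : Current) :
    repComplex φ hφ (S4.fn φ hφ f) (single m w) = single m ((C f : StripPoly) • w) := by
  have h := apply_single_eq_single (T := repComplex φ hφ (S4.fn φ hφ f)) (k := 0)
    (U := fun _ u => (C f : StripPoly) • u) (fun _ => smul_zero _)
    (fun w n => by rw [repComplex_fn_apply, sub_zero]) m w
  rwa [add_zero] at h

theorem twist_eq_complexCoord {i : Fin 4} {n : ℤ × ℤ} (h : det₂ (torusDegree i) n = 0) :
    twist φ hφ i n = complexCoord i := by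
  rw [twist, h, phase_zero, map_one, one_mul]

/-- In each summand of `ω` conjugate generators are paired. Starting from degree zero, every
generator therefore lands in a degree that is zero or its own, where its phase is trivial. -/
theorem formRep_omega_single (w : Current) :
    formRep φ hφ (S4.omega φ hφ) (single 0 w) = single 0 (Current.volumeMul w) := by
  have t0 : twist φ hφ 0 0 = complexCoord 0 := twist_eq_complexCoord φ hφ (by decide)
  have t1 : twist φ hφ 1 (torusDegree 1) = complexCoord 1 :=
    twist_eq_complexCoord φ hφ (by decide)
  have t2 : twist φ hφ 2 0 = complexCoord 2 := twist_eq_complexCoord φ hφ (by decide)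
  have t3 : twist φ hφ 3 (torusDegree 3) = complexCoord 3 :=
    twist_eq_complexCoord φ hφ (by decide)
  have s0 : torusDegree 1 + torusDegree 0 = 0 := by decide
  have s2 : torusDegree 3 + torusDegree 2 = 0 := by decide
  have h : ∀ S T : Module.End ℂ TwistedCurrent, ∀ u, (S * T) u = S (T u) := fun _ _ _ => rfl
  simp only [S4.omega, map_smul, map_add, map_sub, map_mul, formRep_inc, formRep_dOf,
    LinearMap.smul_apply, LinearMap.add_apply, LinearMap.sub_apply, h, commutator_x_single,
    repComplex_x_single, commutator_t_single, zero_add, s0, s2, t0, t1, t2, t3]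
  rw [S4.t, repComplex_fn_single]
  rw [Current.volumeMul, single_smul, single_add, single_sub, single_smul, single_smul]
  simp only [map_smul (dMul _) (complexCoord 3)]

theorem repComplex_x_pow_single (i : Fin 4) (k : ℕ) (m : ℤ × ℤ) (w : Current) :
    repComplex φ hφ (S4.x φ hφ i ^ k) (single m w) = single (m + k • torusDegree i)
      ((C (phase φ hφ (k * det₂ (torusDegree i) m)) * complexCoord i ^ k : StripPoly) • w) := by
  induction k with
  | zero => simp [phase_zero]
  | succ k ih =>
    rw [pow_succ', map_mul]
    change repComplex φ hφ (S4.x φ hφ i) (repComplex φ hφ (S4.x φ hφ i ^ k) (single m w)) = _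
    rw [ih, repComplex_x_single, ← mul_smul, twist]
    have h1 : m + k • torusDegree i + torusDegree i = m + (k + 1) • torusDegree i := by
      rw [add_smul, one_smul, add_assoc]
    -- A generator has determinant zero with its own degree, so all factors of the power contribute
    -- the same phase.
    have h2 : det₂ (torusDegree i) (m + (k + 1) • torusDegree i) = det₂ (torusDegree i) m := by
      simp only [det₂, Prod.fst_add, Prod.snd_add, Prod.smul_fst, Prod.smul_snd]
      simp only [nsmul_eq_mul]
      ring
    have h3 : phase φ hφ (((k + 1 : ℕ) : ℤ) * det₂ (torusDegree i) m) =
        phase φ hφ (det₂ (torusDegree i) m) * phase φ hφ (k * det₂ (torusDegree i) m) := by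
      rw [← phase_add]
      congr 1
      push_cast
      ring
    rw [h1, h2, h3, map_mul]
    congr 2
    ring

end TwistedCurrent

/-! ### The integral on forms -/

namespace S4

open TwistedCurrent

/-- The monomial `f(t) a^i (a*)^j b^k (b*)^l`. -/
def normalMonomial (f : SmoothI) (i j k l : ℕ) : S4 φ hφ :=
  fn φ hφ f * x φ hφ 0 ^ i * x φ hφ 1 ^ j * x φ hφ 2 ^ k * x φ hφ 3 ^ l

/-- The integral, on forms of all degrees. -/
def integral : Forms φ hφ →ₗ[ℂ] ℂ where
  -- The sign offsets the one in `Current.mass_smul_volumeMul`. Evaluation at degree `0` discards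
  -- every part of nonzero torus degree.
  toFun ρ := -Current.mass (formRep φ hφ ρ (single 0 Current.fundamental) 0)
  map_add' ρ σ := by
    rw [map_add]
    change -Current.mass (formRep φ hφ ρ _ 0 + formRep φ hφ σ _ 0) = _
    rw [map_add, neg_add]
  map_smul' c ρ := by
    rw [map_smul]
    change -Current.mass (c • formRep φ hφ ρ _ 0) = c • _
    rw [map_smul, smul_neg]

theorem integral_apply (ρ : Forms φ hφ) : integral φ hφ ρ =
    -Current.mass (formRep φ hφ ρ (single 0 Current.fundamental) 0) := rfl

/-- The form `dρ` acts as `D ρ - z D`. The second term kills the closed fundamental current and the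
first produces an exact current, of mass zero. -/
theorem integral_d (ρ : Forms φ hφ) : integral φ hφ (d φ hφ ρ) = 0 := by
  obtain ⟨z, hz⟩ := FormsMod.exists_commutatorRep_d (repComplex φ hφ) twistedDiff
    twistedDiff_mul_self (parity_calcRel φ hφ) (commutatorRep_calcRel φ hφ) ρ
  have h0 : twistedDiff (single 0 Current.fundamental) = 0 := by
    funext n
    change Current.diff (single 0 Current.fundamental n) = 0
    by_cases h : n = 0
    · rw [h, single_self, Current.diff_fundamental]
    · rw [single_of_ne h, map_zero]
  have h1 : formRep φ hφ (d φ hφ ρ) = twistedDiff * formRep φ hφ ρ - z * twistedDiff := hz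
  rw [integral_apply, h1]
  change -Current.mass (Current.diff (formRep φ hφ ρ (single 0 Current.fundamental) 0) -
    z (twistedDiff (single 0 Current.fundamental)) 0) = 0
  rw [h0, map_zero, Pi.zero_apply, sub_zero, Current.mass_diff, neg_zero]

/-- For `i = j` and `k = l` the path through `ℤ²` returns to zero and each power meets a degree
parallel to its own, so no phase survives. For other exponents the path ends at a nonzero degree,
and the classical integral vanishes too. -/
theorem integral_normalMonomial (f : SmoothI) (i j k l : ℕ) :
    integral φ hφ (inc φ hφ (normalMonomial φ hφ f i j k l) * omega φ hφ) =
      classicalIntegral f i j k l := by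
  rw [integral_apply, map_mul, formRep_inc]
  change -Current.mass (repComplex φ hφ _ (formRep φ hφ (omega φ hφ)
    (single 0 Current.fundamental)) 0) = _
  rw [formRep_omega_single, normalMonomial, map_mul, map_mul, map_mul, map_mul]
  change -Current.mass (repComplex φ hφ (fn φ hφ f) (repComplex φ hφ (x φ hφ 0 ^ i)
    (repComplex φ hφ (x φ hφ 1 ^ j) (repComplex φ hφ (x φ hφ 2 ^ k)
    (repComplex φ hφ (x φ hφ 3 ^ l) (single 0 _))))) 0) = _
  rw [repComplex_x_pow_single, repComplex_x_pow_single, repComplex_x_pow_single,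
    repComplex_x_pow_single, repComplex_fn_single]
  by_cases h : i = j ∧ k = l
  · obtain ⟨rfl, rfl⟩ := h
    have h0 : (0 : ℤ × ℤ) + k • torusDegree 3 + k • torusDegree 2 + i • torusDegree 1 +
        i • torusDegree 0 = 0 := by
      simp [torusDegree]
    rw [h0, single_self, ← sphereIntegral_complexMonomial, ← neg_eq_iff_eq_neg.2
      (Current.mass_smul_volumeMul (complexMonomial f i i k k))]
    simp only [← mul_smul]
    have h1 : det₂ (torusDegree 0) ((0 : ℤ × ℤ) + k • torusDegree 3 + k • torusDegree 2 +
        i • torusDegree 1) = 0 := by simp [torusDegree, det₂]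
    have h2 : det₂ (torusDegree 1) ((0 : ℤ × ℤ) + k • torusDegree 3 + k • torusDegree 2) = 0 := by
      simp [torusDegree, det₂]
    have h3 : det₂ (torusDegree 2) ((0 : ℤ × ℤ) + k • torusDegree 3) = 0 := by
      simp [torusDegree, det₂]
    have h4 : det₂ (torusDegree 3) 0 = 0 := by simp [det₂]
    rw [h1, h2, h3, h4]
    simp only [mul_zero, phase_zero, map_one, one_mul, complexMonomial, mul_assoc]
  · rw [single_of_ne, map_zero, neg_zero, classicalIntegral_eq_zero f h]
    intro h0
    apply h
    simp [torusDegree, Prod.ext_iff] at h0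
    omega

theorem isIntegral_integral :
    IsIntegral φ hφ (integral φ hφ ∘ₗ (nForms φ hφ 4).subtype) :=
  integral_normalMonomial φ hφ

end S4

end TwistedRep

end

/-! ## The relations of the calculus on the sphere in an abstract algebra -/

/-- The matrix of the commutation relations, for arbitrary `λ` and `λ̄`. -/
def phaseMatrix {K : Type} [CommRing K] (l l' : K) : Fin 4 → Fin 4 → K :=
  ![![1, 1, l, l'], ![1, 1, l', l], ![l', l, 1, 1], ![l, l', 1, 1]]

/-- The matrix of the logarithmic derivatives, for an arbitrary value of its first entry. -/
def signMatrix {K : Type} [CommRing K] (β : K) : Fin 4 → Fin 4 → K :=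
  ![![0, 0, β, -β], ![0, 0, -β, β], ![-β, β, 0, 0], ![β, -β, 0, 0]]

/-- Generators of an algebra that satisfy the relations of the differential calculus on the
deformed four-sphere. -/
structure SphereCalculus (K R : Type) [CommRing K] [Ring R] [Algebra K R] where
  /-- the coordinates -/
  x : Fin 4 → R
  /-- their differentials -/
  dx : Fin 4 → R
  /-- the differential of `t` -/
  dt : R
  /-- the central coordinate -/
  t : K
  /-- the deformation parameter -/
  l : K
  /-- its inverse -/
  l' : K
  /-- half its logarithmic derivative -/
  β : K
  l_mul_l' : l * l' = 1
  -- The restriction to `i < j`, here and in `dx_mul_dx`, orients the relations as rewriting rules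
  -- that sort products.
  x_mul_x : ∀ {i j}, i < j → x j * x i = phaseMatrix l l' j i • (x i * x j)
  dx_mul_x : ∀ i j, dx j * x i =
    phaseMatrix l l' j i • (x i * dx j) + signMatrix β j i • (x j * (x i * dt))
  dt_mul_x : ∀ i, dt * x i = x i * dt
  dx_mul_dt : ∀ i, dx i * dt = -(dt * dx i)
  dt_mul_dt : dt * dt = 0
  dx_mul_self : ∀ i, dx i * dx i = 0
  dx_mul_dx : ∀ {i j}, i < j → dx j * dx i = -(phaseMatrix l l' j i • (dx i * dx j)) +
    signMatrix β j i • (x j * (dt * dx i) - phaseMatrix l l' j i • (x i * (dt * dx j)))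
  sphere : x 0 * x 1 + x 2 * x 3 + t ^ 2 • (1 : R) = 1
  d_sphere : x 0 * dx 1 + x 1 * dx 0 + x 2 * dx 3 + x 3 * dx 2 + (2 * t) • dt = 0

namespace SphereCalculus

variable {K R : Type} [CommRing K] [Ring R] [Algebra K R] (S : SphereCalculus K R)

theorem x_mul_x_assoc {i j : Fin 4} (h : i < j) (z : R) :
    S.x j * (S.x i * z) = phaseMatrix S.l S.l' j i • (S.x i * (S.x j * z)) := by
  rw [← mul_assoc, S.x_mul_x h, smul_mul_assoc, mul_assoc]

theorem dx_mul_x_assoc (i j : Fin 4) (z : R) : S.dx j * (S.x i * z) =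
    phaseMatrix S.l S.l' j i • (S.x i * (S.dx j * z)) +
      signMatrix S.β j i • (S.x j * (S.x i * (S.dt * z))) := by
  rw [← mul_assoc, S.dx_mul_x, add_mul, smul_mul_assoc, smul_mul_assoc]
  simp only [mul_assoc]

theorem dt_mul_x_assoc (i : Fin 4) (z : R) : S.dt * (S.x i * z) = S.x i * (S.dt * z) := by
  rw [← mul_assoc, S.dt_mul_x, mul_assoc]

theorem dx_mul_dt_assoc (i : Fin 4) (z : R) : S.dx i * (S.dt * z) = -(S.dt * (S.dx i * z)) := by
  rw [← mul_assoc, S.dx_mul_dt, neg_mul, mul_assoc]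

theorem dt_mul_dt_assoc (z : R) : S.dt * (S.dt * z) = 0 := by
  rw [← mul_assoc, S.dt_mul_dt, zero_mul]

theorem dx_mul_self_assoc (i : Fin 4) (z : R) : S.dx i * (S.dx i * z) = 0 := by
  rw [← mul_assoc, S.dx_mul_self, zero_mul]

theorem dx_mul_dx_assoc {i j : Fin 4} (h : i < j) (z : R) : S.dx j * (S.dx i * z) =
    -(phaseMatrix S.l S.l' j i • (S.dx i * (S.dx j * z))) + signMatrix S.β j i •
      (S.x j * (S.dt * (S.dx i * z)) -
        phaseMatrix S.l S.l' j i • (S.x i * (S.dt * (S.dx j * z)))) := by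
  rw [← mul_assoc, S.dx_mul_dx h]
  simp only [add_mul, sub_mul, neg_mul, smul_mul_assoc, mul_assoc]

theorem l'_mul_l : S.l' * S.l = 1 := by rw [mul_comm, S.l_mul_l']

-- These rules bring a product into normal form: coordinates first, then `dt`, then the other
-- differentials, with increasing indices. The correction terms in `β` carry a factor `dt`, whose
-- square is zero.
attribute [local simp] x_mul_x x_mul_x_assoc dx_mul_x dx_mul_x_assoc dt_mul_x dt_mul_x_assoc
  dx_mul_dt dx_mul_dt_assoc dt_mul_dt dt_mul_dt_assoc dx_mul_self dx_mul_self_assoc dx_mul_dx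
  dx_mul_dx_assoc phaseMatrix signMatrix mul_add mul_sub add_mul sub_mul mul_assoc smul_smul
  smul_sub smul_add l_mul_l' l'_mul_l

/-- The product `da da* db db*`. -/
def E : R := S.dx 0 * (S.dx 1 * (S.dx 2 * S.dx 3))

/-- The product of `dt` and three differentials. -/
def F (i j k : Fin 4) : R := S.dt * (S.dx i * (S.dx j * S.dx k))

/-- Multiplying `d_sphere` by `dt` and two other differentials kills its `dt` term and the terms
with a repeated differential, leaving two. The next four identities come from other pairs of
differentials. -/
theorem x_zero_mul_F_one_two_three : S.x 0 * S.F 1 2 3 = -(S.x 1 * S.F 0 2 3) := by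
  have h := congrArg (fun z => z * (S.dt * (S.dx 2 * S.dx 3))) S.d_sphere
  simp at h
  simp only [F]
  linear_combination (norm := module) -h

theorem x_two_mul_F_zero_one_three : S.x 2 * S.F 0 1 3 = -(S.x 3 * S.F 0 1 2) := by
  have h := congrArg (fun z => z * (S.dt * (S.dx 0 * S.dx 1))) S.d_sphere
  simp at h
  simp only [F]
  linear_combination (norm := module) -h

theorem x_zero_mul_F_zero_one_two : S.x 0 * S.F 0 1 2 = S.l • (S.x 2 * S.F 0 2 3) := by
  have h := congrArg (fun z => z * (S.dt * (S.dx 0 * S.dx 2))) S.d_sphere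
  simp at h
  simp only [F]
  linear_combination (norm := module) h

theorem x_one_mul_F_zero_one_two : S.x 1 * S.F 0 1 2 = -(S.l' • (S.x 2 * S.F 1 2 3)) := by
  have h := congrArg (fun z => z * (S.dt * (S.dx 1 * S.dx 2))) S.d_sphere
  simp at h
  simp only [F]
  linear_combination (norm := module) -h

theorem x_one_mul_F_zero_one_three : S.x 1 * S.F 0 1 3 = S.l • (S.x 3 * S.F 1 2 3) := by
  have h := congrArg (fun z => z * (S.dt * (S.dx 1 * S.dx 3))) S.d_sphere
  simp at h
  simp only [F]
  linear_combination (norm := module) -h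

/-- Here `d_sphere` is multiplied by three differentials without `dt`, so that the term `2t dt`
survives together with the one term whose differential is missing. -/
theorem x_zero_mul_E : S.x 0 * S.E = (2 * S.t) • S.F 0 2 3 := by
  have h := congrArg (fun z => z * (S.dx 0 * (S.dx 2 * S.dx 3))) S.d_sphere
  simp at h
  simp only [E, F]
  linear_combination (norm := module) -h

theorem x_one_mul_E : S.x 1 * S.E = -((2 * S.t) • S.F 1 2 3) := by
  have h := congrArg (fun z => z * (S.dx 1 * (S.dx 2 * S.dx 3))) S.d_sphere
  simp at h
  simp only [E, F]
  linear_combination (norm := module) h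

theorem l_mul_mul_l' (c : K) : S.l * (c * S.l') = c := by
  linear_combination c * S.l_mul_l'

theorem l'_mul_mul_l (c : K) : S.l' * (c * S.l) = c := by
  linear_combination c * S.l_mul_l'

theorem x_two_mul_E : S.x 2 * S.E = (2 * S.t) • S.F 0 1 2 := by
  have h := congrArg (fun z => z * (S.dx 0 * (S.dx 1 * S.dx 2))) S.d_sphere
  -- Moving differentials of `b` past `da da*` leaves terms in `β`, which cancel by this relation.
  have h' := congrArg (fun z => S.x 2 * z) S.x_zero_mul_F_one_two_three
  simp [l_mul_mul_l', l'_mul_mul_l, F] at h h'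
  simp only [E, F]
  linear_combination (norm := module) -h - S.β • h'

theorem x_three_mul_E : S.x 3 * S.E = -((2 * S.t) • S.F 0 1 3) := by
  have h := congrArg (fun z => z * (S.dx 0 * (S.dx 1 * S.dx 3))) S.d_sphere
  have h' := congrArg (fun z => S.x 3 * z) S.x_zero_mul_F_one_two_three
  simp [l_mul_mul_l', l'_mul_mul_l, F] at h h'
  simp only [E, F]
  linear_combination (norm := module) h + S.β • h'

/-- Four times the volume form. -/
def W : R := S.t • S.E - (2 : K) • (S.x 0 * S.F 1 2 3) + (2 : K) • (S.F 0 1 2 * S.x 3)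

/-- The summands of `x₀ W` become twice `t²`, `a a*` and `b b*` times the same form, and these
coefficients add up to `1`. Read backwards, this and the analogues for the other coordinates express
the forms `F` as multiples of `W`. -/
theorem x_zero_mul_W : S.x 0 * S.W = (2 : K) • S.F 0 2 3 := by
  have h := congrArg (fun z => z * S.F 0 2 3) S.sphere
  have h0 := S.x_zero_mul_E
  have h1 := congrArg (fun z => S.x 0 * z) S.x_zero_mul_F_one_two_three
  have h2 := congrArg (fun z => S.x 3 * z) S.x_zero_mul_F_zero_one_two
  simp only [W, F, E] at h h0 h1 h2 ⊢
  simp at h h0 h1 ⊢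
  replace h2 := congrArg (fun z => S.l' • z) h2
  simp at h2
  linear_combination (norm := module) S.t • h0 - (2 : K) • h1 + (2 : K) • h2 + (2 : K) • h

theorem x_one_mul_W : S.x 1 * S.W = -((2 : K) • S.F 1 2 3) := by
  have h := congrArg (fun z => z * S.F 1 2 3) S.sphere
  have h0 := S.x_one_mul_E
  have h2 := congrArg (fun z => S.x 3 * z) S.x_one_mul_F_zero_one_two
  simp only [W, F, E] at h h0 h2 ⊢
  simp at h h0 ⊢
  replace h2 := congrArg (fun z => S.l • z) h2
  simp at h2
  linear_combination (norm := module) S.t • h0 + (2 : K) • h2 - (2 : K) • h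

theorem x_two_mul_W : S.x 2 * S.W = (2 : K) • S.F 0 1 2 := by
  have h := congrArg (fun z => z * S.F 0 1 2) S.sphere
  have h0 := S.x_two_mul_E
  have h2 := congrArg (fun z => S.x 0 * z) S.x_one_mul_F_zero_one_two
  simp only [W, F, E] at h h0 h2 ⊢
  simp at h h0 h2 ⊢
  linear_combination (norm := module) S.t • h0 - (2 : K) • h2 + (2 : K) • h

theorem x_three_mul_W : S.x 3 * S.W = -((2 : K) • S.F 0 1 3) := by
  have h := congrArg (fun z => z * S.F 0 1 3) S.sphere
  have h0 := S.x_three_mul_E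
  have h1 := congrArg (fun z => S.x 3 * z) S.x_two_mul_F_zero_one_three
  have h2 := congrArg (fun z => S.x 0 * z) S.x_one_mul_F_zero_one_three
  simp only [W, F, E] at h h0 h1 h2 ⊢
  simp at h h0 h1 h2 ⊢
  linear_combination (norm := module) S.t • h0 + (2 : K) • h2 - (2 : K) • h + (2 : K) • h1

/-- By the preceding relations `a a* E` and `b b* E` are the last two summands of `t W`, so `t W` is
the sphere relation applied to `E`. -/
theorem t_smul_W : S.t • S.W = S.E := by
  have h := congrArg (fun z => z * S.E) S.sphere
  have h0 := congrArg (fun z => S.x 0 * z) S.x_one_mul_E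
  have h1 := congrArg (fun z => S.x 3 * z) S.x_two_mul_E
  simp only [W, F, E] at h h0 h1 ⊢
  simp at h h0 h1 ⊢
  linear_combination (norm := module) h - h0 - h1

/-- The powers of `λ` from conjugate factors of `W` cancel. The remaining terms are multiples of `t
β` and vanish by the relations between the forms `F`. -/
theorem W_mul_x (i : Fin 4) : S.W * S.x i = S.x i * S.W := by
  have h := congrArg (fun z => S.x i * z) S.x_zero_mul_F_one_two_three
  have h' := congrArg (fun z => S.x i * z) S.x_two_mul_F_zero_one_three
  fin_cases i <;> simp [l_mul_mul_l', l'_mul_mul_l, F, E, W] at h h' ⊢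
  · linear_combination (norm := module) -(S.t * S.β) • h'
  · linear_combination (norm := module) (S.t * S.β) • h'
  · linear_combination (norm := module) (S.t * S.β) • h
  · linear_combination (norm := module) -(S.t * S.β) • h

/-! ### Generators of the left modules of forms -/

/-- The subalgebra generated by the coordinates. -/
abbrev coords : Subalgebra K R := Algebra.adjoin K (Set.range S.x)

/-- Generators of the left modules of forms of degrees one, two, three and four. -/
def words : ℕ → Set R
  | 1 => {S.dt, S.dx 0, S.dx 1, S.dx 2, S.dx 3}
  | 2 => {S.dt * S.dx 0, S.dt * S.dx 1, S.dt * S.dx 2, S.dt * S.dx 3, S.dx 0 * S.dx 1,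
      S.dx 0 * S.dx 2, S.dx 0 * S.dx 3, S.dx 1 * S.dx 2, S.dx 1 * S.dx 3, S.dx 2 * S.dx 3}
  | 3 => {S.dt * (S.dx 0 * S.dx 1), S.dt * (S.dx 0 * S.dx 2), S.dt * (S.dx 0 * S.dx 3),
      S.dt * (S.dx 1 * S.dx 2), S.dt * (S.dx 1 * S.dx 3), S.dt * (S.dx 2 * S.dx 3),
      S.dx 0 * (S.dx 1 * S.dx 2), S.dx 0 * (S.dx 1 * S.dx 3), S.dx 0 * (S.dx 2 * S.dx 3),
      S.dx 1 * (S.dx 2 * S.dx 3)}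
  -- The identities above let `W` alone replace the five products of four differentials.
  | 4 => {S.W}
  | _ => ∅

/-- The left module of forms of degree `n`. -/
def forms (n : ℕ) : Submodule S.coords R := Submodule.span S.coords (S.words n)

theorem x_mul_mem (i : Fin 4) {n : ℕ} {w : R} (h : w ∈ S.forms n) : S.x i * w ∈ S.forms n :=
  (S.forms n).smul_mem ⟨S.x i, Algebra.subset_adjoin ⟨i, rfl⟩⟩ h

theorem smul_mem_forms (c : K) {n : ℕ} {w : R} (h : w ∈ S.forms n) : c • w ∈ S.forms n := by
  have := (S.forms n).smul_mem (c • (1 : S.coords)) h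
  rwa [smul_assoc, one_smul] at this

theorem word_mem_forms {n : ℕ} {w : R} (h : w ∈ S.words n) : w ∈ S.forms n :=
  Submodule.subset_span h

theorem word_mul_word_mem_one {v w : R} (hv : v ∈ S.words 1) (hw : w ∈ S.words 1) :
    v * w ∈ S.forms 2 := by
  have h := fun w => S.word_mem_forms (n := 2) (w := w)
  simp only [words, Set.mem_insert_iff, Set.mem_singleton_iff, forall_eq_or_imp, forall_eq] at h
  obtain ⟨h0, h1, h2, h3, h4, h5, h6, h7, h8, h9⟩ := h
  simp only [words, Set.mem_insert_iff, Set.mem_singleton_iff] at hv hw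
  rcases hv with rfl | rfl | rfl | rfl | rfl <;> rcases hw with rfl | rfl | rfl | rfl | rfl <;>
  -- Simplification sorts each product into coordinates times generators of the next degree, and
  -- closure of the module does the rest.
  (try simp) <;>
  repeat with_reducible first
    | assumption | apply x_mul_mem | apply smul_mem_forms | apply add_mem | apply neg_mem
    | apply sub_mem | exact zero_mem _

theorem word_mul_word_mem_two {v w : R} (hv : v ∈ S.words 1) (hw : w ∈ S.words 2) :
    v * w ∈ S.forms 3 := by
  have h := fun w => S.word_mem_forms (n := 3) (w := w)
  simp only [words, Set.mem_insert_iff, Set.mem_singleton_iff, forall_eq_or_imp, forall_eq] at h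
  obtain ⟨h0, h1, h2, h3, h4, h5, h6, h7, h8, h9⟩ := h
  simp only [words, Set.mem_insert_iff, Set.mem_singleton_iff] at hv hw
  rcases hv with rfl | rfl | rfl | rfl | rfl <;>
  rcases hw with rfl | rfl | rfl | rfl | rfl | rfl | rfl | rfl | rfl | rfl <;>
  (try simp) <;>
  repeat with_reducible first
    | assumption | apply x_mul_mem | apply smul_mem_forms | apply add_mem | apply neg_mem
    | apply sub_mem | exact zero_mem _

theorem mem_forms_four [Invertible (2 : K)] {v w : R} (hv : v ∈ S.forms 4) (h : v = (2 : K) • w) :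
    w ∈ S.forms 4 := by
  rw [← invOf_smul_smul (2 : K) w, ← h]
  exact S.smul_mem_forms _ hv

theorem x_mul_W_mem (i : Fin 4) : S.x i * S.W ∈ S.forms 4 :=
  S.x_mul_mem i (S.word_mem_forms rfl)

theorem E_mem : S.dx 0 * (S.dx 1 * (S.dx 2 * S.dx 3)) ∈ S.forms 4 := by
  change S.E ∈ _
  rw [← t_smul_W]
  exact S.smul_mem_forms _ (S.word_mem_forms rfl)

theorem F_zero_two_three_mem [Invertible (2 : K)] : S.dt * (S.dx 0 * (S.dx 2 * S.dx 3)) ∈ S.forms 4 :=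
  S.mem_forms_four (S.x_mul_W_mem 0) S.x_zero_mul_W

theorem F_one_two_three_mem [Invertible (2 : K)] : S.dt * (S.dx 1 * (S.dx 2 * S.dx 3)) ∈ S.forms 4 :=
  S.mem_forms_four (neg_mem (S.x_mul_W_mem 1)) (by rw [x_one_mul_W, neg_neg]; rfl)

theorem F_zero_one_two_mem [Invertible (2 : K)] : S.dt * (S.dx 0 * (S.dx 1 * S.dx 2)) ∈ S.forms 4 :=
  S.mem_forms_four (S.x_mul_W_mem 2) S.x_two_mul_W

theorem F_zero_one_three_mem [Invertible (2 : K)] : S.dt * (S.dx 0 * (S.dx 1 * S.dx 3)) ∈ S.forms 4 :=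
  S.mem_forms_four (neg_mem (S.x_mul_W_mem 3)) (by rw [x_three_mul_W, neg_neg]; rfl)

theorem word_mul_word_mem_three [Invertible (2 : K)] {v w : R} (hv : v ∈ S.words 1)
    (hw : w ∈ S.words 3) :
    v * w ∈ S.forms 4 := by
  have h0 := S.E_mem
  have h1 := S.F_zero_two_three_mem
  have h2 := S.F_one_two_three_mem
  have h3 := S.F_zero_one_two_mem
  have h4 := S.F_zero_one_three_mem
  simp only [words, Set.mem_insert_iff, Set.mem_singleton_iff] at hv hw
  rcases hv with rfl | rfl | rfl | rfl | rfl <;>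
  rcases hw with rfl | rfl | rfl | rfl | rfl | rfl | rfl | rfl | rfl | rfl <;>
  (try simp) <;>
  repeat with_reducible first
    | assumption | apply x_mul_mem | apply smul_mem_forms | apply add_mem | apply neg_mem
    | apply sub_mem | exact zero_mem _

theorem word_mul_x_mem {v : R} (hv : v ∈ S.words 1) (i : Fin 4) : v * S.x i ∈ S.forms 1 := by
  have h := fun w => S.word_mem_forms (n := 1) (w := w)
  simp only [words, Set.mem_insert_iff, Set.mem_singleton_iff, forall_eq_or_imp, forall_eq] at h
  obtain ⟨h0, h1, h2, h3, h4⟩ := h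
  simp only [words, Set.mem_insert_iff, Set.mem_singleton_iff] at hv
  rcases hv with rfl | rfl | rfl | rfl | rfl <;> fin_cases i <;>
  simp <;>
  repeat with_reducible first
    | assumption | apply x_mul_mem | apply smul_mem_forms | apply add_mem | apply neg_mem
    | apply sub_mem | exact zero_mem _

theorem forms_one_mul_x_mem {v : R} (hv : v ∈ S.forms 1) (i : Fin 4) :
    v * S.x i ∈ S.forms 1 := by
  induction hv using Submodule.span_induction with
  | mem v h => exact S.word_mul_x_mem h i
  | zero => simp
  | add a b _ _ ha hb => rw [add_mul]; exact add_mem ha hb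
  | smul c a _ ha => rw [smul_mul_assoc]; exact Submodule.smul_mem _ _ ha

theorem forms_one_mul_coords_mem {v y : R} (hv : v ∈ S.forms 1) (hy : y ∈ S.coords) :
    v * y ∈ S.forms 1 := by
  induction hy using Algebra.adjoin_induction generalizing v with
  | mem y h => obtain ⟨i, rfl⟩ := h; exact S.forms_one_mul_x_mem hv i
  | algebraMap r => rw [← Algebra.commutes, ← Algebra.smul_def]; exact S.smul_mem_forms _ hv
  | add a b _ _ ha hb => rw [mul_add]; exact add_mem (ha hv) (hb hv)
  | mul a b _ _ ha hb => rw [← mul_assoc]; exact hb (ha hv)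

/-- Coefficients of the second factor can be absorbed by the first, since the left module of
one-forms is also stable under right multiplication by coordinates. -/
theorem forms_one_mul_mem {n : ℕ} (h : ∀ v ∈ S.words 1, ∀ w ∈ S.words n, v * w ∈ S.forms (n + 1))
    {v w : R} (hv : v ∈ S.forms 1) (hw : w ∈ S.forms n) : v * w ∈ S.forms (n + 1) := by
  induction hw using Submodule.span_induction generalizing v with
  | mem w hw =>
    induction hv using Submodule.span_induction with
    | mem v hv => exact h v hv w hw
    | zero => simp
    | add a b _ _ ha hb => rw [add_mul]; exact add_mem ha hb
    | smul c a _ ha => rw [smul_mul_assoc]; exact Submodule.smul_mem _ _ ha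
  | zero => simp
  | add a b _ _ ha hb => rw [mul_add]; exact add_mem (ha hv) (hb hv)
  | smul c a _ ha =>
    rw [Subalgebra.smul_def, smul_eq_mul, ← mul_assoc]
    exact ha (S.forms_one_mul_coords_mem hv c.2)

theorem exists_eq_mul_W [Invertible (2 : K)] {u v w z : R} (hu : u ∈ S.forms 1)
    (hv : v ∈ S.forms 1) (hw : w ∈ S.forms 1) (hz : z ∈ S.forms 1) :
    ∃ y ∈ S.coords, u * (v * (w * z)) = y * S.W := by
  have h := S.forms_one_mul_mem (fun _ h _ h' => S.word_mul_word_mem_three h h') hu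
    (S.forms_one_mul_mem (fun _ h _ h' => S.word_mul_word_mem_two h h') hv
      (S.forms_one_mul_mem (fun _ h _ h' => S.word_mul_word_mem_one h h') hw hz))
  obtain ⟨y, hy⟩ := Submodule.mem_span_singleton.1 h
  exact ⟨y, y.2, hy.symm⟩

theorem W_mul_coords {y : R} (hy : y ∈ S.coords) : S.W * y = y * S.W := by
  induction hy using Algebra.adjoin_induction with
  | mem y h => obtain ⟨i, rfl⟩ := h; exact S.W_mul_x i
  | algebraMap r => rw [Algebra.commutes]
  | add a b _ _ ha hb => rw [mul_add, add_mul, ha, hb]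
  | mul a b _ _ ha hb => rw [← mul_assoc, ha, mul_assoc, hb, mul_assoc]

end SphereCalculus

section

open SmoothI

/-! ## The differential calculus of `S⁴_λ` -/

namespace FormsMod

open UnivForms

variable {A : Type} [Ring A] [Algebra ℂ A] {S : Set (UnivForms A)}

theorem proj_surjective : Function.Surjective (proj S) := RingQuot.mkAlgHom_surjective ℂ _

theorem proj_eq_zero_of_mem {s : UnivForms A} (hs : s ∈ S) : proj S s = 0 :=
  proj_eq_zero (Submodule.subset_span ⟨1, 1, s, hs, by simp⟩)

theorem induction {P : FormsMod S → Prop} (h0 : ∀ x : A, P (incl S x))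
    (h1 : ∀ x : A, P (dincl S x)) (hadd : ∀ x y, P x → P y → P (x + y))
    (hmul : ∀ x y, P x → P y → P (x * y)) (w : FormsMod S) : P w := by
  obtain ⟨u, rfl⟩ := proj_surjective w
  induction u using UnivForms.induction with
  | scalar c =>
    have := h0 (algebraMap ℂ A c)
    rwa [AlgHom.commutes, ← (proj S).commutes] at this
  | h0 x => exact h0 x
  | h1 x => exact h1 x
  | hadd x y hx hy => rw [map_add]; exact hadd _ _ hx hy
  | hmul x y hx hy => rw [map_mul]; exact hmul _ _ hx hy

variable (hS : ∀ s ∈ S, parity s = -s)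

theorem d_incl (x : A) : d hS (incl S x) = dincl S x := by
  simp only [incl, dincl, AlgHom.comp_apply, d_proj, UnivForms.d_incl]
  rfl

theorem d_dincl (x : A) : d hS (dincl S x) = 0 := by
  simp only [dincl, LinearMap.comp_apply, AlgHom.toLinearMap_apply, d_proj, UnivForms.d_dincl,
    map_zero]

theorem d_incl_mul (x : A) (w : FormsMod S) :
    d hS (incl S x * w) = incl S x * d hS w + dincl S x * w := by
  obtain ⟨u, rfl⟩ := proj_surjective w
  simp only [incl, dincl, LinearMap.comp_apply, AlgHom.toLinearMap_apply, AlgHom.comp_apply,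
    ← map_mul, d_proj, ← map_add, UnivForms.d_mul, parity_incl, UnivForms.d_incl]

theorem d_dincl_mul (x : A) (w : FormsMod S) :
    d hS (dincl S x * w) = -(dincl S x * d hS w) := by
  obtain ⟨u, rfl⟩ := proj_surjective w
  have h : dincl S x * proj S u = proj S (UnivForms.dincl x * u) := by
    rw [map_mul]
    rfl
  rw [h, d_proj, UnivForms.d_mul, parity_dincl, UnivForms.d_dincl, zero_mul, add_zero, neg_mul,
    map_neg, map_mul, d_proj]
  rfl

end FormsMod

section Calculus

variable (φ : ℝ → ℝ) (hφ : ContDiffOn ℝ ∞ φ (Set.Icc (-1) 1))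

namespace S4

theorem dOf_fn (f : SmoothI) :
    dOf φ hφ (fn φ hφ f) = inc φ hφ (fn φ hφ (deriv f)) * dOf φ hφ (t φ hφ) := by
  have h := FormsMod.proj_eq_zero_of_mem (CalcRel.chain (φ := φ) (hφ := hφ) f)
  rw [map_sub, map_mul, sub_eq_zero] at h
  exact h

theorem inc_mul_dt (y : S4 φ hφ) :
    inc φ hφ y * dOf φ hφ (t φ hφ) = dOf φ hφ (t φ hφ) * inc φ hφ y := by
  have h := FormsMod.proj_eq_zero_of_mem (CalcRel.dt_central (φ := φ) (hφ := hφ) y)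
  rw [map_sub, map_mul, map_mul, sub_eq_zero] at h
  exact h

/-- Differentiate `f y = y f`. The terms with `df = ḟ dt` agree because `ḟ` and `dt` commute with
`y`. -/
theorem inc_fn_mul_dOf (f : SmoothI) (y : S4 φ hφ) :
    inc φ hφ (fn φ hφ f) * dOf φ hφ y = dOf φ hφ y * inc φ hφ (fn φ hφ f) := by
  have h : fn φ hφ f * y = y * fn φ hφ f := Algebra.commutes f y
  have h1 := congrArg (dOf φ hφ) h
  rw [FormsMod.dincl_mul, FormsMod.dincl_mul, dOf_fn, mul_assoc, ← inc_mul_dt, ← mul_assoc,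
    ← mul_assoc, ← map_mul, ← map_mul,
    show fn φ hφ (deriv f) * y = y * fn φ hφ (deriv f) from Algebra.commutes _ y, add_comm] at h1
  exact add_left_cancel h1

theorem inc_fn_mul (f : SmoothI) (w : Forms φ hφ) :
    inc φ hφ (fn φ hφ f) * w = w * inc φ hφ (fn φ hφ f) := by
  induction w using FormsMod.induction with
  | h0 y =>
    rw [← map_mul, ← map_mul]
    exact congrArg _ (Algebra.commutes f y)
  | h1 y => exact inc_fn_mul_dOf φ hφ f y
  | hadd v w hv hw => rw [mul_add, add_mul, hv, hw]
  | hmul v w hv hw => rw [← mul_assoc, hv, mul_assoc, hw, mul_assoc]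

/-- The forms are an algebra over the smooth functions of `t`. -/
instance formsAlgebra : Algebra SmoothI (Forms φ hφ) :=
  RingHom.toAlgebra' ((inc φ hφ).toRingHom.comp (algebraMap SmoothI (S4 φ hφ)))
    (inc_fn_mul φ hφ)

theorem smul_eq (f : SmoothI) (w : Forms φ hφ) : f • w = inc φ hφ (fn φ hφ f) * w := rfl

theorem inc_smul (f : SmoothI) (y : S4 φ hφ) : inc φ hφ (f • y) = f • inc φ hφ y := by
  rw [smul_eq, ← map_mul]
  exact congrArg _ (Algebra.smul_def f y)

theorem d_smul (f : SmoothI) (w : Forms φ hφ) :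
    d φ hφ (f • w) = f • d φ hφ w + deriv f • (dOf φ hφ (t φ hφ) * w) := by
  rw [smul_eq, FormsMod.d_incl_mul, dOf_fn, smul_eq, smul_eq, mul_assoc]

/-- The differential of `y dt = dt y`. -/
theorem dOf_mul_dt (y : S4 φ hφ) :
    dOf φ hφ y * dOf φ hφ (t φ hφ) = -(dOf φ hφ (t φ hφ) * dOf φ hφ y) := by
  have h := congrArg (d φ hφ) (inc_mul_dt φ hφ y)
  rwa [FormsMod.d_mul_dincl, FormsMod.d_dincl_mul, FormsMod.d_incl] at h

theorem eq_zero_of_eq_neg {w : Forms φ hφ} (h : w = -w) : w = 0 := by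
  have h2 : (2 : ℂ) • w = 0 := by rw [two_smul]; nth_rewrite 2 [h]; exact add_neg_cancel w
  exact (smul_eq_zero.1 h2).resolve_left two_ne_zero

theorem dt_mul_dt : dOf φ hφ (t φ hφ) * dOf φ hφ (t φ hφ) = 0 :=
  eq_zero_of_eq_neg φ hφ (dOf_mul_dt φ hφ _)

theorem mkAlgHom_ι (i : Fin 4) :
    RingQuot.mkAlgHom SmoothI (SphereRel φ hφ) (FreeAlgebra.ι SmoothI i) = x φ hφ i := by
  rw [x, ← RingQuot.mkAlgHom_coe SmoothI]
  rfl

set_option synthInstance.maxHeartbeats 100000 in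
theorem x_mul_x (i j : Fin 4) : x φ hφ i * x φ hφ j = matA φ hφ i j • (x φ hφ j * x φ hφ i) := by
  have h := RingQuot.mkAlgHom_rel SmoothI (SphereRel.comm (φ := φ) (hφ := hφ) i j)
  rwa [map_mul, map_smul, map_mul, mkAlgHom_ι, mkAlgHom_ι] at h

set_option synthInstance.maxHeartbeats 100000 in
theorem x_sphere : x φ hφ 0 * x φ hφ 1 + x φ hφ 2 * x φ hφ 3 + (coord ^ 2) • (1 : S4 φ hφ) = 1 := by
  have h := RingQuot.mkAlgHom_rel SmoothI (SphereRel.sphere (φ := φ) (hφ := hφ))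
  rw [map_add, map_add, map_mul, map_mul, mkAlgHom_ι, mkAlgHom_ι, mkAlgHom_ι, mkAlgHom_ι,
    AlgHom.commutes, map_one] at h
  rw [← Algebra.algebraMap_eq_smul_one]
  exact h

theorem inc_x_mul_inc_x (i j : Fin 4) : inc φ hφ (x φ hφ i) * inc φ hφ (x φ hφ j) =
    matA φ hφ i j • (inc φ hφ (x φ hφ j) * inc φ hφ (x φ hφ i)) := by
  rw [← map_mul, x_mul_x, inc_smul, map_mul]

theorem fn_smul (c : ℂ) (f : SmoothI) : fn φ hφ (c • f) = c • fn φ hφ f := by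
  rw [Algebra.smul_def, fn_mul, Algebra.smul_def]
  rfl

theorem smul_smul_forms (c : ℂ) (f : SmoothI) (w : Forms φ hφ) : (c • f) • w = c • f • w := by
  rw [smul_eq, smul_eq, fn_smul, map_smul, smul_mul_assoc]

theorem x_mul_dx (i j : Fin 4) : inc φ hφ (x φ hφ i) * dOf φ hφ (x φ hφ j) =
    matA φ hφ i j • (dOf φ hφ (x φ hφ j) * inc φ hφ (x φ hφ i)) +
      ((1 / 2 : ℂ) • matB φ hφ i j) • (dOf φ hφ (t φ hφ) *
        (inc φ hφ (x φ hφ i) * inc φ hφ (x φ hφ j))) := by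
  have h := FormsMod.proj_eq_zero_of_mem (CalcRel.comm (φ := φ) (hφ := hφ) i j)
  rw [map_sub, map_add, map_smul, map_mul, map_mul, map_mul, map_mul, map_mul, sub_eq_zero] at h
  rw [smul_smul_forms, smul_eq, smul_eq, ← mul_assoc, ← mul_assoc, ← map_mul]
  exact h

theorem half_matB_swap (i j : Fin 4) :
    (1 / 2 : ℂ) • matB φ hφ j i = -((1 / 2 : ℂ) • matB φ hφ i j) := by
  rw [matB_swap, smul_neg]

/-- The defining relation solved for `dx^j x^i`, using `A_ji A_ij = 1` and the antisymmetry of `B`.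
-/
theorem dx_mul_x (i j : Fin 4) : dOf φ hφ (x φ hφ j) * inc φ hφ (x φ hφ i) =
    matA φ hφ j i • (inc φ hφ (x φ hφ i) * dOf φ hφ (x φ hφ j)) +
      ((1 / 2 : ℂ) • matB φ hφ j i) • (inc φ hφ (x φ hφ j) *
        (inc φ hφ (x φ hφ i) * dOf φ hφ (t φ hφ))) := by
  have hA : matA φ hφ j i * matA φ hφ i j = 1 := matA_mul_matA φ hφ j i
  have h := congrArg (fun z => matA φ hφ j i • z) (x_mul_dx φ hφ i j)
  have h1 : matA φ hφ j i • (dOf φ hφ (t φ hφ) * (inc φ hφ (x φ hφ i) * inc φ hφ (x φ hφ j))) =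
      inc φ hφ (x φ hφ j) * (inc φ hφ (x φ hφ i) * dOf φ hφ (t φ hφ)) := by
    rw [inc_mul_dt, ← mul_assoc (inc φ hφ (x φ hφ j)), inc_mul_dt, mul_assoc,
      inc_x_mul_inc_x φ hφ j i, mul_smul_comm]
  simp only [smul_add, smul_smul, hA, one_smul] at h
  rw [h, mul_comm (matA φ hφ j i), mul_smul, h1, half_matB_swap φ hφ i j, neg_smul, add_neg_cancel_right]

/-- The differential of the relation for `x^j dx^i`. Differentiating `A_ji` gives twice the term `½
B_ji x^j dt dx^i`, and one copy is removed by differentiating the term with `½ B_ji dt`. -/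
theorem d_dx_mul_x (i j : Fin 4) : dOf φ hφ (x φ hφ j) * dOf φ hφ (x φ hφ i) =
    -(matA φ hφ j i • (dOf φ hφ (x φ hφ i) * dOf φ hφ (x φ hφ j))) +
      ((1 / 2 : ℂ) • matB φ hφ j i) • (inc φ hφ (x φ hφ j) *
          (dOf φ hφ (t φ hφ) * dOf φ hφ (x φ hφ i)) -
        matA φ hφ j i • (inc φ hφ (x φ hφ i) *
          (dOf φ hφ (t φ hφ) * dOf φ hφ (x φ hφ j)))) := by
  have h := congrArg (d φ hφ) (x_mul_dx φ hφ j i)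
  rw [map_add, d_smul, d_smul, FormsMod.d_mul_dincl, FormsMod.d_incl, FormsMod.d_dincl_mul,
    FormsMod.d_dincl_mul, FormsMod.d_incl_mul, FormsMod.d_incl, FormsMod.d_incl] at h
  have hx : ∀ (k : Fin 4) (w : Forms φ hφ), dOf φ hφ (t φ hφ) * (inc φ hφ (x φ hφ k) * w) =
      inc φ hφ (x φ hφ k) * (dOf φ hφ (t φ hφ) * w) := fun k w => by
    rw [← mul_assoc, ← inc_mul_dt, mul_assoc]
  have h0 : ∀ w : Forms φ hφ, dOf φ hφ (t φ hφ) * (dOf φ hφ (t φ hφ) * w) = 0 := fun w => by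
    rw [← mul_assoc, dt_mul_dt, zero_mul]
  have h1 := congrArg (fun z => dOf φ hφ (t φ hφ) * z) (x_mul_dx φ hφ j i)
  have h2 := congrArg (fun z => dOf φ hφ (t φ hφ) * z) (dx_mul_x φ hφ i j)
  simp only [mul_add, mul_smul_comm, h0, hx, dt_mul_dt, mul_zero, smul_zero, add_zero] at h1 h2
  have hB : deriv (matA φ hφ j i) =
      (2 : SmoothI) * ((1 / 2 : ℂ) • matB φ hφ j i) * matA φ hφ j i := by
    have h2 : (2 : SmoothI) * algebraMap ℂ SmoothI (1 / 2) = 1 := by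
      rw [← map_ofNat (algebraMap ℂ SmoothI) 2, ← map_mul]
      norm_num
    rw [deriv_matA, Algebra.smul_def, ← mul_assoc 2, h2, one_mul, mul_comm]
  rw [h, h0, smul_zero, add_zero, hB]
  simp only [mul_add, hx, h2]
  rw [mul_smul (_ * _), ← h1]
  generalize (1 / 2 : ℂ) • matB φ hφ j i = b
  module

theorem phaseMatrix_eq (i j : Fin 4) :
    phaseMatrix (lam φ hφ) (lamBar φ hφ) i j = matA φ hφ i j := by
  fin_cases i <;> fin_cases j <;> rfl

theorem signMatrix_eq (i j : Fin 4) :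
    signMatrix ((1 / 2 : ℂ) • matB φ hφ 0 2) i j = (1 / 2 : ℂ) • matB φ hφ i j := by
  simp only [matB_eq, signMatrix]
  fin_cases i <;> fin_cases j <;> simp [torusDegree, det₂]

/-- The calculus of `S⁴_λ` satisfies the relations of a calculus on the four-sphere. -/
def calculus : SphereCalculus SmoothI (Forms φ hφ) where
  x i := inc φ hφ (x φ hφ i)
  dx i := dOf φ hφ (x φ hφ i)
  dt := dOf φ hφ (t φ hφ)
  t := coord
  l := lam φ hφ
  l' := lamBar φ hφ
  β := (1 / 2 : ℂ) • matB φ hφ 0 2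
  l_mul_l' := matA_mul_matA φ hφ 0 2
  x_mul_x {i j} _ := by
    rw [phaseMatrix_eq]
    exact inc_x_mul_inc_x φ hφ j i
  dx_mul_x i j := by
    rw [phaseMatrix_eq, signMatrix_eq]
    exact dx_mul_x φ hφ i j
  dt_mul_x i := (inc_mul_dt φ hφ _).symm
  dx_mul_dt i := dOf_mul_dt φ hφ _
  dt_mul_dt := dt_mul_dt φ hφ
  dx_mul_self i := by
    have hA : matA φ hφ i i = 1 := by fin_cases i <;> rfl
    have h := d_dx_mul_x φ hφ i i
    rw [hA, one_smul, one_smul, sub_self, smul_zero, add_zero] at h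
    exact eq_zero_of_eq_neg φ hφ h
  dx_mul_dx {i j} _ := by
    rw [phaseMatrix_eq, signMatrix_eq]
    exact d_dx_mul_x φ hφ i j
  sphere := by
    have h := congrArg (inc φ hφ) (x_sphere φ hφ)
    rwa [map_add, map_add, map_mul, map_mul, inc_smul, map_one] at h
  d_sphere := by
    have h := FormsMod.proj_eq_zero_of_mem (CalcRel.sphere (φ := φ) (hφ := hφ))
    simp only [map_add, map_mul, map_ofNat] at h
    rw [mul_smul, ofNat_smul_eq_nsmul, nsmul_eq_mul, smul_eq φ hφ coord, ← mul_assoc]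
    exact h

end S4

end Calculus

namespace FormsMod

open UnivForms

variable {A : Type} [Ring A] [Algebra ℂ A] {S : Set (UnivForms A)}

theorem d_mul_incl (hS : ∀ s ∈ S, parity s = -s) (x : A) {n : ℕ} {w : FormsMod S}
    (hw : w ∈ deg S n) :
    d hS (w * incl S x) = d hS w * incl S x + (-1 : ℂ) ^ n • (w * dincl S x) := by
  induction n generalizing x w with
  | zero =>
    induction hw using Submodule.span_induction with
    | mem w h =>
      obtain ⟨v, rfl⟩ := h
      rw [monomial_apply, List.ofFn_zero, List.prod_nil, mul_one, d_incl_mul, d_incl, d_incl,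
        pow_zero, one_smul, add_comm]
    | zero => simp
    | add a b _ _ ha hb => rw [add_mul, map_add, ha, hb, map_add, add_mul, add_mul, smul_add]; abel
    | smul c a _ ha =>
      rw [smul_mul_assoc, map_smul, ha, map_smul, smul_mul_assoc, smul_mul_assoc, smul_add,
        smul_comm c]
  | succ n ih =>
    refine deg_succ n (P := fun w => d hS (w * incl S x) =
      d hS w * incl S x + (-1 : ℂ) ^ (n + 1) • (w * dincl S x)) ?_ ?_ ?_ ?_ hw
    · simp
    · intro a b ha hb
      rw [add_mul, map_add, ha, hb, map_add, add_mul, add_mul, smul_add]; abel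
    · intro c a ha
      rw [smul_mul_assoc, map_smul, ha, map_smul, smul_mul_assoc, smul_mul_assoc, smul_add,
        smul_comm c]
    · intro w hw y
      -- The Leibniz rule moves `x` past `dy` and reduces the claim to the form `w` of lower degree.
      have h : w * dincl S y * incl S x = w * dincl S (y * x) - w * incl S y * dincl S x := by
        rw [dincl_mul]; noncomm_ring
      rw [h, map_sub, d_mul_dincl, d_mul_dincl, d_mul_dincl, ih y hw, dincl_mul, pow_succ]
      simp only [mul_add, add_mul, mul_assoc, smul_mul_assoc, mul_neg, mul_one, neg_smul]
      abel

end FormsMod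

section Calculus

variable (φ : ℝ → ℝ) (hφ : ContDiffOn ℝ ∞ φ (Set.Icc (-1) 1))

namespace S4

/-! ### The four-forms -/

theorem omega_eq : omega φ hφ = (1 / 4 : ℂ) • (calculus φ hφ).W := by
  have h : ∀ w : Forms φ hφ, (2 : SmoothI) • w = (2 : ℂ) • w := fun w => by
    rw [ofNat_smul_eq_nsmul SmoothI, ofNat_smul_eq_nsmul ℂ]
  rw [SphereCalculus.W, h, h, smul_eq]
  simp only [omega, SphereCalculus.E, SphereCalculus.F, mul_assoc]
  rfl

theorem W_eq : (calculus φ hφ).W = (4 : ℂ) • omega φ hφ := by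
  rw [omega_eq, smul_smul]
  norm_num

theorem inc_mem_coords (y : S4 φ hφ) : inc φ hφ y ∈ (calculus φ hφ).coords := by
  induction y using S4.induction with
  | hf f => exact Subalgebra.algebraMap_mem _ f
  | hx i => exact Algebra.subset_adjoin ⟨i, rfl⟩
  | hadd y z hy hz => rw [map_add]; exact add_mem hy hz
  | hmul y z hy hz => rw [map_mul]; exact mul_mem hy hz

theorem exists_inc_eq {w : Forms φ hφ} (hw : w ∈ (calculus φ hφ).coords) :
    ∃ y, inc φ hφ y = w := by
  induction hw using Algebra.adjoin_induction with
  | mem w h => obtain ⟨i, rfl⟩ := h; exact ⟨x φ hφ i, rfl⟩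
  | algebraMap f => exact ⟨fn φ hφ f, rfl⟩
  | add a b _ _ ha hb =>
    obtain ⟨y, rfl⟩ := ha
    obtain ⟨z, rfl⟩ := hb
    exact ⟨y + z, map_add _ _ _⟩
  | mul a b _ _ ha hb =>
    obtain ⟨y, rfl⟩ := ha
    obtain ⟨z, rfl⟩ := hb
    exact ⟨y * z, map_mul _ _ _⟩

theorem dOf_mem_forms (y : S4 φ hφ) : dOf φ hφ y ∈ (calculus φ hφ).forms 1 := by
  have hsmul : ∀ {y : S4 φ hφ} {w : Forms φ hφ}, w ∈ (calculus φ hφ).forms 1 →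
      inc φ hφ y * w ∈ (calculus φ hφ).forms 1 := fun {y w} hw =>
    Submodule.smul_mem _ (⟨_, inc_mem_coords φ hφ y⟩ : (calculus φ hφ).coords) hw
  induction y using S4.induction with
  | hf f =>
    rw [dOf_fn]
    exact hsmul (SphereCalculus.word_mem_forms _ (Or.inl rfl))
  | hx i =>
    refine SphereCalculus.word_mem_forms _ (Or.inr ?_)
    fin_cases i
    · exact Or.inl rfl
    · exact Or.inr (Or.inl rfl)
    · exact Or.inr (Or.inr (Or.inl rfl))
    · exact Or.inr (Or.inr (Or.inr rfl))
  | hadd y z hy hz => rw [map_add]; exact add_mem hy hz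
  | hmul y z hy hz =>
    rw [FormsMod.dincl_mul]
    exact add_mem (hsmul hz) (SphereCalculus.forms_one_mul_coords_mem _ hy
      (inc_mem_coords φ hφ z))

instance : Invertible (2 : SmoothI) where
  invOf := algebraMap ℂ SmoothI (1 / 2)
  invOf_mul_self := by
    rw [← map_ofNat (algebraMap ℂ SmoothI) 2, ← map_mul]
    norm_num
  mul_invOf_self := by
    rw [← map_ofNat (algebraMap ℂ SmoothI) 2, ← map_mul]
    norm_num

theorem exists_eq_inc_mul_omega {w : Forms φ hφ} (hw : w ∈ nForms φ hφ 4) :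
    ∃ y, w = inc φ hφ y * omega φ hφ := by
  induction hw using Submodule.span_induction with
  | mem w h =>
    obtain ⟨v, rfl⟩ := h
    obtain ⟨y, hy, h⟩ := (calculus φ hφ).exists_eq_mul_W (dOf_mem_forms φ hφ (v 1))
      (dOf_mem_forms φ hφ (v 2)) (dOf_mem_forms φ hφ (v 3)) (dOf_mem_forms φ hφ (v 4))
    obtain ⟨z, rfl⟩ := exists_inc_eq φ hφ hy
    -- The factor comes from `W = 4ω`.
    refine ⟨(4 : ℂ) • (v 0 * z), ?_⟩
    rw [map_smul, smul_mul_assoc, ← mul_smul_comm, ← W_eq, map_mul, mul_assoc, ← h,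
      FormsMod.monomial_apply]
    simp [List.ofFn_succ]
  | zero => exact ⟨0, by simp⟩
  | add a b _ _ ha hb =>
    obtain ⟨y, rfl⟩ := ha
    obtain ⟨z, rfl⟩ := hb
    exact ⟨y + z, by rw [map_add, add_mul]⟩
  | smul c a _ ha =>
    obtain ⟨y, rfl⟩ := ha
    exact ⟨c • y, by rw [map_smul, smul_mul_assoc]⟩

theorem omega_mul_inc (y : S4 φ hφ) : omega φ hφ * inc φ hφ y = inc φ hφ y * omega φ hφ := by
  rw [omega_eq, smul_mul_assoc, mul_smul_comm,
    SphereCalculus.W_mul_coords _ (inc_mem_coords φ hφ y)]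

/-! ### Normal monomials -/

theorem x_mul_x_pow (i j : Fin 4) (n : ℕ) :
    x φ hφ i * x φ hφ j ^ n = matA φ hφ i j ^ n • (x φ hφ j ^ n * x φ hφ i) := by
  induction n with
  | zero => simp
  | succ n ih =>
    rw [pow_succ, ← mul_assoc, ih, smul_mul_assoc, mul_assoc, x_mul_x, mul_smul_comm, smul_smul,
      mul_assoc, pow_succ]

theorem x_mul_x_pow_mul (i j : Fin 4) (n : ℕ) (y : S4 φ hφ) :
    x φ hφ i * (x φ hφ j ^ n * y) = matA φ hφ i j ^ n • (x φ hφ j ^ n * (x φ hφ i * y)) := by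
  rw [← mul_assoc, x_mul_x_pow, smul_mul_assoc, mul_assoc]

theorem normalMonomial_eq (f : SmoothI) (i j k l : ℕ) : normalMonomial φ hφ f i j k l =
    f • (x φ hφ 0 ^ i * (x φ hφ 1 ^ j * (x φ hφ 2 ^ k * x φ hφ 3 ^ l))) := by
  rw [Algebra.smul_def]
  simp only [normalMonomial, fn, mul_assoc]

theorem x_zero_mul_normalMonomial (f : SmoothI) (i j k l : ℕ) :
    x φ hφ 0 * normalMonomial φ hφ f i j k l = normalMonomial φ hφ f (i + 1) j k l := by
  simp only [normalMonomial_eq, mul_smul_comm, pow_succ', mul_assoc]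

theorem x_one_mul_normalMonomial (f : SmoothI) (i j k l : ℕ) :
    x φ hφ 1 * normalMonomial φ hφ f i j k l =
      normalMonomial φ hφ (f * matA φ hφ 1 0 ^ i) i (j + 1) k l := by
  simp only [normalMonomial_eq, mul_smul_comm, pow_succ', mul_assoc, x_mul_x_pow_mul, smul_smul]

theorem x_two_mul_normalMonomial (f : SmoothI) (i j k l : ℕ) :
    x φ hφ 2 * normalMonomial φ hφ f i j k l =
      normalMonomial φ hφ (f * (matA φ hφ 2 0 ^ i * matA φ hφ 2 1 ^ j)) i j (k + 1) l := by
  simp only [normalMonomial_eq, mul_smul_comm, pow_succ', mul_assoc, x_mul_x_pow_mul, smul_smul]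

theorem x_three_mul_normalMonomial (f : SmoothI) (i j k l : ℕ) :
    x φ hφ 3 * normalMonomial φ hφ f i j k l =
      normalMonomial φ hφ (f * (matA φ hφ 3 0 ^ i * (matA φ hφ 3 1 ^ j * matA φ hφ 3 2 ^ k)))
        i j k (l + 1) := by
  simp only [normalMonomial_eq, mul_smul_comm, pow_succ', x_mul_x_pow_mul, smul_smul]

theorem x_pow_mul_x (i j : Fin 4) (n : ℕ) :
    x φ hφ j ^ n * x φ hφ i = matA φ hφ j i ^ n • (x φ hφ i * x φ hφ j ^ n) := by
  have h : matA φ hφ j i * matA φ hφ i j = 1 := matA_mul_matA φ hφ j i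
  rw [x_mul_x_pow, smul_smul, ← mul_pow, h, one_pow, one_smul]

theorem normalMonomial_mul_x_three (f : SmoothI) (i j k l : ℕ) :
    normalMonomial φ hφ f i j k l * x φ hφ 3 = normalMonomial φ hφ f i j k (l + 1) := by
  simp only [normalMonomial_eq, smul_mul_assoc, pow_succ, mul_assoc]

theorem normalMonomial_mul_x_two (f : SmoothI) (i j k l : ℕ) :
    normalMonomial φ hφ f i j k l * x φ hφ 2 =
      normalMonomial φ hφ (f * matA φ hφ 3 2 ^ l) i j (k + 1) l := by
  simp only [normalMonomial_eq, smul_mul_assoc, pow_succ, mul_assoc, x_pow_mul_x _ _ 2 3,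
    mul_smul_comm, smul_smul]

theorem normalMonomial_mul_x_one (f : SmoothI) (i j k l : ℕ) :
    normalMonomial φ hφ f i j k l * x φ hφ 1 =
      normalMonomial φ hφ (f * (matA φ hφ 3 1 ^ l * matA φ hφ 2 1 ^ k)) i (j + 1) k l := by
  have h : ∀ y, x φ hφ 2 ^ k * (x φ hφ 1 * y) =
      matA φ hφ 2 1 ^ k • (x φ hφ 1 * (x φ hφ 2 ^ k * y)) := fun y => by
    rw [← mul_assoc, x_pow_mul_x, smul_mul_assoc, mul_assoc]
  simp only [normalMonomial_eq, smul_mul_assoc, pow_succ _ j, mul_assoc, x_pow_mul_x _ _ 1 3,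
    mul_smul_comm, smul_smul, h]

theorem normalMonomial_mul_x_zero (f : SmoothI) (i j k l : ℕ) :
    normalMonomial φ hφ f i j k l * x φ hφ 0 =
      normalMonomial φ hφ (f * (matA φ hφ 3 0 ^ l * (matA φ hφ 2 0 ^ k * matA φ hφ 1 0 ^ j)))
        (i + 1) j k l := by
  have h : ∀ m n y, x φ hφ m ^ n * (x φ hφ 0 * y) =
      matA φ hφ m 0 ^ n • (x φ hφ 0 * (x φ hφ m ^ n * y)) := fun m n y => by
    rw [← mul_assoc, x_pow_mul_x, smul_mul_assoc, mul_assoc]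
  simp only [normalMonomial_eq, smul_mul_assoc, pow_succ _ i, mul_assoc, x_pow_mul_x _ _ 0 3,
    mul_smul_comm, smul_smul, h _ j, h _ k]

theorem normalMonomial_induction {P : S4 φ hφ → Prop}
    (hm : ∀ f i j k l, P (normalMonomial φ hφ f i j k l))
    (hadd : ∀ y z, P y → P z → P (y + z)) (y : S4 φ hφ) : P y := by
  -- Sums of normal monomials are stable under left multiplication by all of `S⁴_λ`. As `1` is a
  -- normal monomial, every element is such a sum.
  suffices h : ∀ y z : S4 φ hφ, z ∈ AddSubmonoid.closure
      {z | ∃ f i j k l, z = normalMonomial φ hφ f i j k l} → y * z ∈ AddSubmonoid.closure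
      {z | ∃ f i j k l, z = normalMonomial φ hφ f i j k l} by
    have h1 := h y 1 (AddSubmonoid.subset_closure ⟨1, 0, 0, 0, 0, by simp [normalMonomial_eq]⟩)
    rw [mul_one] at h1
    induction h1 using AddSubmonoid.closure_induction with
    | mem y h => obtain ⟨f, i, j, k, l, rfl⟩ := h; exact hm f i j k l
    | zero =>
      have := hm 0 0 0 0 0
      rwa [normalMonomial_eq, zero_smul] at this
    | add y z _ _ hy hz => exact hadd y z hy hz
  intro y
  induction y using S4.induction with
  | hf g =>
    intro z hz
    induction hz using AddSubmonoid.closure_induction with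
    | mem z h =>
      obtain ⟨f, i, j, k, l, rfl⟩ := h
      refine AddSubmonoid.subset_closure ⟨g * f, i, j, k, l, ?_⟩
      simp only [normalMonomial, fn_mul, mul_assoc]
    | zero => rw [mul_zero]; exact zero_mem _
    | add y z _ _ hy hz => rw [mul_add]; exact add_mem hy hz
  | hx a =>
    intro z hz
    induction hz using AddSubmonoid.closure_induction with
    | mem z h =>
      obtain ⟨f, i, j, k, l, rfl⟩ := h
      fin_cases a
      · exact AddSubmonoid.subset_closure ⟨_, _, _, _, _, x_zero_mul_normalMonomial φ hφ f i j k l⟩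
      · exact AddSubmonoid.subset_closure ⟨_, _, _, _, _, x_one_mul_normalMonomial φ hφ f i j k l⟩
      · exact AddSubmonoid.subset_closure ⟨_, _, _, _, _, x_two_mul_normalMonomial φ hφ f i j k l⟩
      · exact AddSubmonoid.subset_closure
          ⟨_, _, _, _, _, x_three_mul_normalMonomial φ hφ f i j k l⟩
    | zero => rw [mul_zero]; exact zero_mem _
    | add y z _ _ hy hz => rw [mul_add]; exact add_mem hy hz
  | hadd y y' hy hy' => intro z hz; rw [add_mul]; exact add_mem (hy z hz) (hy' z hz)
  | hmul y y' hy hy' => intro z hz; rw [mul_assoc]; exact hy _ (hy' z hz)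

end S4

end Calculus

section Calculus

variable (φ : ℝ → ℝ) (hφ : ContDiffOn ℝ ∞ φ (Set.Icc (-1) 1))

namespace S4

/-! ### The graded trace property -/

theorem eq_of_isIntegral {I J : nForms φ hφ 4 →ₗ[ℂ] ℂ} (hI : IsIntegral φ hφ I)
    (hJ : IsIntegral φ hφ J) : I = J := by
  have h : ∀ y : S4 φ hφ,
      I ⟨inc φ hφ y * omega φ hφ, FormsMod.incl_mul_mem _ (omega_mem φ hφ)⟩ =
      J ⟨inc φ hφ y * omega φ hφ, FormsMod.incl_mul_mem _ (omega_mem φ hφ)⟩ := fun y => by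
    induction y using normalMonomial_induction with
    | hm f i j k l => exact (hI f i j k l).trans (hJ f i j k l).symm
    | hadd y z hy hz =>
      have h1 : (⟨inc φ hφ (y + z) * omega φ hφ, FormsMod.incl_mul_mem _ (omega_mem φ hφ)⟩ :
          nForms φ hφ 4) =
          ⟨inc φ hφ y * omega φ hφ, FormsMod.incl_mul_mem _ (omega_mem φ hφ)⟩ +
          ⟨inc φ hφ z * omega φ hφ, FormsMod.incl_mul_mem _ (omega_mem φ hφ)⟩ :=
        Subtype.ext (by simp [add_mul])
      rw [h1, map_add, map_add, hy, hz]
  ext ⟨w, hw⟩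
  obtain ⟨y, rfl⟩ := exists_eq_inc_mul_omega φ hφ hw
  exact h y

/-- Coefficients need to be compared only for balanced exponents, as all other monomials integrate
to zero. -/
theorem integral_normalMonomial_eq (f g : SmoothI) (i j k l : ℕ)
    (h : i = j → k = l → f = g) :
    integral φ hφ (inc φ hφ (normalMonomial φ hφ f i j k l) * omega φ hφ) =
      integral φ hφ (inc φ hφ (normalMonomial φ hφ g i j k l) * omega φ hφ) := by
  rw [integral_normalMonomial, integral_normalMonomial]
  by_cases h0 : i = j ∧ k = l
  · rw [h h0.1 h0.2]
  · rw [classicalIntegral_eq_zero f h0, classicalIntegral_eq_zero g h0]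

/-- Both products are the same monomial up to powers of `λ` and `λ̄`. These come from passing
conjugate generators, and cancel when the exponents of the product are balanced. -/
theorem integral_x_mul_normalMonomial (a : Fin 4) (f : SmoothI) (i j k l : ℕ) :
    integral φ hφ (inc φ hφ (x φ hφ a * normalMonomial φ hφ f i j k l) * omega φ hφ) =
      integral φ hφ (inc φ hφ (normalMonomial φ hφ f i j k l * x φ hφ a) * omega φ hφ) := by
  have h : lam φ hφ * lamBar φ hφ = 1 := matA_mul_matA φ hφ 0 2
  have h' : lamBar φ hφ * lam φ hφ = 1 := matA_mul_matA φ hφ 2 0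
  fin_cases a
  · change integral φ hφ (inc φ hφ (x φ hφ 0 * _) * _) =
      integral φ hφ (inc φ hφ (_ * x φ hφ 0) * _)
    rw [x_zero_mul_normalMonomial, normalMonomial_mul_x_zero]
    refine integral_normalMonomial_eq φ hφ _ _ _ _ _ _ ?_
    rintro rfl rfl
    simp [matA, ← mul_pow, h]
  · change integral φ hφ (inc φ hφ (x φ hφ 1 * _) * _) =
      integral φ hφ (inc φ hφ (_ * x φ hφ 1) * _)
    rw [x_one_mul_normalMonomial, normalMonomial_mul_x_one]
    refine integral_normalMonomial_eq φ hφ _ _ _ _ _ _ ?_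
    rintro rfl rfl
    simp [matA, ← mul_pow, h']
  · change integral φ hφ (inc φ hφ (x φ hφ 2 * _) * _) =
      integral φ hφ (inc φ hφ (_ * x φ hφ 2) * _)
    rw [x_two_mul_normalMonomial, normalMonomial_mul_x_two]
    refine integral_normalMonomial_eq φ hφ _ _ _ _ _ _ ?_
    rintro rfl rfl
    simp [matA, ← mul_pow, h']
  · change integral φ hφ (inc φ hφ (x φ hφ 3 * _) * _) =
      integral φ hφ (inc φ hφ (_ * x φ hφ 3) * _)
    rw [x_three_mul_normalMonomial, normalMonomial_mul_x_three]
    refine integral_normalMonomial_eq φ hφ _ _ _ _ _ _ ?_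
    rintro rfl rfl
    simp [matA, ← mul_pow, h]

/-- It is enough to commute generators, since `(y y') z` can be cycled through `(y' z) y` to `(z y)
y'`. -/
theorem integral_mul_omega_comm (y z : S4 φ hφ) :
    integral φ hφ (inc φ hφ (y * z) * omega φ hφ) =
      integral φ hφ (inc φ hφ (z * y) * omega φ hφ) := by
  induction y using S4.induction generalizing z with
  | hf f => exact congrArg (fun y => integral φ hφ (inc φ hφ y * _)) (Algebra.commutes f z)
  | hx a =>
    induction z using normalMonomial_induction with
    | hm f i j k l => exact integral_x_mul_normalMonomial φ hφ a f i j k l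
    | hadd y z hy hz => simp only [mul_add, add_mul, map_add, hy, hz]
  | hadd y y' hy hy' => simp only [mul_add, add_mul, map_add, hy, hy']
  | hmul y y' hy hy' => rw [mul_assoc, hy, mul_assoc, hy', mul_assoc]

theorem integral_inc_mul_comm (y : S4 φ hφ) {w : Forms φ hφ} (hw : w ∈ nForms φ hφ 4) :
    integral φ hφ (inc φ hφ y * w) = integral φ hφ (w * inc φ hφ y) := by
  obtain ⟨z, rfl⟩ := exists_eq_inc_mul_omega φ hφ hw
  rw [mul_assoc (inc φ hφ z), omega_mul_inc, ← mul_assoc, ← mul_assoc, ← map_mul, ← map_mul,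
    integral_mul_omega_comm]

/-- Both `d(y w)` and `d(w y)` have integral zero, and the terms with `dw` agree by the trace
property in degree four. -/
theorem integral_dOf_mul_comm (y : S4 φ hφ) {w : Forms φ hφ} (hw : w ∈ nForms φ hφ 3) :
    integral φ hφ (dOf φ hφ y * w) = -integral φ hφ (w * dOf φ hφ y) := by
  have h1 := integral_d φ hφ (inc φ hφ y * w)
  have h2 := integral_d φ hφ (w * inc φ hφ y)
  rw [FormsMod.d_incl_mul, map_add, integral_inc_mul_comm φ hφ y (FormsMod.d_mem _ hw)] at h1
  rw [FormsMod.d_mul_incl _ _ hw, map_add, map_smul, smul_eq_mul] at h2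
  linear_combination h1 - h2

theorem integral_mul_comm {p q : ℕ} (h : p + q = 4) {ρ σ : Forms φ hφ}
    (hρ : ρ ∈ nForms φ hφ p) (hσ : σ ∈ nForms φ hφ q) :
    integral φ hφ (ρ * σ) = (-1) ^ (p * q) * integral φ hφ (σ * ρ) := by
  induction q generalizing p ρ σ with
  | zero =>
    obtain rfl : p = 4 := h
    induction hσ using Submodule.span_induction with
    | mem σ h =>
      obtain ⟨v, rfl⟩ := h
      rw [FormsMod.monomial_apply, List.ofFn_zero, List.prod_nil, mul_one,
        integral_inc_mul_comm φ hφ _ hρ]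
      simp
    | zero => simp
    | add a b _ _ ha hb => rw [mul_add, add_mul, map_add, map_add, ha, hb, mul_add]
    | smul c a _ ha =>
      rw [mul_smul_comm, smul_mul_assoc, map_smul, map_smul, ha, smul_eq_mul, smul_eq_mul]
      ring
  | succ q ih =>
    refine FormsMod.deg_succ q (P := fun σ => integral φ hφ (ρ * σ) =
      (-1) ^ (p * (q + 1)) * integral φ hφ (σ * ρ)) ?_ ?_ ?_ ?_ hσ
    · simp
    · intro a b ha hb
      rw [mul_add, add_mul, map_add, map_add, ha, hb]
      ring
    · intro c a ha
      rw [mul_smul_comm, smul_mul_assoc, map_smul, map_smul, ha, smul_eq_mul, smul_eq_mul]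
      ring
    -- The last differential of `z dy` is cycled to the front of `ρ`, after which induction applies
    -- to `dy ρ` and `z`.
    · intro z hz y
      have h3 : p + q = 3 := by omega
      have h4 : ρ * z ∈ nForms φ hφ 3 := h3 ▸ FormsMod.mul_mem hρ hz
      have h5 := integral_dOf_mul_comm φ hφ y h4
      have h6 : dOf φ hφ y * ρ ∈ nForms φ hφ (p + 1) :=
        add_comm 1 p ▸ FormsMod.mul_mem (FormsMod.dincl_mem y) hρ
      have h7 := ih (by omega) h6 hz
      rw [← mul_assoc, ← neg_eq_iff_eq_neg.2 h5, ← mul_assoc, h7, ← mul_assoc,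
        ← neg_one_mul, ← mul_assoc, ← pow_succ']
      congr 1
      -- The collected sign agrees with the desired one because the two exponents have an even sum
      -- when `p + q = 3`.
      have h8 : (p + 1) * q + 1 + p * (q + 1) = 2 * (p * q + 2) := by
        have : (p + 1) * q + 1 + p * (q + 1) = 2 * (p * q) + (p + q) + 1 := by ring
        omega
      have h9 : ((-1 : ℂ) ^ ((p + 1) * q + 1)) * (-1) ^ (p * (q + 1)) = 1 := by
        rw [← pow_add, h8, pow_mul, neg_one_sq, one_pow]
      have h10 : ((-1 : ℂ) ^ (p * (q + 1))) * (-1) ^ (p * (q + 1)) = 1 := by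
        rw [← pow_add, ← two_mul, pow_mul, neg_one_sq, one_pow]
      exact mul_right_cancel₀ (right_ne_zero_of_mul_eq_one h9) (h9.trans h10.symm)

/-! ### The cyclic cocycle -/

theorem isCyclicCocycle_psi {I : nForms φ hφ 4 →ₗ[ℂ] ℂ}
    (hI : I = integral φ hφ ∘ₗ (nForms φ hφ 4).subtype) : IsCyclicCocycle (psi I) := by
  have hpsi : ∀ a, psi I a = integral φ hφ (inc φ hφ (a 0) * (dOf φ hφ (a 1) *
      (dOf φ hφ (a 2) * (dOf φ hφ (a 3) * dOf φ hφ (a 4))))) := fun a => by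
    rw [hI]
    change integral φ hφ (FormsMod.monomial (CalcRel φ hφ) 4 a) = _
    rw [FormsMod.monomial_apply]
    simp [List.ofFn_succ]
  refine ⟨fun a => ?_, fun a => ?_⟩
  · have h3 : dOf φ hφ (a 2) * (dOf φ hφ (a 3) * dOf φ hφ (a 4)) ∈ nForms φ hφ 3 :=
      FormsMod.mul_mem (m := 1) (n := 2) (FormsMod.dincl_mem _)
        (FormsMod.mul_mem (m := 1) (n := 1) (FormsMod.dincl_mem _) (FormsMod.dincl_mem _))
    -- Cyclicity combines two facts: `da₀` moves to the end with a sign, and the integral of `d(a₀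
    -- a₁ da₂ da₃ da₄)` is zero.
    have h1 := integral_dOf_mul_comm φ hφ (a 0) (FormsMod.incl_mul_mem (a 1) h3)
    have h2 := integral_d φ hφ (inc φ hφ (a 0) * (inc φ hφ (a 1) *
      (dOf φ hφ (a 2) * (dOf φ hφ (a 3) * dOf φ hφ (a 4)))))
    rw [FormsMod.d_incl_mul, FormsMod.d_incl_mul, FormsMod.d_dincl_mul, FormsMod.d_dincl_mul,
      FormsMod.d_dincl] at h2
    simp only [mul_zero, neg_zero, zero_add, map_add] at h2
    rw [hpsi, hpsi]
    simp only [mul_assoc] at h1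
    change integral φ hφ (inc φ hφ (a 1) * (dOf φ hφ (a 2) *
      (dOf φ hφ (a 3) * (dOf φ hφ (a 4) * dOf φ hφ (a 0))))) = _
    linear_combination h1 - h2
  · have h4 : inc φ hφ (a 0) * (dOf φ hφ (a 1) * (dOf φ hφ (a 2) *
        (dOf φ hφ (a 3) * dOf φ hφ (a 4)))) ∈ nForms φ hφ 4 := by
      simp only [← mul_assoc]
      exact FormsMod.mul_dincl_mem _ (FormsMod.mul_dincl_mem _ (FormsMod.mul_dincl_mem _
        (FormsMod.mul_dincl_mem _ (FormsMod.incl_mem _))))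
    have h := integral_inc_mul_comm φ hφ (a 5) h4
    refine (congrArg (· + _) (Fin.sum_univ_five _)).trans ?_
    have e0 : psi I (Fin.contractNth 0 (· * ·) a) =
        integral φ hφ (inc φ hφ (a 0 * a 1) * (dOf φ hφ (a 2) *
          (dOf φ hφ (a 3) * (dOf φ hφ (a 4) * dOf φ hφ (a 5))))) := hpsi _
    have e1 : psi I (Fin.contractNth 1 (· * ·) a) =
        integral φ hφ (inc φ hφ (a 0) * (dOf φ hφ (a 1 * a 2) *
          (dOf φ hφ (a 3) * (dOf φ hφ (a 4) * dOf φ hφ (a 5))))) := hpsi _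
    have e2 : psi I (Fin.contractNth 2 (· * ·) a) =
        integral φ hφ (inc φ hφ (a 0) * (dOf φ hφ (a 1) *
          (dOf φ hφ (a 2 * a 3) * (dOf φ hφ (a 4) * dOf φ hφ (a 5))))) := hpsi _
    have e3 : psi I (Fin.contractNth 3 (· * ·) a) =
        integral φ hφ (inc φ hφ (a 0) * (dOf φ hφ (a 1) *
          (dOf φ hφ (a 2) * (dOf φ hφ (a 3 * a 4) * dOf φ hφ (a 5))))) := hpsi _
    have e4 : psi I (Fin.contractNth 4 (· * ·) a) =
        integral φ hφ (inc φ hφ (a 0) * (dOf φ hφ (a 1) *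
          (dOf φ hφ (a 2) * (dOf φ hφ (a 3) * dOf φ hφ (a 4 * a 5))))) := hpsi _
    have e5 : psi I (Fin.cons (a (Fin.last 5) * a 0) (fun i : Fin 4 => a i.castSucc.succ)) =
        integral φ hφ (inc φ hφ (a 5 * a 0) * (dOf φ hφ (a 1) *
          (dOf φ hφ (a 2) * (dOf φ hφ (a 3) * dOf φ hφ (a 4))))) := hpsi _
    change (-1) ^ 0 * psi I (Fin.contractNth 0 (· * ·) a) +
      (-1) ^ 1 * psi I (Fin.contractNth 1 (· * ·) a) +
      (-1) ^ 2 * psi I (Fin.contractNth 2 (· * ·) a) +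
      (-1) ^ 3 * psi I (Fin.contractNth 3 (· * ·) a) +
      (-1) ^ 4 * psi I (Fin.contractNth 4 (· * ·) a) +
      (-1) ^ 5 * psi I (Fin.cons (a (Fin.last 5) * a 0) (fun i : Fin 4 => a i.castSucc.succ)) = 0
    rw [e0, e1, e2, e3, e4, e5]
    -- By the Leibniz rule the alternating sum telescopes to `a₀ da₁ da₂ da₃ da₄ a₅`, and the trace
    -- property `h` cancels it against the last term.
    simp only [FormsMod.dincl_mul, map_mul, map_add, mul_add, add_mul, mul_assoc] at h ⊢
    linear_combination -h

end S4

end Calculus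

end

end

theorem mainTheorem4 (φ : ℝ → ℝ) (hφ : ContDiffOn ℝ ∞ φ (Set.Icc (-1) 1)) :
    (∃! I : S4.nForms φ hφ 4 →ₗ[ℂ] ℂ, S4.IsIntegral φ hφ I) ∧
    ∀ I : S4.nForms φ hφ 4 →ₗ[ℂ] ℂ, S4.IsIntegral φ hφ I →
      S4.IsClosedFunctional I ∧ S4.IsGradedTrace I ∧ IsCyclicCocycle (S4.psi I) := by
  refine ⟨⟨_, S4.isIntegral_integral φ hφ, fun J hJ =>
    S4.eq_of_isIntegral φ hφ hJ (S4.isIntegral_integral φ hφ)⟩, fun I hI => ?_⟩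
  obtain rfl := S4.eq_of_isIntegral φ hφ hI (S4.isIntegral_integral φ hφ)
  exact ⟨fun ρ _ => S4.integral_d φ hφ ρ,
    fun p q h ρ σ hρ hσ => S4.integral_mul_comm φ hφ h hρ hσ, S4.isCyclicCocycle_psi φ hφ rfl⟩
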